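/- There is an absolute constant $c$ with the following property. Let $(M,g)$ be a smooth compact Riemannian 3-manifold with (possibly empty) boundary, and let $\Sigma\subset M$ be a smooth embedded two-sided surface (without boundary, not necessarily connected or compact), with smooth unit normal field $\nu$ (the outer normal) and second fundamental form $A$ satisfying $|A|\le C$ on $\Sigma$ for some constant $C$. Let $G_\Sigma(p,s)=\exp^M_p(s\nu(p))$ be the normal exponential map, $B^\Sigma_r(x)$ the intrinsic open balls of $\Sigma$, and $\mathrm{inj}(M,g;\Sigma)$ the infimum over $p\in\Sigma$ of the injectivity radii of $(M,g)$ at $p$. Let $$i^+(\Sigma)=\sup\{\delta\le \mathrm{dist}(\Sigma,\partial M) : G_\Sigma|_{\Sigma\times[0,\delta)}\ \text{is injective}\},$$ and let $i_0^+(\Sigma)$ be any number $r$ with $0<r<\mathrm{inj}(M,g;\Sigma)$ such that for every $x\in\Sigma$ the map $G_\Sigma|_{B^\Sigma_r(x)\times[0,r)}$ is a diffeomorphism onto its image, and such that for every $x\in\Sigma$ and $s\in[0,r)$ the sheet $\Sigma^s_{x,r}=G_\Sigma(B^\Sigma_r(x),s)$ is a disc whose second fundamental form satisfies $\sup_{\Sigma^s_{x,r}}|A|\le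 2\sup_\Sigma|A|$. Put $\delta=\min\{i_0^+(\Sigma),i^+(\Sigma)\}$. Then $$|\Sigma|\le c\,\bigl(\delta^{-1}+\sup_\Sigma|A|\bigr)\,\mathrm{Vol}(M),$$ where $|\Sigma|$ is the area of $\Sigma$, and the right-hand side is read as $+\infty$ if $\delta=0$ and $M\neq\emptyset$. -/

import Mathlib

open Set MeasureTheory
open scoped Manifold ContDiff ENNReal NNReal

noncomputable section

namespace AreaBound

section General

variable {E : Type*} [NormedAddCommGroup E] [NormedSpace ℝ E]
  {H : Type*} [TopologicalSpace H] (I : ModelWithCorners ℝ E H)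
  (M : Type*) [TopologicalSpace M] [ChartedSpace H M]

/-- A field of real-valued forms in two tangent vectors (for instance a Riemannian metric,
or the metric induced on a submanifold). -/
abbrev FormField : Type _ := ∀ x : M, TangentSpace I x → TangentSpace I x → ℝ

variable {I M}

/-- The form field `b` in the coordinates given by the chart centred at `q`: the pullback of `b`
by the inverse of the chart, at the coordinate point `z`. -/
def chartForm (b : FormField I M) (q : M) (z v w : E) : ℝ :=
  b ((extChartAt I q).symm z)
    (mfderivWithin 𝓘(ℝ, E) I (extChartAt I q).symm (range I) z v)
    (mfderivWithin 𝓘(ℝ, E) I (extChartAt I q).symm (range I) z w)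

/-- The derivative in the direction `u` of the coefficient `b(v, w)`, in the chart at `q`. -/
def chartFormDeriv (b : FormField I M) (q : M) (z u v w : E) : ℝ :=
  fderivWithin ℝ (fun y => chartForm b q y v w) (range I) z u

/-- Christoffel symbols of the first kind of the metric `b` in the chart at `q`:
`Γ(u, v; w) = (∂_u b(v, w) + ∂_v b(u, w) - ∂_w b(u, v)) / 2`, which is `b(∇_u v, w)` for
constant coordinate fields `u, v, w` and the Levi-Civita connection `∇` of `b`. -/
def christoffel (b : FormField I M) (q : M) (z u v w : E) : ℝ :=
  (chartFormDeriv b q z u v w + chartFormDeriv b q z v u w - chartFormDeriv b q z w u v) / 2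

/-- The curve `γ`, parametrized by the interval `J`, is a geodesic: in every chart it satisfies
`b(x'', w) + Γ(x', x'; w) = 0` for all `w`, that is `x''^k + Γ^k_{ij} x'^i x'^j = 0`. -/
def IsGeodesicOn (b : FormField I M) (γ : ℝ → M) (J : Set ℝ) : Prop :=
  ContMDiffOn 𝓘(ℝ, ℝ) I ∞ γ J ∧
    ∀ q : M, ∀ t ∈ J, γ t ∈ (extChartAt I q).source → ∀ w : E,
      let x : ℝ → E := fun s => extChartAt I q (γ s)
      chartForm b q (x t) (derivWithin (derivWithin x J) J t) w
        + christoffel b q (x t) (derivWithin x J t) (derivWithin x J t) w = 0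

/-- `γ` is a geodesic on `[0, 1]` that starts at `p` with velocity `v`. -/
def IsGeodesicFrom (b : FormField I M) (p : M) (v : TangentSpace I p) (γ : ℝ → M) : Prop :=
  IsGeodesicOn b γ (Icc 0 1) ∧
    (⟨γ 0, mfderivWithin 𝓘(ℝ, ℝ) I γ (Icc 0 1) 0 (1 : ℝ)⟩ : TangentBundle I M) = ⟨p, v⟩

open Classical in
/-- The exponential map `exp_p(v)`; the value is `p` where no geodesic on `[0, 1]` exists. -/
def expMap (b : FormField I M) (p : M) (v : TangentSpace I p) : M :=
  if h : ∃ γ : ℝ → M, IsGeodesicFrom b p v γ then h.choose 1 else p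

/-- The length distance of the metric `b` (infimum of the lengths of `C^1` paths). -/
def formEDist (b : FormField I M) (x y : M) : ℝ≥0∞ :=
  letI : ∀ z : M, ENorm (TangentSpace I z) := fun z => ⟨fun v => ENNReal.ofReal √(b z v v)⟩
  Manifold.riemannianEDist I x y

end General

section Diffeo

variable {E : Type*} [NormedAddCommGroup E] [NormedSpace ℝ E]
  {H : Type*} [TopologicalSpace H] (I : ModelWithCorners ℝ E H)
  {M : Type*} [TopologicalSpace M] [ChartedSpace H M]
  {E' : Type*} [NormedAddCommGroup E'] [NormedSpace ℝ E']
  {H' : Type*} [TopologicalSpace H'] (I' : ModelWithCorners ℝ E' H')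
  {N : Type*} [TopologicalSpace N] [ChartedSpace H' N]

/-- `φ`, restricted to `U`, is a diffeomorphism onto its image. -/
def IsDiffeoOntoImage (φ : N → M) (U : Set N) : Prop :=
  ContMDiffOn I' I ∞ φ U ∧
    ∃ ψ : M → N, ContMDiffOn I I' ∞ ψ (φ '' U) ∧ LeftInvOn ψ φ U

variable {I} in
/-- The injectivity radius at `p`: the supremum of the radii `r` such that the exponential map
is defined on the ball of radius `r` in the tangent space at `p`, and is a diffeomorphism from
this ball onto its image. -/
def injRadius (b : FormField I M) (p : M) : ℝ≥0∞ :=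
  ⨆ (r : ℝ) (_ : (∀ v : TangentSpace I p, √(b p v v) < r → ∃ γ, IsGeodesicFrom b p v γ) ∧
      IsDiffeoOntoImage I 𝓘(ℝ, E) (fun v : E => expMap b p v) {v : E | √(b p v v) < r}),
    ENNReal.ofReal r

variable {I} in
/-- The form induced on `N` by the map `φ : N → M`. -/
def pullbackForm (b : FormField I M) (φ : N → M) : FormField I' N :=
  fun p v w => b (φ p) (mfderiv I' I φ p v) (mfderiv I' I φ p w)

variable {I} in
/-- `n` is a unit normal at `φ p` to the immersed submanifold `φ : N → M`. -/
def IsUnitNormalAt (b : FormField I M) (φ : N → M) (p : N) (n : TangentSpace I (φ p)) : Prop :=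
  b (φ p) n n = 1 ∧ ∀ v : TangentSpace I' p, b (φ p) n (mfderiv I' I φ p v) = 0

variable {I} in
/-- `ν` is a smooth unit normal field along `φ : N → M`. -/
def IsUnitNormalField [IsManifold I 1 M] (b : FormField I M) (φ : N → M) (ν : ∀ p : N, TangentSpace I (φ p)) :
    Prop :=
  ContMDiff I' I.tangent ∞ (fun p : N => (⟨φ p, ν p⟩ : TangentBundle I M)) ∧
    ∀ p : N, IsUnitNormalAt I' b φ p (ν p)

variable {I} in
/-- The second fundamental form at `p` of the immersion `φ : N → M` with respect to the normal
`n`, namely `A(v, w) = -b(n, ∇_v (dφ w))`, in the coordinates given by the charts centred at `p`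
and at `φ p`. -/
def secondFundForm (b : FormField I M) (φ : N → M) (p : N) (n : TangentSpace I (φ p))
    (v w : E') : ℝ :=
  let z : E' := extChartAt I' p p
  let F : E' → E := fun y => extChartAt I (φ p) (φ ((extChartAt I' p).symm y))
  let m : E := mfderiv I 𝓘(ℝ, E) (extChartAt I (φ p)) (φ p) n;
  -(chartForm b (φ p) (F z) (fderiv ℝ (fderiv ℝ F) z v w) m
    + christoffel b (φ p) (F z) (fderiv ℝ F z v) (fderiv ℝ F z w) m)

end Diffeo

section Euclidean

variable {n : ℕ} {H : Type*} [TopologicalSpace H]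
  {I : ModelWithCorners ℝ (EuclideanSpace ℝ (Fin n)) H}
  {M : Type*} [TopologicalSpace M] [ChartedSpace H M]

/-- The matrix `(b_{ij})` of the form `b` in the chart at `q`. -/
def gramMatrix (b : FormField I M) (q : M) (z : EuclideanSpace ℝ (Fin n)) :
    Matrix (Fin n) (Fin n) ℝ :=
  Matrix.of fun i j =>
    chartForm b q z (EuclideanSpace.single i 1) (EuclideanSpace.single j 1)

/-- The measure `√(det b_{ij}) dx` of the chart at `q`, as a measure on `M` carried by the domain
of the chart. -/
def chartVolume [MeasurableSpace M] (b : FormField I M) (q : M) : Measure M :=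
  ((volume.restrict (extChartAt I q).target).withDensity
    (fun z => ENNReal.ofReal √(gramMatrix b q z).det)).map (extChartAt I q).symm

/-- The Riemannian volume measure of the metric `b`: the least measure that dominates the measures
`√(det b_{ij}) dx` of all charts. As these agree on the overlaps, it restricts to
`√(det b_{ij}) dx` on the domain of each chart. -/
def volumeMeasure [MeasurableSpace M] (b : FormField I M) : Measure M :=
  ⨆ q : M, chartVolume b q

end Euclidean

section SecondFundNorm

variable {E : Type*} [NormedAddCommGroup E] [NormedSpace ℝ E]
  {H : Type*} [TopologicalSpace H] {I : ModelWithCorners ℝ E H}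
  {M : Type*} [TopologicalSpace M] [ChartedSpace H M]
  {k : ℕ} {H' : Type*} [TopologicalSpace H']
  (I' : ModelWithCorners ℝ (EuclideanSpace ℝ (Fin k)) H')
  {N : Type*} [TopologicalSpace N] [ChartedSpace H' N]

/-- The norm `|A|` at `p` of the second fundamental form of `φ` with respect to `n`:
`|A|² = g^{ij} g^{kl} A_{ik} A_{jl}`, where `g` is the induced metric. -/
def secondFundNorm (b : FormField I M) (φ : N → M) (p : N) (n : TangentSpace I (φ p)) : ℝ :=
  let G := gramMatrix (pullbackForm I' b φ) p (extChartAt I' p p)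
  let A : Matrix (Fin k) (Fin k) ℝ := Matrix.of fun i j =>
    secondFundForm I' b φ p n (EuclideanSpace.single i 1) (EuclideanSpace.single j 1)
  √(G⁻¹ * A * (G⁻¹ * A)).trace

end SecondFundNorm

section Surface

variable {M : Type*} [TopologicalSpace M] [ChartedSpace (EuclideanHalfSpace 3) M]
  [IsManifold (𝓡∂ 3) ∞ M]
  {S : Type*} [TopologicalSpace S] [ChartedSpace (EuclideanSpace ℝ (Fin 2)) S]

/-- A smooth Riemannian metric on the 3-manifold with boundary `M`. -/
abbrev Metric3 (M : Type*) [TopologicalSpace M] [ChartedSpace (EuclideanHalfSpace 3) M]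
    [IsManifold (𝓡∂ 3) ∞ M] : Type _ :=
  Bundle.ContMDiffRiemannianMetric (𝓡∂ 3) ∞ (EuclideanSpace ℝ (Fin 3))
    (fun x : M => TangentSpace (𝓡∂ 3) x)

/-- The form field underlying a Riemannian metric. -/
def Metric3.form (g : Metric3 M) : FormField (𝓡∂ 3) M := fun x v w => g.inner x v w

/-- The volume of `(M, g)`. -/
def totalVolume [MeasurableSpace M] (g : Metric3 M) : ℝ≥0∞ := volumeMeasure g.form univ

/-- The area of the surface `f : S → M`, in the induced metric. -/
def area [MeasurableSpace S] (g : Metric3 M) (f : S → M) : ℝ≥0∞ :=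
  volumeMeasure (pullbackForm (𝓡 2) g.form f) univ

/-- The supremum of `|A|` over the surface `f : S → M` with unit normal field `ν`. -/
def supSecondFund (g : Metric3 M) (f : S → M) (ν : ∀ p : S, TangentSpace (𝓡∂ 3) (f p)) : ℝ≥0∞ :=
  ⨆ p : S, ENNReal.ofReal (secondFundNorm (𝓡 2) g.form f p (ν p))

/-- The distance in `M` from the surface to the boundary of `M` (infinite if there is none). -/
def distToBoundary (g : Metric3 M) (f : S → M) : ℝ≥0∞ :=
  ⨅ (p : S) (q ∈ (𝓡∂ 3).boundary M), formEDist g.form (f p) q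

/-- The intrinsic open ball of radius `r` around `x` in the surface. -/
def intrinsicBall (g : Metric3 M) (f : S → M) (x : S) (r : ℝ) : Set S :=
  {y | formEDist (pullbackForm (𝓡 2) g.form f) x y < ENNReal.ofReal r}

/-- The injectivity radius of `(M, g)` restricted to the surface. -/
def surfaceInjRadius (g : Metric3 M) (f : S → M) : ℝ≥0∞ := ⨅ p : S, injRadius g.form (f p)

/-- The normal exponential map `(p, s) ↦ exp_p(s ν)` of the surface. -/
def normalExp (g : Metric3 M) (f : S → M) (ν : ∀ p : S, TangentSpace (𝓡∂ 3) (f p))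
    (z : S × ℝ) : M :=
  expMap g.form (f z.1) (z.2 • ν z.1)

/-- The outer injectivity radius `i^+`: the supremum of the `δ` such that the normal exponential
map is (defined and) injective on `S × [0, δ)`. It is defined up to the distance from the surface
to the boundary of `M`. -/
def outerInjRadius (g : Metric3 M) (f : S → M) (ν : ∀ p : S, TangentSpace (𝓡∂ 3) (f p)) : ℝ≥0∞ :=
  ⨆ (δ : ℝ) (_ : ENNReal.ofReal δ ≤ distToBoundary g f ∧
      InjOn (normalExp g f ν) (univ ×ˢ Ico 0 δ)),
    ENNReal.ofReal δ

/-- `r` is a local outer injectivity radius `i_0^+` of the surface: it is positive and smaller than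
the injectivity radius of `M` along the surface; for each `x` the normal exponential map is a
diffeomorphism from `B_r(x) × [0, r)` onto its image; and for `0 ≤ s < r` the sheets, the images of
`B_r(x) × {s}`, are discs with second fundamental form bounded by `2 sup |A|`. (The norm of the
second fundamental form of a sheet is the same for its two unit normals.) -/
structure IsLocalOuterInjRadius (g : Metric3 M) (f : S → M)
    (ν : ∀ p : S, TangentSpace (𝓡∂ 3) (f p)) (r : ℝ) : Prop where
  pos : 0 < r
  lt_injRadius : ENNReal.ofReal r < surfaceInjRadius g f
  diffeo : ∀ x : S, IsDiffeoOntoImage (𝓡∂ 3) ((𝓡 2).prod 𝓘(ℝ, ℝ)) (normalExp g f ν)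
    (intrinsicBall g f x r ×ˢ Ico 0 r)
  disc : ∀ x : S, ∀ s ∈ Ico 0 r,
    Nonempty (((fun y => normalExp g f ν (y, s)) '' intrinsicBall g f x r) ≃ₜ
      Metric.ball (0 : EuclideanSpace ℝ (Fin 2)) 1)
  curvature : ∀ x : S, ∀ s ∈ Ico 0 r, ∀ y ∈ intrinsicBall g f x r,
    ∀ n : TangentSpace (𝓡∂ 3) (normalExp g f ν (y, s)),
      IsUnitNormalAt (𝓡 2) g.form (fun y' => normalExp g f ν (y', s)) y n →
        ENNReal.ofReal
          (secondFundNorm (𝓡 2) g.form (fun y' => normalExp g f ν (y', s)) y n)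
          ≤ 2 * supSecondFund g f ν

end Surface

end AreaBound

end

set_option maxSynthPendingDepth 3

noncomputable section

namespace AreaBound

open Filter Topology Bundle

section MetricInCharts

variable {E : Type*} [NormedAddCommGroup E] [NormedSpace ℝ E]
  {H : Type*} [TopologicalSpace H] {I : ModelWithCorners ℝ E H}
  {M : Type*} [TopologicalSpace M] [ChartedSpace H M] [IsManifold I ∞ M]
  {W : Type*} [NormedAddCommGroup W] [NormedSpace ℝ W]

/-- The form field of a smooth Riemannian metric. -/
def metricForm (g : ContMDiffRiemannianMetric I ∞ E (fun x : M => TangentSpace I x)) :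
    FormField I M :=
  fun x v w => g.inner x v w

variable (g : ContMDiffRiemannianMetric I ∞ E (fun x : M => TangentSpace I x))

variable (I) in
/-- The derivative of the inverse of the chart at `q`, with values in the model space. -/
def symmDeriv (q : M) (z : E) : E →L[ℝ] E :=
  mfderivWithin 𝓘(ℝ, E) I (extChartAt I q).symm (range I) z

/-- The scalar product on the tangent space at `x`, on the model space. -/
def modelInner (x : M) : E →L[ℝ] E →L[ℝ] ℝ := g.inner x

lemma modelInner_symm (x : M) (v w : E) : modelInner g x v w = modelInner g x w v :=
  g.symm x v w

lemma modelInner_pos (x : M) {v : E} (hv : v ≠ 0) : 0 < modelInner g x v v :=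
  g.pos x v hv

/-- The coefficients of a Riemannian metric in the chart at `q`, as a continuous bilinear map. -/
def chartBilin (q : M) (z : E) : E →L[ℝ] E →L[ℝ] ℝ :=
  (modelInner g ((extChartAt I q).symm z)).bilinearComp (symmDeriv I q z) (symmDeriv I q z)

lemma chartBilin_apply (q : M) (z v w : E) :
    chartBilin g q z v w
      = modelInner g ((extChartAt I q).symm z) (symmDeriv I q z v) (symmDeriv I q z w) := rfl

lemma chartForm_metricForm (q : M) (z v w : E) :
    chartForm (metricForm g) q z v w = chartBilin g q z v w := rfl

lemma chartBilin_symm (q : M) (z v w : E) : chartBilin g q z v w = chartBilin g q z w v :=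
  modelInner_symm g _ _ _

lemma symmDeriv_injective {q : M} {z : E} (hz : z ∈ (extChartAt I q).target) :
    Function.Injective (symmDeriv I q z) := by
  have : IsManifold I 1 M := IsManifold.of_le (n := ∞) (by simp)
  have h := mfderiv_extChartAt_comp_mfderivWithin_extChartAt_symm (I := I) hz
  have h2 : ∀ v : E, (show E →L[ℝ] E from mfderiv I 𝓘(ℝ, E) (extChartAt I q)
      ((extChartAt I q).symm z)) (symmDeriv I q z v) = v := fun v => DFunLike.congr_fun h v
  intro v w hvw
  rw [← h2 v, hvw, h2 w]

lemma chartBilin_pos {q : M} {z : E} (hz : z ∈ (extChartAt I q).target) {v : E} (hv : v ≠ 0) :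
    0 < chartBilin g q z v v := by
  apply modelInner_pos
  intro h
  exact hv (symmDeriv_injective (I := I) hz (h.trans (map_zero _).symm))

lemma contDiffOn_chartBilin [FiniteDimensional ℝ E] (q : M) :
    ContDiffOn ℝ ∞ (chartBilin g q) (extChartAt I q).target := by
  have : IsManifold I 1 M := IsManifold.of_le (n := ∞) (by simp)
  have : ContMDiffVectorBundle ∞ E (fun x : M => TangentSpace I x) I := inferInstance
  have hsymm : ContMDiffOn 𝓘(ℝ, E) I ∞ (extChartAt I q).symm (extChartAt I q).target :=
    contMDiffOn_extChartAt_symm q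
  have hsec : ∀ v : E, ContMDiffOn 𝓘(ℝ, E) (I.prod 𝓘(ℝ, E)) ∞
      (fun z => TotalSpace.mk' E (E := fun x : M => TangentSpace I x) ((extChartAt I q).symm z)
        (symmDeriv I q z v))
      (extChartAt I q).target := by
    intro v
    have h := (trivializationAt E (fun x : M => TangentSpace I x) q).contMDiffOn_symm (IB := I)
      (n := ∞)
    have h2 : ContMDiffOn 𝓘(ℝ, E) (I.prod 𝓘(ℝ, E)) ∞
      (fun z => ((extChartAt I q).symm z, v)) (extChartAt I q).target :=
      hsymm.prodMk contMDiffOn_const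
    have h3 := h.comp h2 (by
      intro z hz
      have := (extChartAt I q).map_target hz
      simp only [extChartAt_source] at this
      change ((extChartAt I q).symm z, v) ∈
        (trivializationAt E (fun x : M => TangentSpace I x) q).target
      rw [Trivialization.mem_target]
      simpa using this)
    refine h3.congr ?_
    intro z hz
    have hs := (extChartAt I q).map_target hz
    simp only [extChartAt_source] at hs
    simp only [Function.comp]
    rw [← Trivialization.mk_symm _ (by simpa using hs)]
    have h4 := TangentBundle.symmL_trivializationAt (I := I) hs
    have h5 := DFunLike.congr_fun h4 v
    rw [(extChartAt I q).right_inv hz] at h5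
    simp only [TotalSpace.mk']
    congr 1
    exact h5.symm.trans (Trivialization.symmL_apply (R := ℝ) _ (by simpa using hs) v)
  rw [contDiffOn_clm_apply]
  intro v
  rw [contDiffOn_clm_apply]
  intro w
  rw [← contMDiffOn_iff_contDiffOn]
  have h6 : ContMDiffOn 𝓘(ℝ, E) (I.prod 𝓘(ℝ, ℝ)) ∞
      (fun z => TotalSpace.mk' ℝ (E := Bundle.Trivial M ℝ) ((extChartAt I q).symm z)
        (chartBilin g q z v w)) (extChartAt I q).target := by
    apply ContMDiffOn.clm_bundle_apply₂ (F₁ := E) (F₂ := E)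
      (E₁ := fun x : M => TangentSpace I x) (E₂ := fun x : M => TangentSpace I x)
      (E₃ := Bundle.Trivial M ℝ) (F₃ := ℝ) (b := (extChartAt I q).symm)
      (ψ := fun z => g.inner ((extChartAt I q).symm z))
      (v := fun z => symmDeriv I q z v) (w := fun z => symmDeriv I q z w)
    · exact g.contMDiff.comp_contMDiffOn hsymm
    · exact hsec v
    · exact hsec w
  intro z hz
  have := h6 z hz
  simp only [contMDiffWithinAt_totalSpace] at this
  exact this.2

lemma chartFormDeriv_metricForm [FiniteDimensional ℝ E] {q : M} {z : E}
    (hz : z ∈ (extChartAt I q).target) (u v w : E) :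
    chartFormDeriv (metricForm g) q z u v w
      = fderivWithin ℝ (chartBilin g q) (range I) z u v w := by
  have hd : DifferentiableWithinAt ℝ (chartBilin g q) (range I) z := by
    have := (contDiffOn_chartBilin g q).differentiableOn (by simp) z hz
    exact this.mono_of_mem_nhdsWithin (extChartAt_target_mem_nhdsWithin_of_mem hz)
  have hu : UniqueDiffWithinAt ℝ (range I) z :=
    I.uniqueDiffOn z (extChartAt_target_subset_range q hz)
  unfold chartFormDeriv
  simp only [chartForm_metricForm]
  rw [((hd.hasFDerivWithinAt.clm_apply (hasFDerivWithinAt_const v z _)).clm_apply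
    (hasFDerivWithinAt_const w z _)).fderivWithin hu]
  simp

lemma symmDeriv_mfderiv {k x : M} (hx : x ∈ (extChartAt I k).source) (v : TangentSpace I x) :
    symmDeriv I k (extChartAt I k x) (mfderiv I 𝓘(ℝ, E) (extChartAt I k) x v) = v := by
  have : IsManifold I 1 M := IsManifold.of_le (n := ∞) (by simp)
  exact DFunLike.congr_fun
    (mfderivWithin_extChartAt_symm_comp_mfderiv_extChartAt' (I := I) hx) v

lemma mfderiv_symmDeriv {k x : M} (hx : x ∈ (extChartAt I k).source) (v : E) :
    (show E from mfderiv I 𝓘(ℝ, E) (extChartAt I k) x (symmDeriv I k (extChartAt I k x) v))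
      = v := by
  have : IsManifold I 1 M := IsManifold.of_le (n := ∞) (by simp)
  exact DFunLike.congr_fun
    (mfderiv_extChartAt_comp_mfderivWithin_extChartAt_symm' (I := I) hx) v

lemma symmDeriv_fderivWithin {k : M} {Φ : W → M} {D : Set W} {u : W}
    (hΦ : MDifferentiableWithinAt 𝓘(ℝ, W) I Φ D u) (hu : UniqueDiffWithinAt ℝ D u)
    (hk : Φ u ∈ (extChartAt I k).source) (c : W) :
    symmDeriv I k (extChartAt I k (Φ u)) (fderivWithin ℝ (fun y => extChartAt I k (Φ y)) D u c)
      = mfderivWithin 𝓘(ℝ, W) I Φ D u c := by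
  have : IsManifold I 1 M := IsManifold.of_le (n := ∞) (by simp)
  have hk' : Φ u ∈ (chartAt H k).source := by simpa using hk
  have hcomp : mfderivWithin 𝓘(ℝ, W) 𝓘(ℝ, E) (fun y => extChartAt I k (Φ y)) D u
      = (mfderiv I 𝓘(ℝ, E) (extChartAt I k) (Φ u)).comp (mfderivWithin 𝓘(ℝ, W) I Φ D u) :=
    mfderiv_comp_mfderivWithin (I' := I) u (mdifferentiableAt_extChartAt hk') hΦ
      hu.uniqueMDiffWithinAt
  rw [mfderivWithin_eq_fderivWithin] at hcomp
  rw [hcomp]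
  exact symmDeriv_mfderiv (I := I) hk _

lemma chartBilin_extChartAt {k x : M} (hx : x ∈ (extChartAt I k).source) (v w : E) :
    chartBilin g k (extChartAt I k x) v w
      = modelInner g x (symmDeriv I k (extChartAt I k x) v)
        (symmDeriv I k (extChartAt I k x) w) := by
  rw [chartBilin_apply, (extChartAt I k).left_inv hx]

/-- The metric, pulled back by a map `Φ` into the manifold, in a chart. -/
lemma metricForm_mfderivWithin (k : M) {Φ : W → M} {D : Set W} {u : W}
    (hΦ : MDifferentiableWithinAt 𝓘(ℝ, W) I Φ D u) (hu : UniqueDiffWithinAt ℝ D u)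
    (hk : Φ u ∈ (extChartAt I k).source) (a b : W) :
    metricForm g (Φ u) (mfderivWithin 𝓘(ℝ, W) I Φ D u a) (mfderivWithin 𝓘(ℝ, W) I Φ D u b)
      = chartBilin g k (extChartAt I k (Φ u))
        (fderivWithin ℝ (fun y => extChartAt I k (Φ y)) D u a)
        (fderivWithin ℝ (fun y => extChartAt I k (Φ y)) D u b) := by
  rw [chartBilin_extChartAt g hk, symmDeriv_fderivWithin hΦ hu hk, symmDeriv_fderivWithin hΦ hu hk]
  rfl

end MetricInCharts

lemma _root_.ContDiffWithinAt.clm_flip {V F G K : Type*} [NormedAddCommGroup V] [NormedSpace ℝ V]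
    [NormedAddCommGroup F] [NormedSpace ℝ F] [NormedAddCommGroup G] [NormedSpace ℝ G]
    [NormedAddCommGroup K] [NormedSpace ℝ K] {n : WithTop ℕ∞} {h : V → F →L[ℝ] G →L[ℝ] K} {s : Set V} {y : V}
    (hh : ContDiffWithinAt ℝ n h s y) : ContDiffWithinAt ℝ n (fun a => (h a).flip) s y :=
  (ContinuousLinearMap.flipₗᵢ ℝ F G K).contDiff.contDiffAt.comp_contDiffWithinAt y hh

section Geodesics

variable {E : Type*} [NormedAddCommGroup E] [NormedSpace ℝ E] [FiniteDimensional ℝ E]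
  {H : Type*} [TopologicalSpace H] {I : ModelWithCorners ℝ E H}
  {M : Type*} [TopologicalSpace M] [ChartedSpace H M] [IsManifold I ∞ M]
  (g : ContMDiffRiemannianMetric I ∞ E (fun x : M => TangentSpace I x))

lemma chartBilin_contDiffWithinAt {q : M} {z : E} (hz : z ∈ (extChartAt I q).target) :
    ContDiffWithinAt ℝ ∞ (chartBilin g q) (range I) z :=
  (contDiffOn_chartBilin g q z hz).mono_of_mem_nhdsWithin
    (extChartAt_target_mem_nhdsWithin_of_mem hz)

/-- The derivative of the coefficients of the metric in the chart at `q`. -/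
def chartBilinDeriv (q : M) (z : E) : E →L[ℝ] E →L[ℝ] E →L[ℝ] ℝ :=
  fderivWithin ℝ (chartBilin g q) (range I) z

lemma chartBilinDeriv_contDiffWithinAt {q : M} {z : E} (hz : z ∈ (extChartAt I q).target) :
    ContDiffWithinAt ℝ ∞ (chartBilinDeriv g q) (range I) z :=
  (chartBilin_contDiffWithinAt g hz).fderivWithin_right I.uniqueDiffOn (by simp)
    (extChartAt_target_subset_range q hz)

lemma chartBilin_hasFDerivWithinAt {q : M} {z : E} (hz : z ∈ (extChartAt I q).target) :
    HasFDerivWithinAt (chartBilin g q) (chartBilinDeriv g q z) (range I) z :=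
  ((chartBilin_contDiffWithinAt g hz).differentiableWithinAt (by simp)).hasFDerivWithinAt

lemma chartBilinDeriv_symm {q : M} {z : E} (hz : z ∈ (extChartAt I q).target) (u v w : E) :
    chartBilinDeriv g q z u v w = chartBilinDeriv g q z u w v := by
  have hd := chartBilin_hasFDerivWithinAt g hz
  have hu : UniqueDiffWithinAt ℝ (range I) z :=
    I.uniqueDiffOn z (extChartAt_target_subset_range q hz)
  have h1 := (hd.clm_apply (hasFDerivWithinAt_const v z _)).clm_apply
    (hasFDerivWithinAt_const w z _)
  have h2 := (hd.clm_apply (hasFDerivWithinAt_const w z _)).clm_apply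
    (hasFDerivWithinAt_const v z _)
  have h3 : (fun y => chartBilin g q y v w) = fun y => chartBilin g q y w v :=
    funext fun y => chartBilin_symm g q y v w
  rw [h3] at h1
  have := DFunLike.congr_fun (hu.eq h1 h2) u
  simpa using this

lemma christoffel_metricForm {q : M} {z : E} (hz : z ∈ (extChartAt I q).target) (u v w : E) :
    christoffel (metricForm g) q z u v w = (chartBilinDeriv g q z u v w
      + chartBilinDeriv g q z v u w - chartBilinDeriv g q z w u v) / 2 := by
  simp only [christoffel, chartFormDeriv_metricForm g hz]
  rfl

/-- The linear form `Γ(u, u; ·)` in the chart at `q`. -/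
def christoffelForm (q : M) (z u : E) : E →L[ℝ] ℝ :=
  chartBilinDeriv g q z u u - (1 / 2 : ℝ) • ((chartBilinDeriv g q z).flip u).flip u

lemma christoffelForm_apply {q : M} {z : E} (hz : z ∈ (extChartAt I q).target) (u w : E) :
    christoffelForm g q z u w = christoffel (metricForm g) q z u u w := by
  rw [christoffel_metricForm g hz]
  simp [christoffelForm]
  ring

lemma chartBilin_isInvertible {q : M} {z : E} (hz : z ∈ (extChartAt I q).target) :
    (chartBilin g q z).IsInvertible := by
  have hinj : Function.Injective (chartBilin g q z) := by
    rw [injective_iff_map_eq_zero]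
    intro v hv
    by_contra h
    have := chartBilin_pos g hz h
    rw [hv] at this
    simp at this
  have hfin : Module.finrank ℝ E = Module.finrank ℝ (E →L[ℝ] ℝ) := by
    rw [← Subspace.dual_finrank_eq]
    exact (LinearMap.toContinuousLinearMap (𝕜 := ℝ) (E := E) (F' := ℝ)).finrank_eq
  let e := (LinearEquiv.ofInjectiveOfFinrankEq (chartBilin g q z : E →ₗ[ℝ] E →L[ℝ] ℝ) hinj hfin)
  exact ⟨e.toContinuousLinearEquiv, by ext; rfl⟩

/-- The acceleration of a geodesic with position `y.1` and velocity `y.2` in the chart at `q`. -/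
def geodesicField (q : M) (y : E × E) : E × E :=
  (y.2, -(chartBilin g q y.1).inverse (christoffelForm g q y.1 y.2))

lemma geodesicField_contDiffWithinAt {q : M} {y : E × E} (hy : y.1 ∈ (extChartAt I q).target) :
    ContDiffWithinAt ℝ ∞ (geodesicField g q) (range I ×ˢ univ) y := by
  have hfst : ContDiffWithinAt ℝ ∞ (Prod.fst : E × E → E) (range I ×ˢ univ) y :=
    contDiffWithinAt_fst
  have hsnd : ContDiffWithinAt ℝ ∞ (Prod.snd : E × E → E) (range I ×ˢ univ) y :=
    contDiffWithinAt_snd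
  have hmaps : MapsTo (Prod.fst : E × E → E) (range I ×ˢ univ) (range I) := fun _ h => h.1
  have hB := (chartBilin_contDiffWithinAt g hy).comp y hfst hmaps
  have hD := (chartBilinDeriv_contDiffWithinAt g hy).comp y hfst hmaps
  have hinv := (chartBilin_isInvertible g hy).contDiffAt_map_inverse (n := ∞)
    |>.comp_contDiffWithinAt y hB
  have hC : ContDiffWithinAt ℝ ∞ (fun a : E × E => christoffelForm g q a.1 a.2)
      (range I ×ˢ univ) y := by
    refine ((hD.clm_apply hsnd).clm_apply hsnd).sub (ContDiffWithinAt.const_smul _ ?_)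
    exact ((hD.clm_flip.clm_apply hsnd).clm_flip).clm_apply hsnd
  exact hsnd.prodMk (hinv.clm_apply hC).neg

end Geodesics

section GeodesicUniqueness

variable {E : Type*} [NormedAddCommGroup E] [NormedSpace ℝ E]
  {H : Type*} [TopologicalSpace H] {I : ModelWithCorners ℝ E H}
  {M : Type*} [TopologicalSpace M] [ChartedSpace H M] [IsManifold I ∞ M]

/-- A curve that is smooth on `J` is smooth in charts. -/
lemma contDiffWithinAt_extChartAt_comp {γ : ℝ → M} {J : Set ℝ}
    (hγ : ContMDiffOn 𝓘(ℝ, ℝ) I ∞ γ J) {q : M} {t : ℝ} (ht : t ∈ J)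
    (hq : γ t ∈ (extChartAt I q).source) :
    ContDiffWithinAt ℝ ∞ (fun s => extChartAt I q (γ s)) J t := by
  rw [← contMDiffWithinAt_iff_contDiffWithinAt]
  exact (contMDiffAt_extChartAt' (by simpa using hq)).comp_contMDiffWithinAt t (hγ t ht)

lemma ContDiffWithinAt.derivWithin_top {x : ℝ → E} {J : Set ℝ} {t : ℝ}
    (hx : ContDiffWithinAt ℝ ∞ x J t) (hJ : UniqueDiffOn ℝ J) (ht : t ∈ J) :
    ContDiffWithinAt ℝ ∞ (derivWithin x J) J t :=
  hx.fderivWithin_right_apply contDiffWithinAt_const hJ (by simp) ht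

lemma derivWithin_extChartAt_comp {γ : ℝ → M} {J : Set ℝ}
    (hγ : ContMDiffOn 𝓘(ℝ, ℝ) I ∞ γ J) {q : M} {t : ℝ} (ht : t ∈ J) (hJ : UniqueDiffOn ℝ J)
    (hq : γ t ∈ (extChartAt I q).source) :
    derivWithin (fun s => extChartAt I q (γ s)) J t
      = mfderiv I 𝓘(ℝ, E) (extChartAt I q) (γ t) (mfderivWithin 𝓘(ℝ, ℝ) I γ J t (1 : ℝ)) := by
  have : IsManifold I 1 M := IsManifold.of_le (n := ∞) (by simp)
  have h1 := mfderiv_comp_mfderivWithin (I := 𝓘(ℝ, ℝ)) (I' := I) (I'' := 𝓘(ℝ, E)) t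
    (mdifferentiableAt_extChartAt (I := I) (x := q) (y := γ t) (by simpa using hq))
    ((hγ t ht).mdifferentiableWithinAt (by simp)) (hJ t ht).uniqueMDiffWithinAt
  rw [mfderivWithin_eq_fderivWithin] at h1
  exact DFunLike.congr_fun h1 (1 : ℝ)

variable [FiniteDimensional ℝ E]
  (g : ContMDiffRiemannianMetric I ∞ E (fun x : M => TangentSpace I x))

/-- Position and velocity of a geodesic in a chart form an integral curve of `geodesicField`. -/
lemma IsGeodesicOn.hasDerivWithinAt {γ : ℝ → M} {J : Set ℝ} (hγ : IsGeodesicOn (metricForm g) γ J)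
    (hJ : UniqueDiffOn ℝ J) {q : M} {t : ℝ} (ht : t ∈ J)
    (hq : γ t ∈ (extChartAt I q).source) :
    HasDerivWithinAt (fun s => (extChartAt I q (γ s),
        derivWithin (fun s => extChartAt I q (γ s)) J s))
      (geodesicField g q (extChartAt I q (γ t), derivWithin (fun s => extChartAt I q (γ s)) J t))
      J t := by
  have hx := contDiffWithinAt_extChartAt_comp hγ.1 ht hq
  have hx1 := (hx.differentiableWithinAt (by simp)).hasDerivWithinAt
  have hx2 := ((ContDiffWithinAt.derivWithin_top hx hJ ht).differentiableWithinAt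
    (by simp)).hasDerivWithinAt
  have hT := (extChartAt I q).map_source hq
  convert hx1.prodMk hx2 using 1
  simp only [geodesicField, Prod.mk.injEq, true_and]
  have heq := hγ.2 q t ht hq
  simp only [chartForm_metricForm] at heq
  have h2 : chartBilin g q (extChartAt I q (γ t))
      (derivWithin (derivWithin (fun s => extChartAt I q (γ s)) J) J t)
      = - christoffelForm g q (extChartAt I q (γ t))
        (derivWithin (fun s => extChartAt I q (γ s)) J t) := by
    ext w
    rw [neg_apply, christoffelForm_apply g hT]
    linarith [heq w]
  rw [← map_neg, ← h2, (chartBilin_isInvertible g hT).inverse_apply_eq]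

lemma IsGeodesicOn.locally_unique {γ₁ γ₂ : ℝ → M}
    (h₁ : IsGeodesicOn (metricForm g) γ₁ (Icc 0 1)) (h₂ : IsGeodesicOn (metricForm g) γ₂ (Icc 0 1))
    {t₀ : ℝ} (ht₀ : t₀ ∈ Ico (0 : ℝ) 1) (heq : γ₁ t₀ = γ₂ t₀)
    (hder : derivWithin (fun s => extChartAt I (γ₁ t₀) (γ₁ s)) (Icc 0 1) t₀
      = derivWithin (fun s => extChartAt I (γ₁ t₀) (γ₂ s)) (Icc 0 1) t₀) :
    ∃ ε > 0, ∀ t ∈ Icc t₀ (t₀ + ε), γ₁ t = γ₂ t := by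
  have hJ : UniqueDiffOn ℝ (Icc (0 : ℝ) 1) := uniqueDiffOn_Icc_zero_one
  have ht₀' : t₀ ∈ Icc (0 : ℝ) 1 := ⟨ht₀.1, ht₀.2.le⟩
  set q := γ₁ t₀ with hqdef
  let y : (ℝ → M) → ℝ → E × E := fun γ s => (extChartAt I q (γ s),
        derivWithin (fun s => extChartAt I q (γ s)) (Icc 0 1) s)
  have hq₁ : γ₁ t₀ ∈ (extChartAt I q).source := mem_extChartAt_source q
  have hq₂ : γ₂ t₀ ∈ (extChartAt I q).source := heq ▸ hq₁
  have hy0 : (y γ₁ t₀).1 ∈ (extChartAt I q).target := (extChartAt I q).map_source hq₁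
  have hyeq : y γ₁ t₀ = y γ₂ t₀ := by
    simp only [y, Prod.mk.injEq]
    exact ⟨congrArg (extChartAt I q) heq, hder⟩
  obtain ⟨K, U, hU, hlip⟩ := ((geodesicField_contDiffWithinAt g hy0).of_le
    (m := 1) (by simp)).exists_lipschitzOnWith (I.convex_range.prod convex_univ)
  have hev : ∀ γ : ℝ → M, IsGeodesicOn (metricForm g) γ (Icc 0 1) →
      γ t₀ ∈ (extChartAt I q).source → y γ t₀ = y γ₁ t₀ →
      ∀ᶠ t in 𝓝[≥] t₀, t ∈ Icc (0 : ℝ) 1 ∧ γ t ∈ (extChartAt I q).source ∧ y γ t ∈ U := by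
    intro γ hγ hq hy
    have hle : 𝓝[≥] t₀ ≤ 𝓝[Icc 0 1] t₀ :=
      nhdsWithin_le_iff.2 (Filter.mem_of_superset (Icc_mem_nhdsGE ht₀.2)
        (Icc_subset_Icc_left ht₀.1))
    apply hle
    have hc : ContinuousWithinAt (y γ) (Icc 0 1) t₀ :=
      (hγ.hasDerivWithinAt g hJ ht₀' hq).continuousWithinAt
    have h2 : Tendsto (y γ) (𝓝[Icc 0 1] t₀) (𝓝[range I ×ˢ univ] (y γ₁ t₀)) := by
      rw [← hy]
      refine tendsto_nhdsWithin_iff.2 ⟨hc, Eventually.of_forall fun t => ⟨?_, mem_univ _⟩⟩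
      exact ⟨chartAt H q (γ t), rfl⟩
    exact (eventually_mem_nhdsWithin).and ((((hγ.1 t₀ ht₀').continuousWithinAt).eventually
      ((isOpen_extChartAt_source q).mem_nhds hq)).and (h2 hU))
  obtain ⟨u, hu, hsub⟩ := mem_nhdsGE_iff_exists_Icc_subset.1
    ((hev γ₁ h₁ hq₁ rfl).and (hev γ₂ h₂ hq₂ hyeq.symm))
  have hu' : t₀ < u := hu
  have hode : ∀ γ : ℝ → M, IsGeodesicOn (metricForm g) γ (Icc 0 1) →
      (∀ t ∈ Icc t₀ u, t ∈ Icc (0 : ℝ) 1 ∧ γ t ∈ (extChartAt I q).source ∧ y γ t ∈ U) →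
      ContinuousOn (y γ) (Icc t₀ u) ∧
      ∀ t ∈ Ico t₀ u, HasDerivWithinAt (y γ) (geodesicField g q (y γ t)) (Ici t) t := by
    intro γ hγ h
    refine ⟨fun t ht => ?_, fun t ht => ?_⟩
    · exact ((hγ.hasDerivWithinAt g hJ (h t ht).1 (h t ht).2.1).continuousWithinAt).mono
        fun s hs => (h s hs).1
    · have ht' : t ∈ Icc t₀ u := ⟨ht.1, ht.2.le⟩
      refine (hγ.hasDerivWithinAt g hJ (h t ht').1 (h t ht').2.1).mono_of_mem_nhdsWithin ?_
      have ht1 : t < 1 := ht.2.trans_le (h u ⟨hu'.le, le_rfl⟩).1.2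
      exact Filter.mem_of_superset (Icc_mem_nhdsGE ht1) (Icc_subset_Icc_left (h t ht').1.1)
  have hA₁ := hode γ₁ h₁ fun t ht => (hsub ht).1
  have hA₂ := hode γ₂ h₂ fun t ht => (hsub ht).2
  have key := ODE_solution_unique_of_mem_Icc_right (v := fun _ => geodesicField g q)
    (s := fun _ => U) (fun _ _ => hlip) hA₁.1 hA₁.2
    (fun t ht => (hsub ⟨ht.1, ht.2.le⟩).1.2.2) hA₂.1 hA₂.2
    (fun t ht => (hsub ⟨ht.1, ht.2.le⟩).2.2.2) hyeq
  refine ⟨u - t₀, sub_pos.2 hu', fun t ht => ?_⟩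
  rw [add_sub_cancel] at ht
  have h3 := congrArg Prod.fst (key ht)
  exact (extChartAt I q).injOn (hsub ht).1.2.1 (hsub ht).2.2.1 h3

lemma IsGeodesicFrom.eqOn [T2Space M] {p : M} {v : TangentSpace I p} {γ₁ γ₂ : ℝ → M}
    (h₁ : IsGeodesicFrom (metricForm g) p v γ₁) (h₂ : IsGeodesicFrom (metricForm g) p v γ₂) :
    EqOn γ₁ γ₂ (Icc 0 1) := by
  have hJ : UniqueDiffOn ℝ (Icc (0 : ℝ) 1) := uniqueDiffOn_Icc_zero_one
  have hTB := h₁.2.trans h₂.2.symm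
  have h0 : γ₁ 0 = γ₂ 0 := congrArg TotalSpace.proj hTB
  have hc₁ : ContinuousOn γ₁ (Icc 0 1) := h₁.1.1.continuousOn
  have hc₂ : ContinuousOn γ₂ (Icc 0 1) := h₂.1.1.continuousOn
  let C : Set ℝ := {t ∈ Icc (0 : ℝ) 1 | γ₁ t = γ₂ t}
  have hC : IsClosed C := by
    have := (hc₁.prodMk hc₂).preimage_isClosed_of_isClosed isClosed_Icc isClosed_diagonal
    exact this
  let s : Set ℝ := {t | ∀ u ∈ Icc 0 t, γ₁ u = γ₂ u}
  have hsub : Icc (0 : ℝ) 1 ⊆ s := by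
    apply IsClosed.Icc_subset_of_forall_exists_gt
    · rw [← closure_subset_iff_isClosed]
      intro t ht
      have htI : t ∈ Icc (0 : ℝ) 1 :=
        isClosed_Icc.closure_subset (closure_mono inter_subset_right ht)
      refine ⟨fun u hu => ?_, htI⟩
      rcases hu.2.lt_or_eq with hlt | rfl
      · obtain ⟨t', ht', hts⟩ := mem_closure_iff.1 ht (Ioi u) isOpen_Ioi hlt
        exact hts.1 u ⟨hu.1, le_of_lt ht'⟩
      · have : u ∈ C := by
          apply hC.closure_subset
          refine closure_mono ?_ ht
          exact fun w hw => ⟨hw.2, hw.1 w ⟨hw.2.1, le_rfl⟩⟩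
        exact this.2
    · intro u hu
      have : u = 0 := le_antisymm hu.2 hu.1
      rw [this, h0]
    · rintro x ⟨hxs, hx⟩ y hy
      have hx' : x ∈ Icc (0 : ℝ) 1 := ⟨hx.1, hx.2.le⟩
      have heq : γ₁ x = γ₂ x := hxs x ⟨hx.1, le_rfl⟩
      have hder : derivWithin (fun s => extChartAt I (γ₁ x) (γ₁ s)) (Icc 0 1) x
          = derivWithin (fun s => extChartAt I (γ₁ x) (γ₂ s)) (Icc 0 1) x := by
        have hq₁ : γ₁ x ∈ (extChartAt I (γ₁ x)).source := mem_extChartAt_source _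
        have hq₂ : γ₂ x ∈ (extChartAt I (γ₁ x)).source := by rw [← heq]; exact hq₁
        rcases hx.1.eq_or_lt with rfl | hpos
        · rw [derivWithin_extChartAt_comp h₁.1.1 hx' hJ hq₁,
            derivWithin_extChartAt_comp h₂.1.1 hx' hJ hq₂]
          exact congrArg (fun w : TangentBundle I M =>
            (mfderiv I 𝓘(ℝ, E) (extChartAt I (γ₁ 0)) w.1 w.2 : E)) hTB
        · have hsubs : Icc 0 x ⊆ Icc (0 : ℝ) 1 := Icc_subset_Icc_right hx.2.le
          have hux : UniqueDiffWithinAt ℝ (Icc 0 x) x :=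
            uniqueDiffOn_Icc hpos x ⟨hpos.le, le_rfl⟩
          have hd₁ := ((contDiffWithinAt_extChartAt_comp h₁.1.1 hx' hq₁).differentiableWithinAt
            (by simp)).hasDerivWithinAt.mono hsubs
          have hd₂ := ((contDiffWithinAt_extChartAt_comp h₂.1.1 hx' hq₂).differentiableWithinAt
            (by simp)).hasDerivWithinAt.mono hsubs
          have hd₃ := hd₂.congr (f₁ := fun s => extChartAt I (γ₁ x) (γ₁ s))
            (fun u hu => congrArg (extChartAt I (γ₁ x)) (hxs u hu))
            (congrArg (extChartAt I (γ₁ x)) heq)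
          exact hux.eq_deriv _ hd₁ hd₃
      obtain ⟨ε, hε, hloc⟩ := h₁.1.locally_unique g h₂.1 hx heq hder
      refine ⟨min (x + ε) y, fun u hu => ?_, lt_min (by linarith) hy, min_le_right _ _⟩
      rcases le_total u x with hux | hux
      · exact hxs u ⟨hu.1, hux⟩
      · exact hloc u ⟨hux, hu.2.trans (min_le_left _ _)⟩
  exact fun t ht => hsub ht t ⟨ht.1, le_rfl⟩

omit [FiniteDimensional ℝ E] in
lemma IsGeodesicOn.congr {γ₁ γ₂ : ℝ → M} {J : Set ℝ} (h : IsGeodesicOn (metricForm g) γ₁ J)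
    (heq : EqOn γ₁ γ₂ J) : IsGeodesicOn (metricForm g) γ₂ J := by
  refine ⟨h.1.congr fun t ht => (heq ht).symm, fun q t ht hq w => ?_⟩
  have hx : EqOn (fun s => extChartAt I q (γ₂ s)) (fun s => extChartAt I q (γ₁ s)) J :=
    fun s hs => by simp only [heq hs]
  have hx' : EqOn (derivWithin (fun s => extChartAt I q (γ₂ s)) J)
      (derivWithin (fun s => extChartAt I q (γ₁ s)) J) J :=
    fun s hs => derivWithin_congr hx (hx hs)
  have := h.2 q t ht (by rw [heq ht]; exact hq) w
  simp only at this ⊢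
  rw [derivWithin_congr hx' (hx' ht), hx' ht]
  simp only [heq ht] at this
  exact this

lemma IsGeodesicOn.comp_mul {γ : ℝ → M} {J J' : Set ℝ} (h : IsGeodesicOn (metricForm g) γ J)
    (hJ : UniqueDiffOn ℝ J) (hJ' : UniqueDiffOn ℝ J') {a : ℝ} (ha : MapsTo (fun t => a * t) J' J) :
    IsGeodesicOn (metricForm g) (fun t => γ (a * t)) J' := by
  have hmul : ContDiff ℝ ∞ (fun t : ℝ => a * t) := contDiff_const.mul contDiff_id
  have hsm : ContMDiffOn 𝓘(ℝ, ℝ) I ∞ (fun t => γ (a * t)) J' :=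
    h.1.comp hmul.contMDiff.contMDiffOn ha
  refine ⟨hsm, fun q t ht hq w => ?_⟩
  have hmd : ∀ s, HasDerivWithinAt (fun t : ℝ => a * t) a J' s := fun s => by
    simpa using ((hasDerivAt_id s).const_mul a).hasDerivWithinAt
  have h1 : ∀ s ∈ J', γ (a * s) ∈ (extChartAt I q).source →
      derivWithin (fun s => extChartAt I q (γ (a * s))) J' s
        = a • derivWithin (fun s => extChartAt I q (γ s)) J (a * s) := by
    intro s hs hqs
    have := ((contDiffWithinAt_extChartAt_comp h.1 (ha hs) hqs).differentiableWithinAt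
      (by simp)).hasDerivWithinAt
    exact (this.scomp s (hmd s) ha).derivWithin (hJ' s hs)
  have hev : derivWithin (fun s => extChartAt I q (γ (a * s))) J' =ᶠ[𝓝[J'] t]
      fun s => a • derivWithin (fun s => extChartAt I q (γ s)) J (a * s) := by
    filter_upwards [eventually_mem_nhdsWithin, ((hsm t ht).continuousWithinAt).eventually
      ((isOpen_extChartAt_source q).mem_nhds hq)] with s hs hqs using h1 s hs hqs
  have h2 : derivWithin (derivWithin (fun s => extChartAt I q (γ (a * s))) J') J' t
      = (a * a) • derivWithin (derivWithin (fun s => extChartAt I q (γ s)) J) J (a * t) := by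
    rw [hev.derivWithin_eq (h1 t ht hq)]
    have := ((ContDiffWithinAt.derivWithin_top (contDiffWithinAt_extChartAt_comp h.1 (ha ht) hq)
      hJ (ha ht)).differentiableWithinAt (by simp)).hasDerivWithinAt
    rw [mul_smul]
    exact ((this.scomp t (hmd t) ha).const_smul a).derivWithin (hJ' t ht)
  have heq := h.2 q (a * t) (ha ht) hq w
  have hT := (extChartAt I q).map_source hq
  simp only [chartForm_metricForm] at heq ⊢
  rw [h2, h1 t ht hq]
  rw [christoffel_metricForm g hT] at heq ⊢
  simp only [map_smul, smul_apply, smul_eq_mul] at heq ⊢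
  linear_combination (a * a) * heq

omit [FiniteDimensional ℝ E] [IsManifold I ∞ M] in
/-- The initial velocity of a curve after a linear change of parameter. -/
lemma initialVelocity_comp_mul {γ : ℝ → M} {J J' : Set ℝ} (hγ : ContMDiffOn 𝓘(ℝ, ℝ) I ∞ γ J)
    (hJ' : UniqueDiffOn ℝ J') {a : ℝ} (hmaps : MapsTo (fun t => a * t) J' J) (hz : (0 : ℝ) ∈ J')
    {p : M} {v : TangentSpace I p}
    (h : (⟨γ 0, mfderivWithin 𝓘(ℝ, ℝ) I γ J 0 (1 : ℝ)⟩ : TangentBundle I M) = ⟨p, v⟩) :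
    (⟨γ (a * 0), mfderivWithin 𝓘(ℝ, ℝ) I (fun t => γ (a * t)) J' 0 (1 : ℝ)⟩ :
      TangentBundle I M) = ⟨p, a • v⟩ := by
  have h0 : (⟨γ (a * 0), mfderivWithin 𝓘(ℝ, ℝ) I γ J (a * 0) (1 : ℝ)⟩ :
      TangentBundle I M) = ⟨p, v⟩ := by
    rw [mul_zero]
    exact h
  have hsmul : ∀ {x : M} {w : TangentSpace I x}, (⟨x, w⟩ : TangentBundle I M) = ⟨p, v⟩ →
      (⟨x, a • w⟩ : TangentBundle I M) = ⟨p, a • v⟩ := by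
    intro x w hxw
    cases hxw
    rfl
  refine Eq.trans ?_ (hsmul h0)
  congr 1
  have hm : HasMFDerivWithinAt 𝓘(ℝ, ℝ) 𝓘(ℝ, ℝ) (fun t : ℝ => a * t) J' 0
      (ContinuousLinearMap.toSpanSingleton ℝ a) := by
    have h1 : HasDerivAt (fun t : ℝ => a * t) a 0 := by
      simpa using (hasDerivAt_id (0 : ℝ)).const_mul a
    exact h1.hasFDerivAt.hasMFDerivAt.hasMFDerivWithinAt
  have hg' : HasMFDerivWithinAt 𝓘(ℝ, ℝ) I γ J (a * 0)
      (mfderivWithin 𝓘(ℝ, ℝ) I γ J (a * 0)) :=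
    ((hγ (a * 0) (hmaps hz)).mdifferentiableWithinAt (by simp)).hasMFDerivWithinAt
  have hcomp := (HasMFDerivWithinAt.comp (0 : ℝ) hg' hm hmaps).mfderivWithin
    (hJ' 0 hz).uniqueMDiffWithinAt
  refine (DFunLike.congr_fun hcomp (1 : ℝ)).trans ?_
  have h2 : (ContinuousLinearMap.toSpanSingleton ℝ a) (1 : ℝ) = a • (1 : ℝ) := by simp
  change mfderivWithin 𝓘(ℝ, ℝ) I γ J (a * 0)
    ((ContinuousLinearMap.toSpanSingleton ℝ a) (1 : ℝ)) = _
  rw [h2]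
  exact map_smul (mfderivWithin 𝓘(ℝ, ℝ) I γ J (a * 0)) a (1 : ℝ)

lemma IsGeodesicFrom.comp_mul {p : M} {v : TangentSpace I p} {γ : ℝ → M}
    (h : IsGeodesicFrom (metricForm g) p v γ) {τ : ℝ} (hτ : τ ∈ Icc (0 : ℝ) 1) :
    IsGeodesicFrom (metricForm g) p (τ • v) (fun t => γ (τ * t)) := by
  have hJ : UniqueDiffOn ℝ (Icc (0 : ℝ) 1) := uniqueDiffOn_Icc_zero_one
  have hmaps : MapsTo (fun t => τ * t) (Icc (0 : ℝ) 1) (Icc 0 1) := fun t ht =>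
    ⟨mul_nonneg hτ.1 ht.1, mul_le_one₀ hτ.2 ht.1 ht.2⟩
  exact ⟨h.1.comp_mul g hJ hJ hmaps,
    initialVelocity_comp_mul h.1.1 hJ hmaps ⟨le_rfl, zero_le_one⟩ h.2⟩

lemma expMap_smul [T2Space M] {p : M} {v : TangentSpace I p} {γ : ℝ → M}
    (h : IsGeodesicFrom (metricForm g) p v γ) {τ : ℝ} (hτ : τ ∈ Icc (0 : ℝ) 1) :
    expMap (metricForm g) p (τ • v) = γ τ := by
  have h' := h.comp_mul g hτ
  have hex : ∃ γ : ℝ → M, IsGeodesicFrom (metricForm g) p (τ • v) γ := ⟨_, h'⟩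
  rw [expMap, dif_pos hex]
  have := hex.choose_spec.eqOn g h' ⟨zero_le_one, le_rfl⟩
  simpa using this

end GeodesicUniqueness

section RadialGeodesics

variable {E : Type*} [NormedAddCommGroup E] [NormedSpace ℝ E] [FiniteDimensional ℝ E]
  {H : Type*} [TopologicalSpace H] {I : ModelWithCorners ℝ E H}
  {M : Type*} [TopologicalSpace M] [T2Space M] [ChartedSpace H M] [IsManifold I ∞ M]
  (g : ContMDiffRiemannianMetric I ∞ E (fun x : M => TangentSpace I x))

/-- Within the injectivity radius, `s ↦ exp_p(s v)` is a geodesic with initial velocity `v`, for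
each unit vector `v`. -/
lemma exists_isGeodesicOn_expMap {p : M} {v : TangentSpace I p} (hv : metricForm g p v v = 1)
    {r : ℝ} (hr : 0 < r) (hinj : ENNReal.ofReal r < injRadius (metricForm g) p) :
    ∃ s₁ > r, IsGeodesicOn (metricForm g) (fun s : ℝ => expMap (metricForm g) p (s • v))
        (Icc 0 s₁) ∧
      (⟨expMap (metricForm g) p ((0 : ℝ) • v), mfderivWithin 𝓘(ℝ, ℝ) I
        (fun s : ℝ => expMap (metricForm g) p (s • v)) (Icc 0 s₁) 0 (1 : ℝ)⟩ :
        TangentBundle I M) = ⟨p, v⟩ := by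
  simp only [injRadius, lt_iSup_iff] at hinj
  obtain ⟨r₁, ⟨hex, -⟩, hlt⟩ := hinj
  have hr₁ : r < r₁ := ((ENNReal.ofReal_lt_ofReal_iff_of_nonneg hr.le).1 hlt)
  obtain ⟨s₁, hs₁, hs₁'⟩ := exists_between hr₁
  have hs₁0 : 0 < s₁ := hr.trans hs₁
  have hnorm : √(metricForm g p (s₁ • v) (s₁ • v)) = s₁ := by
    have : metricForm g p (s₁ • v) (s₁ • v) = s₁ ^ 2 := by
      have h1 : metricForm g p (s₁ • v) (s₁ • v) = s₁ * (s₁ * metricForm g p v v) := by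
        have := (modelInner g p).map_smul₂ s₁ v (s₁ • v : E)
        have h2 := ((modelInner g p) v).map_smul s₁ v
        exact this.trans (congrArg (s₁ * ·) h2)
      rw [h1, hv]
      ring
    rw [this, Real.sqrt_sq hs₁0.le]
  obtain ⟨γ, hγ⟩ := hex (s₁ • v) (by rw [hnorm]; exact hs₁')
  have hJ : UniqueDiffOn ℝ (Icc (0 : ℝ) 1) := uniqueDiffOn_Icc_zero_one
  have hJ' : UniqueDiffOn ℝ (Icc (0 : ℝ) s₁) := uniqueDiffOn_Icc hs₁0
  have hmaps : MapsTo (fun t => s₁⁻¹ * t) (Icc (0 : ℝ) s₁) (Icc 0 1) := fun t ht =>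
    ⟨mul_nonneg (inv_nonneg.2 hs₁0.le) ht.1, by rw [inv_mul_le_one₀ hs₁0]; exact ht.2⟩
  have heq : EqOn (fun t => γ (s₁⁻¹ * t)) (fun s : ℝ => expMap (metricForm g) p (s • v))
      (Icc 0 s₁) := by
    intro t ht
    have := expMap_smul g hγ (hmaps ht)
    simp only at this ⊢
    rw [← this, smul_smul]
    congr 2
    field_simp
  have hz : (0 : ℝ) ∈ Icc 0 s₁ := ⟨le_rfl, hs₁0.le⟩
  refine ⟨s₁, hs₁, (hγ.1.comp_mul g hJ hJ' hmaps).congr g heq, ?_⟩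
  have hvel := initialVelocity_comp_mul hγ.1.1 hJ' hmaps hz hγ.2
  rw [smul_smul, inv_mul_cancel₀ hs₁0.ne', one_smul] at hvel
  rw [← hvel]
  exact tangentMapWithin_congr (I := 𝓘(ℝ, ℝ)) (I' := I) (fun t ht => (heq ht).symm)
    ⟨0, (1 : ℝ)⟩ hz

end RadialGeodesics

section IntrinsicBalls

variable {M : Type*} [TopologicalSpace M] [ChartedSpace (EuclideanHalfSpace 3) M]
  [IsManifold (𝓡∂ 3) ∞ M]
  {S : Type*} [TopologicalSpace S] [ChartedSpace (EuclideanSpace ℝ (Fin 2)) S]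
  [IsManifold (𝓡 2) ∞ S]

omit [IsManifold (𝓡 2) ∞ S] in
lemma extChartAt_target_isOpen (q : S) : IsOpen (extChartAt (𝓡 2) q).target :=
  isOpen_extChartAt_target q

lemma mdifferentiableAt_extChartAt_symm {q : S} {z : EuclideanSpace ℝ (Fin 2)}
    (hz : z ∈ (extChartAt (𝓡 2) q).target) :
    MDifferentiableAt 𝓘(ℝ, EuclideanSpace ℝ (Fin 2)) (𝓡 2) (extChartAt (𝓡 2) q).symm z := by
  have : IsManifold (𝓡 2) 1 S := IsManifold.of_le (n := ∞) (by simp)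
  have h := mdifferentiableWithinAt_extChartAt_symm (I := 𝓡 2) hz
  rwa [ModelWithCorners.range_eq_univ, mdifferentiableWithinAt_univ] at h

/-- The induced metric in a chart of the surface, computed in a chart of the ambient manifold. -/
lemma chartForm_pullbackForm (g : Metric3 M) {f : S → M} {q : S} {z : EuclideanSpace ℝ (Fin 2)}
    (hz : z ∈ (extChartAt (𝓡 2) q).target)
    (hf : MDifferentiableAt (𝓡 2) (𝓡∂ 3) f ((extChartAt (𝓡 2) q).symm z)) {k : M}
    (hk : f ((extChartAt (𝓡 2) q).symm z) ∈ (extChartAt (𝓡∂ 3) k).source)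
    (v w : EuclideanSpace ℝ (Fin 2)) :
    chartForm (pullbackForm (𝓡 2) g.form f) q z v w
      = chartBilin g k (extChartAt (𝓡∂ 3) k (f ((extChartAt (𝓡 2) q).symm z)))
        (fderiv ℝ (fun y => extChartAt (𝓡∂ 3) k (f ((extChartAt (𝓡 2) q).symm y))) z v)
        (fderiv ℝ (fun y => extChartAt (𝓡∂ 3) k (f ((extChartAt (𝓡 2) q).symm y))) z w) := by
  have hs := mdifferentiableAt_extChartAt_symm hz
  have hcomp := hf.comp z hs
  have h := metricForm_mfderivWithin g k (Φ := f ∘ (extChartAt (𝓡 2) q).symm)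
    (D := univ) (u := z) (mdifferentiableWithinAt_univ.2 hcomp) uniqueDiffWithinAt_univ hk v w
  rw [mfderivWithin_univ, fderivWithin_univ] at h
  refine Eq.trans ?_ h
  have hc : mfderiv 𝓘(ℝ, EuclideanSpace ℝ (Fin 2)) (𝓡∂ 3) (f ∘ (extChartAt (𝓡 2) q).symm) z
      = (mfderiv (𝓡 2) (𝓡∂ 3) f ((extChartAt (𝓡 2) q).symm z)).comp
        (mfderivWithin 𝓘(ℝ, EuclideanSpace ℝ (Fin 2)) (𝓡 2) (extChartAt (𝓡 2) q).symm
          (range (𝓡 2)) z) := by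
    rw [ModelWithCorners.range_eq_univ, mfderivWithin_univ]
    exact mfderiv_comp z hf hs
  rw [hc]
  rfl

lemma contMDiffAt_extChartAt_symm {q : S} {z : EuclideanSpace ℝ (Fin 2)}
    (hz : z ∈ (extChartAt (𝓡 2) q).target) :
    ContMDiffAt 𝓘(ℝ, EuclideanSpace ℝ (Fin 2)) (𝓡 2) ∞ (extChartAt (𝓡 2) q).symm z :=
  (contMDiffOn_extChartAt_symm (n := ∞) q).contMDiffAt ((extChartAt_target_isOpen q).mem_nhds hz)

lemma contDiffAt_chart_comp {f : S → M} {q : S} {z : EuclideanSpace ℝ (Fin 2)}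
    (hz : z ∈ (extChartAt (𝓡 2) q).target)
    (hf : ContMDiffAt (𝓡 2) (𝓡∂ 3) ∞ f ((extChartAt (𝓡 2) q).symm z)) {k : M}
    (hk : f ((extChartAt (𝓡 2) q).symm z) ∈ (extChartAt (𝓡∂ 3) k).source) :
    ContDiffAt ℝ ∞ (fun y => extChartAt (𝓡∂ 3) k (f ((extChartAt (𝓡 2) q).symm y))) z := by
  rw [← contMDiffAt_iff_contDiffAt]
  exact (contMDiffAt_extChartAt' (by simpa using hk)).comp z
    (hf.comp z (contMDiffAt_extChartAt_symm hz))

omit [IsManifold (𝓡 2) ∞ S] in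
lemma pullbackForm_smul_smul (g : Metric3 M) (f : S → M) (x : S) (c : ℝ)
    (v : TangentSpace (𝓡 2) x) :
    pullbackForm (𝓡 2) g.form f x (c • v) (c • v) = c ^ 2 * pullbackForm (𝓡 2) g.form f x v v := by
  let L : EuclideanSpace ℝ (Fin 2) →L[ℝ] EuclideanSpace ℝ (Fin 3) := mfderiv (𝓡 2) (𝓡∂ 3) f x
  let w : EuclideanSpace ℝ (Fin 2) := v
  change modelInner g (f x) (L (c • w)) (L (c • w)) = c ^ 2 * modelInner g (f x) (L w) (L w)
  simp only [map_smul, smul_apply, smul_eq_mul]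
  ring

/-- Intrinsic balls of positive radius are neighbourhoods of their centre. -/
lemma intrinsicBall_mem_nhds (g : Metric3 M) {f : S → M} (hf : ContMDiff (𝓡 2) (𝓡∂ 3) ∞ f)
    (x : S) {r : ℝ} (hr : 0 < r) : intrinsicBall g f x r ∈ 𝓝 x := by
  set ψ := extChartAt (𝓡 2) x with hψ
  set z₀ := ψ x with hz₀
  set k := f x with hk
  let F : EuclideanSpace ℝ (Fin 2) → EuclideanSpace ℝ (Fin 3) :=
    fun y => extChartAt (𝓡∂ 3) k (f (ψ.symm y))
  have hz₀t : z₀ ∈ ψ.target := mem_extChartAt_target x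
  have hsx : ψ.symm z₀ = x := ψ.left_inv (mem_extChartAt_source x)
  have hkz : f (ψ.symm z₀) ∈ (extChartAt (𝓡∂ 3) k).source := by
    rw [hsx]; exact mem_extChartAt_source k
  have hF : ContDiffAt ℝ ∞ F z₀ := contDiffAt_chart_comp hz₀t hf.contMDiffAt hkz
  have hDF : ContinuousAt (fderiv ℝ F) z₀ := hF.continuousAt_fderiv (by simp)
  have hev : ∀ᶠ z in 𝓝 z₀, z ∈ ψ.target ∧ f (ψ.symm z) ∈ (extChartAt (𝓡∂ 3) k).source := by
    refine ((extChartAt_target_isOpen x).eventually_mem hz₀t).and ?_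
    exact (hf.continuous.continuousAt.comp
      (contMDiffAt_extChartAt_symm hz₀t).continuousAt).eventually
      ((isOpen_extChartAt_source k).mem_nhds hkz)
  have hB : ContinuousAt (fun z => chartBilin g k (F z)) z₀ := by
    have hT : F z₀ ∈ (extChartAt (𝓡∂ 3) k).target := (extChartAt (𝓡∂ 3) k).map_source hkz
    have h1 := ((contDiffOn_chartBilin g k).continuousOn (F z₀) hT)
    have h2 : Tendsto F (𝓝 z₀) (𝓝[(extChartAt (𝓡∂ 3) k).target] (F z₀)) := by
      refine tendsto_nhdsWithin_iff.2 ⟨hF.continuousAt, ?_⟩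
      filter_upwards [hev] with z hz using (extChartAt (𝓡∂ 3) k).map_source hz.2
    exact h1.tendsto.comp h2
  obtain ⟨C, hC0, hC⟩ : ∃ C : ℝ, 0 < C ∧ ∀ᶠ z in 𝓝 z₀,
      ‖chartBilin g k (F z)‖ * ‖fderiv ℝ F z‖ ^ 2 ≤ C ^ 2 := by
    have hcont : ContinuousAt (fun z => ‖chartBilin g k (F z)‖ * ‖fderiv ℝ F z‖ ^ 2) z₀ :=
      hB.norm.mul (hDF.norm.pow 2)
    set A := ‖chartBilin g k (F z₀)‖ * ‖fderiv ℝ F z₀‖ ^ 2 with hA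
    have hA0 : 0 ≤ A := by positivity
    refine ⟨A + 1, by linarith, ?_⟩
    filter_upwards [hcont.eventually (gt_mem_nhds (show A < A + 1 by linarith))] with z hz
    nlinarith
  obtain ⟨ρ, hρ, hball⟩ := Metric.eventually_nhds_iff_ball.1 (hev.and hC)
  have hnear : ∀ᶠ y in 𝓝 x, y ∈ ψ.source ∧ ψ y ∈ Metric.ball z₀ (min ρ (r / C)) := by
    refine ((isOpen_extChartAt_source x).eventually_mem (mem_extChartAt_source (I := 𝓡 2) x)).and ?_
    exact (continuousAt_extChartAt x).eventually
      (Metric.ball_mem_nhds _ (lt_min hρ (div_pos hr hC0)))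
  filter_upwards [hnear] with y hy
  set z := ψ y with hz
  have hzρ : z ∈ Metric.ball z₀ ρ := Metric.ball_subset_ball (min_le_left _ _) hy.2
  have hzr : ‖z - z₀‖ < r / C := by
    have := Metric.ball_subset_ball (min_le_right _ _) hy.2
    rwa [Metric.mem_ball, dist_eq_norm] at this
  let ℓ : ℝ → EuclideanSpace ℝ (Fin 2) := fun t => z₀ + t • (z - z₀)
  have hℓ : ∀ t ∈ Icc (0 : ℝ) 1, ℓ t ∈ Metric.ball z₀ ρ := fun t ht =>
    (convex_ball z₀ ρ).add_smul_sub_mem (Metric.mem_ball_self hρ) hzρ ht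
  have hℓd : ContDiff ℝ ∞ ℓ := contDiff_const.add (contDiff_id.smul contDiff_const)
  have hγ : ∀ t ∈ Icc (0 : ℝ) 1, ContMDiffAt 𝓘(ℝ, ℝ) (𝓡 2) ∞ (fun t => ψ.symm (ℓ t)) t :=
    fun t ht => (contMDiffAt_extChartAt_symm (hball _ (hℓ t ht)).1.1).comp t
      hℓd.contMDiff.contMDiffAt
  have h0 : ψ.symm (ℓ 0) = x := by simp [ℓ, hsx]
  have h1 : ψ.symm (ℓ 1) = y := by simp [ℓ, hz, ψ.left_inv hy.1]
  let en : ∀ z : S, ENorm (TangentSpace (𝓡 2) z) :=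
    fun z => ⟨fun v => ENNReal.ofReal √(pullbackForm (𝓡 2) g.form f z v v)⟩
  have hsm : ∀ z : S, ENormSMulClass ℝ (TangentSpace (𝓡 2) z) := fun z => ⟨fun c v => by
    change ENNReal.ofReal √(pullbackForm (𝓡 2) g.form f z (c • v) (c • v))
      = ‖c‖ₑ * ENNReal.ofReal √(pullbackForm (𝓡 2) g.form f z v v)
    rw [pullbackForm_smul_smul, Real.sqrt_mul (sq_nonneg c), Real.sqrt_sq_eq_abs,
      ENNReal.ofReal_mul (abs_nonneg c), ← Real.norm_eq_abs, ofReal_norm]⟩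
  have hspeed : ∀ t ∈ Icc (0 : ℝ) 1,
      (en (ψ.symm (ℓ t))).enorm (mfderiv 𝓘(ℝ, ℝ) (𝓡 2) (fun t => ψ.symm (ℓ t)) t (1 : ℝ))
        ≤ ENNReal.ofReal (C * ‖z - z₀‖) := by
    intro t ht
    have hb := hball _ (hℓ t ht)
    have hℓt : HasMFDerivAt 𝓘(ℝ, ℝ) 𝓘(ℝ, EuclideanSpace ℝ (Fin 2)) ℓ t
        (ContinuousLinearMap.toSpanSingleton ℝ (z - z₀)) := by
      have : HasDerivAt ℓ (z - z₀) t := by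
        have h := ((hasDerivAt_id t).smul_const (z - z₀)).const_add z₀
        rwa [one_smul] at h
      exact this.hasFDerivAt.hasMFDerivAt
    have hd := (HasMFDerivAt.comp t
      (mdifferentiableAt_extChartAt_symm hb.1.1).hasMFDerivAt hℓt).mfderiv
    have hval : (show EuclideanSpace ℝ (Fin 2) from
        mfderiv 𝓘(ℝ, ℝ) (𝓡 2) (fun t => ψ.symm (ℓ t)) t (1 : ℝ))
        = symmDeriv (𝓡 2) x (ℓ t) (z - z₀) := by
      refine (DFunLike.congr_fun hd (1 : ℝ)).trans ?_
      rw [symmDeriv, ModelWithCorners.range_eq_univ, mfderivWithin_univ]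
      change mfderiv 𝓘(ℝ, EuclideanSpace ℝ (Fin 2)) (𝓡 2) ψ.symm (ℓ t)
        (ContinuousLinearMap.toSpanSingleton ℝ (z - z₀) (1 : ℝ)) = _
      rw [ContinuousLinearMap.toSpanSingleton_apply, one_smul]
      rfl
    have hform := chartForm_pullbackForm g hb.1.1
      ((hf _).mdifferentiableAt (by simp)) hb.1.2 (z - z₀) (z - z₀)
    change ENNReal.ofReal √(pullbackForm (𝓡 2) g.form f (ψ.symm (ℓ t))
      (show EuclideanSpace ℝ (Fin 2) from mfderiv 𝓘(ℝ, ℝ) (𝓡 2) (fun t => ψ.symm (ℓ t)) t (1 : ℝ))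
      (show EuclideanSpace ℝ (Fin 2) from mfderiv 𝓘(ℝ, ℝ) (𝓡 2) (fun t => ψ.symm (ℓ t)) t (1 : ℝ)))
      ≤ _
    rw [hval]
    apply ENNReal.ofReal_le_ofReal
    apply Real.sqrt_le_iff.2 ⟨by positivity, ?_⟩
    refine (le_of_eq hform).trans ?_
    set a := fderiv ℝ F (ℓ t) (z - z₀) with ha
    calc chartBilin g k (F (ℓ t)) a a ≤ ‖chartBilin g k (F (ℓ t))‖ * ‖a‖ * ‖a‖ :=
          (le_abs_self _).trans ((chartBilin g k (F (ℓ t))).le_opNorm₂ a a)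
      _ ≤ ‖chartBilin g k (F (ℓ t))‖ * (‖fderiv ℝ F (ℓ t)‖ * ‖z - z₀‖)
            * (‖fderiv ℝ F (ℓ t)‖ * ‖z - z₀‖) := by
          gcongr <;> exact (fderiv ℝ F (ℓ t)).le_opNorm _
      _ = (‖chartBilin g k (F (ℓ t))‖ * ‖fderiv ℝ F (ℓ t)‖ ^ 2) * ‖z - z₀‖ ^ 2 := by ring
      _ ≤ C ^ 2 * ‖z - z₀‖ ^ 2 := by gcongr; exact hb.2
      _ = (C * ‖z - z₀‖) ^ 2 := by ring
  have hle : formEDist (pullbackForm (𝓡 2) g.form f) x y ≤ ENNReal.ofReal (C * ‖z - z₀‖) := by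
    refine (Manifold.riemannianEDist_le_pathELength (a := 0) (b := 1)
      (γ := fun t => ψ.symm (ℓ t)) (fun t ht => ((hγ t ht).of_le (by simp)).contMDiffWithinAt)
      h0 h1 zero_le_one).trans ?_
    rw [Manifold.pathELength_eq_lintegral_mfderiv_Icc]
    refine (setLIntegral_mono measurable_const hspeed).trans ?_
    simp
  refine lt_of_le_of_lt hle ?_
  rw [ENNReal.ofReal_lt_ofReal_iff hr]
  calc C * ‖z - z₀‖ < C * (r / C) := by gcongr
    _ = r := by field_simp

end IntrinsicBalls

section Variation

variable {E : Type*} [NormedAddCommGroup E] [NormedSpace ℝ E] [FiniteDimensional ℝ E]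
  {H : Type*} [TopologicalSpace H] {I : ModelWithCorners ℝ E H}
  {M : Type*} [TopologicalSpace M] [ChartedSpace H M] [IsManifold I ∞ M]
  (g : ContMDiffRiemannianMetric I ∞ E (fun x : M => TangentSpace I x))
  {W : Type*} [NormedAddCommGroup W] [NormedSpace ℝ W] {k : M} {X : W → E} {u₀ : W}

/-- The scalar product of two partial derivatives of the map `X` into the chart at `k`. -/
def partialInner (k : M) (X : W → E) (a b : W) (u : W) : ℝ :=
  chartBilin g k (X u) (fderiv ℝ X u a) (fderiv ℝ X u b)

lemma hasFDerivAt_partialInner (hX : ContDiffAt ℝ ∞ X u₀)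
    (hT : X u₀ ∈ (extChartAt I k).target) (hr : ∀ᶠ u in 𝓝 u₀, X u ∈ range I) (a b : W) :
    ∃ L : W →L[ℝ] ℝ, HasFDerivAt (partialInner g k X a b) L u₀ ∧ ∀ c, L c =
      chartBilinDeriv g k (X u₀) (fderiv ℝ X u₀ c) (fderiv ℝ X u₀ a) (fderiv ℝ X u₀ b)
      + chartBilin g k (X u₀) (fderiv ℝ (fderiv ℝ X) u₀ c a) (fderiv ℝ X u₀ b)
      + chartBilin g k (X u₀) (fderiv ℝ X u₀ a) (fderiv ℝ (fderiv ℝ X) u₀ c b) := by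
  have hX1 : HasFDerivAt X (fderiv ℝ X u₀) u₀ := (hX.differentiableAt (by simp)).hasFDerivAt
  have hX2 : HasFDerivAt (fderiv ℝ X) (fderiv ℝ (fderiv ℝ X) u₀) u₀ :=
    ((hX.fderiv_right (m := ∞) (by simp)).differentiableAt (by simp)).hasFDerivAt
  have hB : HasFDerivAt (fun u => chartBilin g k (X u))
      ((chartBilinDeriv g k (X u₀)).comp (fderiv ℝ X u₀)) u₀ := by
    have h1 := (chartBilin_hasFDerivWithinAt g hT).comp u₀
      (s := {u | X u ∈ range I}) hX1.hasFDerivWithinAt (fun u hu => hu)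
    exact h1.hasFDerivAt hr
  have ha := hX2.clm_apply (hasFDerivAt_const a u₀)
  have hb := hX2.clm_apply (hasFDerivAt_const b u₀)
  refine ⟨_, (hB.clm_apply ha).clm_apply hb, fun c => ?_⟩
  simp
  ring

lemma fderiv_partialInner (hX : ContDiffAt ℝ ∞ X u₀)
    (hT : X u₀ ∈ (extChartAt I k).target) (hr : ∀ᶠ u in 𝓝 u₀, X u ∈ range I) (a b c : W) :
    fderiv ℝ (partialInner g k X a b) u₀ c =
      chartBilinDeriv g k (X u₀) (fderiv ℝ X u₀ c) (fderiv ℝ X u₀ a) (fderiv ℝ X u₀ b)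
      + chartBilin g k (X u₀) (fderiv ℝ (fderiv ℝ X) u₀ c a) (fderiv ℝ X u₀ b)
      + chartBilin g k (X u₀) (fderiv ℝ X u₀ a) (fderiv ℝ (fderiv ℝ X) u₀ c b) := by
  obtain ⟨L, hL, h⟩ := hasFDerivAt_partialInner g hX hT hr a b
  rw [hL.fderiv, h]

lemma differentiableAt_partialInner (hX : ContDiffAt ℝ ∞ X u₀)
    (hT : X u₀ ∈ (extChartAt I k).target) (hr : ∀ᶠ u in 𝓝 u₀, X u ∈ range I) (a b : W) :
    DifferentiableAt ℝ (partialInner g k X a b) u₀ := by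
  obtain ⟨L, hL, -⟩ := hasFDerivAt_partialInner g hX hT hr a b
  exact hL.differentiableAt

/-- The lines in direction `τ` are mapped by `X` to curves satisfying the geodesic equation. -/
def SolvesGeodesicAt (k : M) (X : W → E) (τ : W) (u : W) : Prop :=
  ∀ w : E, chartBilin g k (X u) (fderiv ℝ (fderiv ℝ X) u τ τ) w
    + christoffel (metricForm g) k (X u) (fderiv ℝ X u τ) (fderiv ℝ X u τ) w = 0

omit [FiniteDimensional ℝ E] in
lemma ContDiffAt.fderiv_fderiv_comm (hX : ContDiffAt ℝ ∞ X u₀) (a b : W) :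
    fderiv ℝ (fderiv ℝ X) u₀ a b = fderiv ℝ (fderiv ℝ X) u₀ b a :=
  (hX.isSymmSndFDerivAt (by
    simpa using WithTop.coe_le_coe.2 (le_top : (2 : ℕ∞) ≤ ⊤))).eq a b

/-- Geodesics have constant speed. -/
lemma SolvesGeodesicAt.fderiv_speed {τ : W} (h : SolvesGeodesicAt g k X τ u₀)
    (hX : ContDiffAt ℝ ∞ X u₀) (hT : X u₀ ∈ (extChartAt I k).target)
    (hr : ∀ᶠ u in 𝓝 u₀, X u ∈ range I) :
    fderiv ℝ (partialInner g k X τ τ) u₀ τ = 0 := by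
  rw [fderiv_partialInner g hX hT hr]
  have h1 := h (fderiv ℝ X u₀ τ)
  rw [christoffel_metricForm g hT] at h1
  rw [chartBilin_symm g k (X u₀) (fderiv ℝ X u₀ τ)]
  linarith

/-- The Gauss lemma, infinitesimally. -/
lemma SolvesGeodesicAt.fderiv_partialInner_left {τ : W} (h : SolvesGeodesicAt g k X τ u₀)
    (hX : ContDiffAt ℝ ∞ X u₀) (hT : X u₀ ∈ (extChartAt I k).target)
    (hr : ∀ᶠ u in 𝓝 u₀, X u ∈ range I) (e : W) :
    fderiv ℝ (partialInner g k X τ e) u₀ τ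
      = fderiv ℝ (partialInner g k X τ τ) u₀ e / 2 := by
  rw [fderiv_partialInner g hX hT hr, fderiv_partialInner g hX hT hr]
  have h1 := h (fderiv ℝ X u₀ e)
  rw [christoffel_metricForm g hT] at h1
  rw [chartBilin_symm g k (X u₀) (fderiv ℝ X u₀ τ) (fderiv ℝ (fderiv ℝ X) u₀ e τ),
    chartBilin_symm g k (X u₀) (fderiv ℝ X u₀ τ) (fderiv ℝ (fderiv ℝ X) u₀ τ e),
    ContDiffAt.fderiv_fderiv_comm hX τ e]
  linarith

/-- The variation of the first fundamental form in a normal direction is given by the second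
fundamental form. -/
lemma fderiv_partialInner_normal {τ a b : W}
    (hX : ContDiffAt ℝ ∞ X u₀) (hT : X u₀ ∈ (extChartAt I k).target)
    (hr : ∀ᶠ u in 𝓝 u₀, X u ∈ range I)
    (hab : fderiv ℝ (partialInner g k X τ a) u₀ b = 0)
    (hba : fderiv ℝ (partialInner g k X τ b) u₀ a = 0) :
    fderiv ℝ (partialInner g k X a b) u₀ τ
      = -2 * (chartBilin g k (X u₀) (fderiv ℝ (fderiv ℝ X) u₀ a b) (fderiv ℝ X u₀ τ)
        + christoffel (metricForm g) k (X u₀) (fderiv ℝ X u₀ a) (fderiv ℝ X u₀ b)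
          (fderiv ℝ X u₀ τ)) := by
  rw [fderiv_partialInner g hX hT hr] at hab hba ⊢
  rw [christoffel_metricForm g hT]
  rw [ContDiffAt.fderiv_fderiv_comm hX b τ, ContDiffAt.fderiv_fderiv_comm hX b a,
    chartBilin_symm g k _ (fderiv ℝ X u₀ τ), chartBilinDeriv_symm g hT _ (fderiv ℝ X u₀ τ)] at hab
  rw [ContDiffAt.fderiv_fderiv_comm hX a τ,
    chartBilin_symm g k _ (fderiv ℝ X u₀ τ), chartBilinDeriv_symm g hT _ (fderiv ℝ X u₀ τ)] at hba
  rw [chartBilin_symm g k _ (fderiv ℝ X u₀ a)]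
  linarith

end Variation

section Collar

variable {M : Type*} [TopologicalSpace M] [ChartedSpace (EuclideanHalfSpace 3) M]
  [IsManifold (𝓡∂ 3) ∞ M]
  {S : Type*} [TopologicalSpace S] [ChartedSpace (EuclideanSpace ℝ (Fin 2)) S]
  [IsManifold (𝓡 2) ∞ S]
  (g : Metric3 M) (f : S → M) (ν : ∀ p : S, TangentSpace (𝓡∂ 3) (f p))

/-- The normal exponential map in the chart of the surface at `q`. -/
def chartNormalExp (q : S) (u : EuclideanSpace ℝ (Fin 2) × ℝ) : M :=
  normalExp g f ν ((extChartAt (𝓡 2) q).symm u.1, u.2)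

/-- The domain of the collar of thickness `r` in the chart of the surface at `q`. -/
def collarDomain (q : S) (r : ℝ) : Set (EuclideanSpace ℝ (Fin 2) × ℝ) :=
  (extChartAt (𝓡 2) q).target ×ˢ Ico 0 r

/-- The normal exponential map in the charts at `q` and `k`. -/
def collarChart (q : S) (k : M) (u : EuclideanSpace ℝ (Fin 2) × ℝ) : EuclideanSpace ℝ (Fin 3) :=
  extChartAt (𝓡∂ 3) k (chartNormalExp g f ν q u)

omit [IsManifold (𝓡 2) ∞ S] in
lemma uniqueDiffOn_collarDomain (q : S) (r : ℝ) :
    UniqueDiffOn ℝ (collarDomain q r) :=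
  (extChartAt_target_isOpen q).uniqueDiffOn.prod (uniqueDiffOn_Ico 0 r)

omit [IsManifold (𝓡 2) ∞ S] in
lemma collarDomain_mem_nhds {q : S} {r : ℝ} {u : EuclideanSpace ℝ (Fin 2) × ℝ}
    (hu : u.1 ∈ (extChartAt (𝓡 2) q).target) (hs : u.2 ∈ Ioo 0 r) : collarDomain q r ∈ 𝓝 u :=
  prod_mem_nhds ((extChartAt_target_isOpen q).mem_nhds hu) (Ico_mem_nhds hs.1 hs.2)

variable {g f ν} {r : ℝ}

lemma contMDiffOn_normalExp (hf : ContMDiff (𝓡 2) (𝓡∂ 3) ∞ f)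
    (h : IsLocalOuterInjRadius g f ν r) :
    ContMDiffOn ((𝓡 2).prod 𝓘(ℝ, ℝ)) (𝓡∂ 3) ∞ (normalExp g f ν) (univ ×ˢ Ico 0 r) := by
  rintro ⟨x, s⟩ ⟨-, hs⟩
  have hball := intrinsicBall_mem_nhds g hf x h.pos
  have hx : x ∈ intrinsicBall g f x r := mem_of_mem_nhds hball
  refine ((h.diffeo x).1 (x, s) ⟨hx, hs⟩).mono_of_mem_nhdsWithin ?_
  rw [nhdsWithin_prod_eq, nhdsWithin_univ]
  exact prod_mem_prod hball self_mem_nhdsWithin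

lemma contMDiffOn_chartNormalExp (hf : ContMDiff (𝓡 2) (𝓡∂ 3) ∞ f)
    (h : IsLocalOuterInjRadius g f ν r) (q : S) :
    ContMDiffOn 𝓘(ℝ, EuclideanSpace ℝ (Fin 2) × ℝ) (𝓡∂ 3) ∞ (chartNormalExp g f ν q)
      (collarDomain q r) := by
  have hsymm : ContMDiffOn 𝓘(ℝ, EuclideanSpace ℝ (Fin 2) × ℝ) (𝓡 2) ∞
      (fun u : EuclideanSpace ℝ (Fin 2) × ℝ => (extChartAt (𝓡 2) q).symm u.1)
      (collarDomain q r) :=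
    (contMDiffOn_extChartAt_symm q).comp
      (contDiff_fst.contMDiff.contMDiffOn : ContMDiffOn 𝓘(ℝ, EuclideanSpace ℝ (Fin 2) × ℝ)
        𝓘(ℝ, EuclideanSpace ℝ (Fin 2)) ∞ Prod.fst _) (fun u hu => hu.1)
  have hsnd : ContMDiffOn 𝓘(ℝ, EuclideanSpace ℝ (Fin 2) × ℝ) 𝓘(ℝ, ℝ) ∞
      (fun u : EuclideanSpace ℝ (Fin 2) × ℝ => u.2) (collarDomain q r) :=
    contDiff_snd.contMDiff.contMDiffOn
  exact (contMDiffOn_normalExp hf h).comp (hsymm.prodMk hsnd) (fun u hu => ⟨mem_univ _, hu.2⟩)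

lemma contDiffWithinAt_collarChart (hf : ContMDiff (𝓡 2) (𝓡∂ 3) ∞ f)
    (h : IsLocalOuterInjRadius g f ν r) {q : S} {k : M} {u : EuclideanSpace ℝ (Fin 2) × ℝ}
    (hu : u ∈ collarDomain q r) (hk : chartNormalExp g f ν q u ∈ (extChartAt (𝓡∂ 3) k).source) :
    ContDiffWithinAt ℝ ∞ (collarChart g f ν q k) (collarDomain q r) u := by
  rw [← contMDiffWithinAt_iff_contDiffWithinAt]
  exact (contMDiffAt_extChartAt' (by simpa using hk)).comp_contMDiffWithinAt u
    (contMDiffOn_chartNormalExp hf h q u hu)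

lemma eventually_chartNormalExp_mem (hf : ContMDiff (𝓡 2) (𝓡∂ 3) ∞ f)
    (h : IsLocalOuterInjRadius g f ν r) {q : S} {k : M} {u : EuclideanSpace ℝ (Fin 2) × ℝ}
    (hu : u ∈ collarDomain q r) (hk : chartNormalExp g f ν q u ∈ (extChartAt (𝓡∂ 3) k).source) :
    ∀ᶠ u' in 𝓝[collarDomain q r] u, u' ∈ collarDomain q r ∧
      chartNormalExp g f ν q u' ∈ (extChartAt (𝓡∂ 3) k).source :=
  eventually_mem_nhdsWithin.and
    (((contMDiffOn_chartNormalExp hf h q u hu).continuousWithinAt).eventually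
      ((isOpen_extChartAt_source k).mem_nhds hk))

lemma contDiffAt_collarChart (hf : ContMDiff (𝓡 2) (𝓡∂ 3) ∞ f)
    (h : IsLocalOuterInjRadius g f ν r) {q : S} {k : M} {u : EuclideanSpace ℝ (Fin 2) × ℝ}
    (hu : u.1 ∈ (extChartAt (𝓡 2) q).target) (hs : u.2 ∈ Ioo 0 r)
    (hk : chartNormalExp g f ν q u ∈ (extChartAt (𝓡∂ 3) k).source) :
    ContDiffAt ℝ ∞ (collarChart g f ν q k) u :=
  (contDiffWithinAt_collarChart hf h ⟨hu, hs.1.le, hs.2⟩ hk).contDiffAt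
    (collarDomain_mem_nhds hu hs)

variable (g f ν r) in
/-- The metric, pulled back by the normal exponential map in the chart of the surface at `q`. -/
def collarMetric (q : S) (a b : EuclideanSpace ℝ (Fin 2) × ℝ)
    (u : EuclideanSpace ℝ (Fin 2) × ℝ) : ℝ :=
  metricForm g (chartNormalExp g f ν q u)
    (mfderivWithin 𝓘(ℝ, EuclideanSpace ℝ (Fin 2) × ℝ) (𝓡∂ 3) (chartNormalExp g f ν q)
      (collarDomain q r) u a)
    (mfderivWithin 𝓘(ℝ, EuclideanSpace ℝ (Fin 2) × ℝ) (𝓡∂ 3) (chartNormalExp g f ν q)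
      (collarDomain q r) u b)

lemma collarMetric_eq (hf : ContMDiff (𝓡 2) (𝓡∂ 3) ∞ f)
    (h : IsLocalOuterInjRadius g f ν r) {q : S} {k : M} {u : EuclideanSpace ℝ (Fin 2) × ℝ}
    (hu : u ∈ collarDomain q r) (hk : chartNormalExp g f ν q u ∈ (extChartAt (𝓡∂ 3) k).source)
    (a b : EuclideanSpace ℝ (Fin 2) × ℝ) :
    collarMetric g f ν r q a b u = chartBilin g k (collarChart g f ν q k u)
      (fderivWithin ℝ (collarChart g f ν q k) (collarDomain q r) u a)
      (fderivWithin ℝ (collarChart g f ν q k) (collarDomain q r) u b) :=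
  metricForm_mfderivWithin g k
    ((contMDiffOn_chartNormalExp hf h q u hu).mdifferentiableWithinAt (by simp))
    (uniqueDiffOn_collarDomain q r u hu) hk a b

lemma collarMetric_eq_partialInner (hf : ContMDiff (𝓡 2) (𝓡∂ 3) ∞ f)
    (h : IsLocalOuterInjRadius g f ν r) {q : S} {k : M} {u : EuclideanSpace ℝ (Fin 2) × ℝ}
    (hu : u.1 ∈ (extChartAt (𝓡 2) q).target) (hs : u.2 ∈ Ioo 0 r)
    (hk : chartNormalExp g f ν q u ∈ (extChartAt (𝓡∂ 3) k).source)
    (a b : EuclideanSpace ℝ (Fin 2) × ℝ) :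
    ∀ᶠ u' in 𝓝 u, collarMetric g f ν r q a b u'
      = partialInner g k (collarChart g f ν q k) a b u' := by
  have hD := collarDomain_mem_nhds (r := r) hu hs
  have h1 := eventually_chartNormalExp_mem hf h ⟨hu, hs.1.le, hs.2⟩ hk
  rw [nhdsWithin_eq_nhds.2 hD] at h1
  filter_upwards [h1, eventually_mem_nhds_iff.2 hD] with u' hu' hD'
  rw [collarMetric_eq hf h hu'.1 hu'.2, fderivWithin_of_mem_nhds hD', partialInner]

lemma continuousOn_collarMetric (hf : ContMDiff (𝓡 2) (𝓡∂ 3) ∞ f)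
    (h : IsLocalOuterInjRadius g f ν r) (q : S) (a b : EuclideanSpace ℝ (Fin 2) × ℝ) :
    ContinuousOn (collarMetric g f ν r q a b) (collarDomain q r) := by
  intro u hu
  set k := chartNormalExp g f ν q u with hkdef
  have hk : chartNormalExp g f ν q u ∈ (extChartAt (𝓡∂ 3) k).source := mem_extChartAt_source k
  have hev := eventually_chartNormalExp_mem hf h hu hk
  have hX := contDiffWithinAt_collarChart hf h hu hk
  have hDX : ContinuousWithinAt (fderivWithin ℝ (collarChart g f ν q k) (collarDomain q r))
      (collarDomain q r) u :=
    (hX.fderivWithin_right (m := ∞) (uniqueDiffOn_collarDomain q r) (by simp)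
      hu).continuousWithinAt
  have hB : ContinuousWithinAt (fun u => chartBilin g k (collarChart g f ν q k u))
      (collarDomain q r) u := by
    have hT : collarChart g f ν q k u ∈ (extChartAt (𝓡∂ 3) k).target :=
      (extChartAt (𝓡∂ 3) k).map_source hk
    have h1 := ((contDiffOn_chartBilin g k).continuousOn _ hT)
    have h2 : Tendsto (collarChart g f ν q k) (𝓝[collarDomain q r] u)
        (𝓝[(extChartAt (𝓡∂ 3) k).target] (collarChart g f ν q k u)) := by
      refine tendsto_nhdsWithin_iff.2 ⟨hX.continuousWithinAt, ?_⟩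
      filter_upwards [hev] with u' hu' using (extChartAt (𝓡∂ 3) k).map_source hu'.2
    exact h1.tendsto.comp h2
  have hc := (hB.clm_apply (hDX.clm_apply (continuousWithinAt_const (b := a)))).clm_apply
    (hDX.clm_apply (continuousWithinAt_const (b := b)))
  refine hc.congr_of_eventuallyEq ?_ (collarMetric_eq hf h hu hk a b)
  filter_upwards [hev] with u' hu' using collarMetric_eq hf h hu'.1 hu'.2 a b

end Collar

/-- A function with vanishing derivative on the interior of a half-open interval is constant. -/
lemma eq_of_hasDerivAt_zero {n : ℝ → ℝ} {r : ℝ} (hc : ContinuousOn n (Ico 0 r))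
    (hd : ∀ s ∈ Ioo 0 r, HasDerivAt n 0 s) {s : ℝ} (hs : s ∈ Ico 0 r) : n s = n 0 := by
  rcases hs.1.eq_or_lt with rfl | hpos
  · rfl
  · obtain ⟨t, -, ht⟩ := exists_hasDerivAt_eq_slope n (fun _ => 0) hpos
      (hc.mono fun t ht => ⟨ht.1, ht.2.trans_lt hs.2⟩)
      (fun t ht => hd t ⟨ht.1, ht.2.trans hs.2⟩)
    rw [eq_comm, div_eq_zero_iff] at ht
    rcases ht with ht | ht <;> linarith

section Collar

variable {M : Type*} [TopologicalSpace M] [ChartedSpace (EuclideanHalfSpace 3) M]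
  [IsManifold (𝓡∂ 3) ∞ M]
  {S : Type*} [TopologicalSpace S] [ChartedSpace (EuclideanSpace ℝ (Fin 2)) S]
  [IsManifold (𝓡 2) ∞ S]
  {g : Metric3 M} {f : S → M} {ν : ∀ p : S, TangentSpace (𝓡∂ 3) (f p)} {r : ℝ}

/-- The slice of the collar at height `s`, in charts. -/
lemma hasFDerivAt_collarChart_slice (hf : ContMDiff (𝓡 2) (𝓡∂ 3) ∞ f)
    (h : IsLocalOuterInjRadius g f ν r) {q : S} {k : M} {y : EuclideanSpace ℝ (Fin 2)} {s : ℝ}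
    (hu : (y, s) ∈ collarDomain q r)
    (hk : chartNormalExp g f ν q (y, s) ∈ (extChartAt (𝓡∂ 3) k).source) :
    HasFDerivAt (fun y' => collarChart g f ν q k (y', s))
      ((fderivWithin ℝ (collarChart g f ν q k) (collarDomain q r) (y, s)).comp
        (ContinuousLinearMap.inl ℝ (EuclideanSpace ℝ (Fin 2)) ℝ)) y := by
  have h1 := ((contDiffWithinAt_collarChart hf h hu hk).differentiableWithinAt
    (by simp)).hasFDerivWithinAt
  have hm : MapsTo (fun y' => (y', s)) (extChartAt (𝓡 2) q).target (collarDomain q r) :=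
    fun y' hy' => ⟨hy', hu.2⟩
  have h2 := HasFDerivWithinAt.comp y h1
    (hasFDerivAt_prodMk_left (𝕜 := ℝ) y s).hasFDerivWithinAt hm
  exact h2.hasFDerivAt ((extChartAt_target_isOpen q).mem_nhds hu.1)

/-- The normal lines of the collar, in charts. -/
lemma hasDerivWithinAt_collarChart_line (hf : ContMDiff (𝓡 2) (𝓡∂ 3) ∞ f)
    (h : IsLocalOuterInjRadius g f ν r) {q : S} {k : M} {y : EuclideanSpace ℝ (Fin 2)} {s : ℝ}
    (hu : (y, s) ∈ collarDomain q r)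
    (hk : chartNormalExp g f ν q (y, s) ∈ (extChartAt (𝓡∂ 3) k).source) :
    HasDerivWithinAt (fun s' => collarChart g f ν q k (y, s'))
      (fderivWithin ℝ (collarChart g f ν q k) (collarDomain q r) (y, s) (0, 1)) (Ico 0 r) s := by
  have h1 := ((contDiffWithinAt_collarChart hf h hu hk).differentiableWithinAt
    (by simp)).hasFDerivWithinAt
  have hm : MapsTo (fun s' => (y, s')) (Ico 0 r) (collarDomain q r) := fun s' hs' => ⟨hu.1, hs'⟩
  have h2 := (HasFDerivWithinAt.comp s h1
    (hasFDerivAt_prodMk_right (𝕜 := ℝ) y s).hasFDerivWithinAt hm).hasDerivWithinAt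
  rw [ContinuousLinearMap.comp_apply, ContinuousLinearMap.inr_apply] at h2
  exact h2

lemma contMDiff_normalExp_slice (hf : ContMDiff (𝓡 2) (𝓡∂ 3) ∞ f)
    (h : IsLocalOuterInjRadius g f ν r) {s : ℝ} (hs : s ∈ Ico 0 r) :
    ContMDiff (𝓡 2) (𝓡∂ 3) ∞ (fun x => normalExp g f ν (x, s)) := by
  rw [← contMDiffOn_univ]
  exact (contMDiffOn_normalExp hf h).comp (contMDiffOn_id.prodMk contMDiffOn_const)
    (fun x _ => ⟨mem_univ _, hs⟩)

/-- The metric induced on a sheet of the collar. -/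
lemma chartForm_slice (hf : ContMDiff (𝓡 2) (𝓡∂ 3) ∞ f)
    (h : IsLocalOuterInjRadius g f ν r) {q : S} {y : EuclideanSpace ℝ (Fin 2)} {s : ℝ}
    (hu : (y, s) ∈ collarDomain q r) (a b : EuclideanSpace ℝ (Fin 2)) :
    chartForm (pullbackForm (𝓡 2) g.form (fun x => normalExp g f ν (x, s))) q y a b
      = collarMetric g f ν r q (a, 0) (b, 0) (y, s) := by
  have hk := mem_extChartAt_source (I := 𝓡∂ 3) (chartNormalExp g f ν q (y, s))
  rw [chartForm_pullbackForm g hu.1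
    (((contMDiff_normalExp_slice hf h hu.2) _).mdifferentiableAt (by simp)) hk,
    collarMetric_eq hf h hu hk]
  have hd := (hasFDerivAt_collarChart_slice hf h hu hk).fderiv
  have hd' : ∀ c, fderiv ℝ (fun y' => collarChart g f ν q (chartNormalExp g f ν q (y, s)) (y', s))
      y c = fderivWithin ℝ (collarChart g f ν q (chartNormalExp g f ν q (y, s)))
        (collarDomain q r) (y, s) (c, 0) := by
    intro c
    rw [hd]
    simp
  rw [← hd', ← hd']
  rfl

variable [T2Space M]

omit [IsManifold (𝓡 2) ∞ S] in
lemma exists_isGeodesicOn_normalExp (hν : ∀ p, IsUnitNormalAt (𝓡 2) g.form f p (ν p))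
    (h : IsLocalOuterInjRadius g f ν r) (p : S) :
    ∃ s₁ > r, IsGeodesicOn (metricForm g) (fun s : ℝ => normalExp g f ν (p, s)) (Icc 0 s₁) ∧
      (⟨normalExp g f ν (p, 0), mfderivWithin 𝓘(ℝ, ℝ) (𝓡∂ 3)
        (fun s : ℝ => normalExp g f ν (p, s)) (Icc 0 s₁) 0 (1 : ℝ)⟩ :
        TangentBundle (𝓡∂ 3) M) = ⟨f p, ν p⟩ :=
  exists_isGeodesicOn_expMap g (hν p).1 h.pos
    (h.lt_injRadius.trans_le (iInf_le (fun p => injRadius g.form (f p)) p))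

omit [IsManifold (𝓡 2) ∞ S] in
lemma normalExp_zero (hν : ∀ p, IsUnitNormalAt (𝓡 2) g.form f p (ν p))
    (h : IsLocalOuterInjRadius g f ν r) (p : S) : normalExp g f ν (p, 0) = f p := by
  obtain ⟨s₁, -, -, h0⟩ := exists_isGeodesicOn_normalExp hν h p
  exact congrArg TotalSpace.proj h0

lemma solvesGeodesicAt_collarChart (hf : ContMDiff (𝓡 2) (𝓡∂ 3) ∞ f)
    (hν : ∀ p, IsUnitNormalAt (𝓡 2) g.form f p (ν p))
    (h : IsLocalOuterInjRadius g f ν r) {q : S} {k : M} {u : EuclideanSpace ℝ (Fin 2) × ℝ}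
    (hu : u.1 ∈ (extChartAt (𝓡 2) q).target) (hs : u.2 ∈ Ioo 0 r)
    (hk : chartNormalExp g f ν q u ∈ (extChartAt (𝓡∂ 3) k).source) :
    SolvesGeodesicAt g k (collarChart g f ν q k) (0, 1) u := by
  obtain ⟨y, s⟩ := u
  obtain ⟨s₁, hs₁, hgeo, -⟩ := exists_isGeodesicOn_normalExp hν h ((extChartAt (𝓡 2) q).symm y)
  intro w
  have hmem : s ∈ Icc 0 s₁ := ⟨hs.1.le, (hs.2.trans hs₁).le⟩
  have heq := hgeo.2 k s hmem hk w
  have hD := collarDomain_mem_nhds (r := r) hu hs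
  have hev : ∀ᶠ s' in 𝓝 s, s' ∈ Ioo 0 r ∧
      chartNormalExp g f ν q (y, s') ∈ (extChartAt (𝓡∂ 3) k).source := by
    have h1 := eventually_chartNormalExp_mem hf h (u := (y, s)) ⟨hu, hs.1.le, hs.2⟩ hk
    rw [nhdsWithin_eq_nhds.2 hD] at h1
    have h2 : Tendsto (fun s' : ℝ => (y, s')) (𝓝 s) (𝓝 (y, s)) :=
      (Continuous.prodMk_right y).tendsto s
    filter_upwards [h2.eventually h1, Ioo_mem_nhds hs.1 hs.2] with s' h3 h4 using ⟨h4, h3.2⟩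
  have hder : ∀ s', s' ∈ Ioo 0 r →
      chartNormalExp g f ν q (y, s') ∈ (extChartAt (𝓡∂ 3) k).source →
      derivWithin (fun s => collarChart g f ν q k (y, s)) (Icc 0 s₁) s'
        = fderiv ℝ (collarChart g f ν q k) (y, s') (0, 1) := by
    intro s' hs' hk'
    have h1 := hasDerivWithinAt_collarChart_line hf h (q := q) (k := k) (y := y) (s := s')
      ⟨hu, hs'.1.le, hs'.2⟩ hk'
    rw [fderivWithin_of_mem_nhds (collarDomain_mem_nhds (u := (y, s')) hu hs')] at h1
    have h2 := h1.hasDerivAt (Ico_mem_nhds hs'.1 hs'.2)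
    rw [derivWithin_of_mem_nhds (Icc_mem_nhds hs'.1 (hs'.2.trans hs₁))]
    exact h2.deriv
  have hder2 : derivWithin (derivWithin (fun s => collarChart g f ν q k (y, s)) (Icc 0 s₁))
      (Icc 0 s₁) s = fderiv ℝ (fderiv ℝ (collarChart g f ν q k)) (y, s) (0, 1) (0, 1) := by
    rw [derivWithin_of_mem_nhds (Icc_mem_nhds hs.1 (hs.2.trans hs₁))]
    have h1 : derivWithin (fun s => collarChart g f ν q k (y, s)) (Icc 0 s₁) =ᶠ[𝓝 s]
        fun s' => fderiv ℝ (collarChart g f ν q k) (y, s') (0, 1) := by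
      filter_upwards [hev] with s' hs' using hder s' hs'.1 hs'.2
    rw [h1.deriv_eq]
    have hX := contDiffAt_collarChart hf h (u := (y, s)) hu hs hk
    have h2 : HasFDerivAt (fderiv ℝ (collarChart g f ν q k))
        (fderiv ℝ (fderiv ℝ (collarChart g f ν q k)) (y, s)) (y, s) :=
      ((hX.fderiv_right (m := ∞) (by simp)).differentiableAt (by simp)).hasFDerivAt
    have h3 := (h2.clm_apply (hasFDerivAt_const ((0, 1) : EuclideanSpace ℝ (Fin 2) × ℝ) (y, s)))
    have h4 := (HasFDerivAt.comp s h3 (hasFDerivAt_prodMk_right (𝕜 := ℝ) y s)).hasDerivAt.deriv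
    refine h4.trans ?_
    simp
  change chartForm (metricForm g) k (collarChart g f ν q k (y, s))
    (derivWithin (derivWithin (fun s => collarChart g f ν q k (y, s)) (Icc 0 s₁)) (Icc 0 s₁) s) w
    + christoffel (metricForm g) k (collarChart g f ν q k (y, s))
      (derivWithin (fun s => collarChart g f ν q k (y, s)) (Icc 0 s₁) s)
      (derivWithin (fun s => collarChart g f ν q k (y, s)) (Icc 0 s₁) s) w = 0 at heq
  rw [hder2, hder s hs hk] at heq
  exact heq

omit [IsManifold (𝓡 2) ∞ S] [T2Space M] in
lemma eventually_collarChart_mem_range (q : S) (k : M) (u : EuclideanSpace ℝ (Fin 2) × ℝ) :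
    ∀ᶠ u' in 𝓝 u, collarChart g f ν q k u' ∈ range (𝓡∂ 3) :=
  Eventually.of_forall fun u' => ⟨chartAt _ k (chartNormalExp g f ν q u'), rfl⟩

/-- The initial velocity of the normal lines, in charts. -/
lemma fderivWithin_collarChart_zero (hf : ContMDiff (𝓡 2) (𝓡∂ 3) ∞ f)
    (hν : ∀ p, IsUnitNormalAt (𝓡 2) g.form f p (ν p))
    (h : IsLocalOuterInjRadius g f ν r) {q : S} {y : EuclideanSpace ℝ (Fin 2)}
    (hy : y ∈ (extChartAt (𝓡 2) q).target) {k : M}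
    (hk : f ((extChartAt (𝓡 2) q).symm y) ∈ (extChartAt (𝓡∂ 3) k).source) :
    fderivWithin ℝ (collarChart g f ν q k) (collarDomain q r) (y, 0) (0, 1)
      = mfderiv (𝓡∂ 3) 𝓘(ℝ, EuclideanSpace ℝ (Fin 3)) (extChartAt (𝓡∂ 3) k)
        (f ((extChartAt (𝓡 2) q).symm y)) (ν ((extChartAt (𝓡 2) q).symm y)) := by
  set p := (extChartAt (𝓡 2) q).symm y with hp
  obtain ⟨s₁, hs₁, hgeo, h0⟩ := exists_isGeodesicOn_normalExp hν h p
  have hs₁0 : 0 < s₁ := h.pos.trans hs₁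
  have hk' : chartNormalExp g f ν q (y, 0) ∈ (extChartAt (𝓡∂ 3) k).source := by
    change normalExp g f ν (p, 0) ∈ _
    rw [normalExp_zero hν h]
    exact hk
  have h1 := hasDerivWithinAt_collarChart_line hf h (q := q) (k := k) (y := y) (s := 0)
      ⟨hy, le_rfl, h.pos⟩ hk'
  have h2 := derivWithin_extChartAt_comp hgeo.1 (q := k) ⟨le_rfl, hs₁0.le⟩
    (uniqueDiffOn_Icc hs₁0) hk'
  have h3 := ((contDiffWithinAt_extChartAt_comp hgeo.1 (q := k) (t := 0) ⟨le_rfl, hs₁0.le⟩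
    hk').differentiableWithinAt (by simp)).hasDerivWithinAt
  have h4 := h3.mono (s := Ico 0 r) (fun t ht => ⟨ht.1, (ht.2.trans hs₁).le⟩)
  rw [(uniqueDiffOn_Ico 0 r 0 ⟨le_rfl, h.pos⟩).eq_deriv _ h1 h4, h2]
  exact congrArg (fun w : TangentBundle (𝓡∂ 3) M =>
    (mfderiv (𝓡∂ 3) 𝓘(ℝ, EuclideanSpace ℝ (Fin 3)) (extChartAt (𝓡∂ 3) k) w.1 w.2 :
      EuclideanSpace ℝ (Fin 3))) h0

end Collar

section Collar

variable {M : Type*} [TopologicalSpace M] [ChartedSpace (EuclideanHalfSpace 3) M]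
  [IsManifold (𝓡∂ 3) ∞ M]
  {S : Type*} [TopologicalSpace S] [ChartedSpace (EuclideanSpace ℝ (Fin 2)) S]
  [IsManifold (𝓡 2) ∞ S]
  {g : Metric3 M} {f : S → M} {ν : ∀ p : S, TangentSpace (𝓡∂ 3) (f p)} {r : ℝ}

omit [IsManifold (𝓡 2) ∞ S] in
lemma collarMetric_comm (q : S) (a b u : EuclideanSpace ℝ (Fin 2) × ℝ) :
    collarMetric g f ν r q a b u = collarMetric g f ν r q b a u :=
  g.symm _ _ _

lemma hasDerivAt_collarMetric (hf : ContMDiff (𝓡 2) (𝓡∂ 3) ∞ f)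
    (h : IsLocalOuterInjRadius g f ν r) {q : S} {k : M} {y : EuclideanSpace ℝ (Fin 2)} {s : ℝ}
    (hu : y ∈ (extChartAt (𝓡 2) q).target) (hs : s ∈ Ioo 0 r)
    (hk : chartNormalExp g f ν q (y, s) ∈ (extChartAt (𝓡∂ 3) k).source)
    (a b : EuclideanSpace ℝ (Fin 2) × ℝ) :
    HasDerivAt (fun s' => collarMetric g f ν r q a b (y, s'))
      (fderiv ℝ (partialInner g k (collarChart g f ν q k) a b) (y, s) (0, 1)) s := by
  have hX := contDiffAt_collarChart hf h (u := (y, s)) hu hs hk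
  have hd := (differentiableAt_partialInner g hX ((extChartAt (𝓡∂ 3) k).map_source hk)
    (eventually_collarChart_mem_range q k _) a b).hasFDerivAt
  have hev := collarMetric_eq_partialInner hf h (u := (y, s)) hu hs hk a b
  have hd2 := hd.congr_of_eventuallyEq hev
  have h2 := (HasFDerivAt.comp s hd2 (hasFDerivAt_prodMk_right (𝕜 := ℝ) y s)).hasDerivAt
  rw [ContinuousLinearMap.comp_apply, ContinuousLinearMap.inr_apply] at h2
  exact h2

lemma continuousOn_collarMetric_line (hf : ContMDiff (𝓡 2) (𝓡∂ 3) ∞ f)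
    (h : IsLocalOuterInjRadius g f ν r) {q : S} {y : EuclideanSpace ℝ (Fin 2)}
    (hu : y ∈ (extChartAt (𝓡 2) q).target) (a b : EuclideanSpace ℝ (Fin 2) × ℝ) :
    ContinuousOn (fun s => collarMetric g f ν r q a b (y, s)) (Ico 0 r) :=
  (continuousOn_collarMetric hf h q a b).comp (Continuous.prodMk_right y).continuousOn
    (fun _ hs => ⟨hu, hs⟩)

variable [T2Space M]

omit [T2Space M] in
lemma symmDeriv_fderiv_chart {φ : S → M} {q x : S} {y : EuclideanSpace ℝ (Fin 2)}
    (hy : y ∈ (extChartAt (𝓡 2) q).target) (hx : (extChartAt (𝓡 2) q).symm y = x)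
    (hφ : MDifferentiableAt (𝓡 2) (𝓡∂ 3) φ x) {k : M} (hk : φ x ∈ (extChartAt (𝓡∂ 3) k).source)
    (v : EuclideanSpace ℝ (Fin 2)) :
    symmDeriv (𝓡∂ 3) k (extChartAt (𝓡∂ 3) k (φ x))
        (fderiv ℝ (fun y' => extChartAt (𝓡∂ 3) k (φ ((extChartAt (𝓡 2) q).symm y'))) y v)
      = mfderiv (𝓡 2) (𝓡∂ 3) φ x (symmDeriv (𝓡 2) q y v) := by
  subst hx
  have hs := mdifferentiableAt_extChartAt_symm hy
  have hsd := symmDeriv_fderivWithin (I := 𝓡∂ 3) (k := k)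
    (Φ := fun y' => φ ((extChartAt (𝓡 2) q).symm y')) (D := univ) (u := y)
    (mdifferentiableWithinAt_univ.2 (hφ.comp y hs)) uniqueDiffWithinAt_univ hk v
  rw [fderivWithin_univ, mfderivWithin_univ] at hsd
  refine hsd.trans ?_
  rw [symmDeriv, ModelWithCorners.range_eq_univ, mfderivWithin_univ]
  exact DFunLike.congr_fun (mfderiv_comp y hφ hs) v

omit [T2Space M] in
lemma symmDeriv_self (p : S) (v : EuclideanSpace ℝ (Fin 2)) :
    symmDeriv (𝓡 2) p (extChartAt (𝓡 2) p p) v = v := by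
  have : IsManifold (𝓡 2) 1 S := IsManifold.of_le (n := ∞) (by simp)
  exact DFunLike.congr_fun (mfderivWithin_range_extChartAt_symm (I := 𝓡 2) (x := p)) v

/-- The normal lines of the collar have unit speed. -/
lemma collarMetric_normal_normal (hf : ContMDiff (𝓡 2) (𝓡∂ 3) ∞ f)
    (hν : ∀ p, IsUnitNormalAt (𝓡 2) g.form f p (ν p))
    (h : IsLocalOuterInjRadius g f ν r) {q : S} {u : EuclideanSpace ℝ (Fin 2) × ℝ}
    (hu : u ∈ collarDomain q r) : collarMetric g f ν r q (0, 1) (0, 1) u = 1 := by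
  obtain ⟨y, s⟩ := u
  have hconst := eq_of_hasDerivAt_zero
    (continuousOn_collarMetric_line hf h (y := y) hu.1 (0, 1) (0, 1)) (fun t ht => by
      have hk := mem_extChartAt_source (I := 𝓡∂ 3) (chartNormalExp g f ν q (y, t))
      have hd := hasDerivAt_collarMetric hf h hu.1 ht hk (0, 1) (0, 1)
      rwa [(solvesGeodesicAt_collarChart hf hν h (u := (y, t)) hu.1 ht hk).fderiv_speed g
        (contDiffAt_collarChart hf h (u := (y, t)) hu.1 ht hk)
        ((extChartAt (𝓡∂ 3) _).map_source hk)
        (eventually_collarChart_mem_range q _ _)] at hd) hu.2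
  rw [hconst]
  set p := (extChartAt (𝓡 2) q).symm y with hp
  have hk := mem_extChartAt_source (I := 𝓡∂ 3) (f p)
  have h0 : chartNormalExp g f ν q (y, 0) = f p := normalExp_zero hν h p
  have hk' : chartNormalExp g f ν q (y, 0) ∈ (extChartAt (𝓡∂ 3) (f p)).source := by rwa [h0]
  have hD : (y, (0 : ℝ)) ∈ collarDomain q r := ⟨hu.1, le_refl (0 : ℝ), h.pos⟩
  have hn : symmDeriv (𝓡∂ 3) (f p) (extChartAt (𝓡∂ 3) (f p) (f p))
      (fderivWithin ℝ (collarChart g f ν q (f p)) (collarDomain q r) (y, 0) (0, 1)) = ν p :=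
    (congrArg _ (fderivWithin_collarChart_zero hf hν h hu.1 hk)).trans (symmDeriv_mfderiv hk _)
  rw [collarMetric_eq hf h hD hk', collarChart, h0, chartBilin_extChartAt g hk]
  exact (congrArg (fun v => modelInner g (f p) v v) hn).trans (hν p).1

/-- The Gauss lemma for the collar. -/
lemma collarMetric_normal_tangent (hf : ContMDiff (𝓡 2) (𝓡∂ 3) ∞ f)
    (hν : ∀ p, IsUnitNormalAt (𝓡 2) g.form f p (ν p))
    (h : IsLocalOuterInjRadius g f ν r) {q : S} {u : EuclideanSpace ℝ (Fin 2) × ℝ}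
    (hu : u ∈ collarDomain q r) (e : EuclideanSpace ℝ (Fin 2)) :
    collarMetric g f ν r q (0, 1) (e, 0) u = 0 := by
  obtain ⟨y, s⟩ := u
  have hconst := eq_of_hasDerivAt_zero
    (continuousOn_collarMetric_line hf h (y := y) hu.1 (0, 1) (e, 0)) (fun t ht => by
      have hk := mem_extChartAt_source (I := 𝓡∂ 3) (chartNormalExp g f ν q (y, t))
      have hd := hasDerivAt_collarMetric hf h hu.1 ht hk (0, 1) (e, 0)
      have hev := collarMetric_eq_partialInner hf h (u := (y, t)) hu.1 ht hk (0, 1) (0, 1)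
      have hone : partialInner g (chartNormalExp g f ν q (y, t))
          (collarChart g f ν q (chartNormalExp g f ν q (y, t))) (0, 1) (0, 1) =ᶠ[𝓝 (y, t)]
          fun _ => (1 : ℝ) := by
        filter_upwards [hev, collarDomain_mem_nhds (u := (y, t)) hu.1 ht] with u' h1 h2
        rw [← h1, collarMetric_normal_normal hf hν h h2]
      rwa [(solvesGeodesicAt_collarChart hf hν h (u := (y, t)) hu.1 ht
        hk).fderiv_partialInner_left g
        (contDiffAt_collarChart hf h (u := (y, t)) hu.1 ht hk)
        ((extChartAt (𝓡∂ 3) _).map_source hk)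
        (eventually_collarChart_mem_range q _ _), hone.fderiv_eq, fderiv_fun_const, Pi.zero_apply,
        zero_apply, zero_div] at hd) hu.2
  rw [hconst]
  set p := (extChartAt (𝓡 2) q).symm y with hp
  have hk := mem_extChartAt_source (I := 𝓡∂ 3) (f p)
  have h0 : chartNormalExp g f ν q (y, 0) = f p := normalExp_zero hν h p
  have hk' : chartNormalExp g f ν q (y, 0) ∈ (extChartAt (𝓡∂ 3) (f p)).source := by rwa [h0]
  have hD : (y, (0 : ℝ)) ∈ collarDomain q r := ⟨hu.1, le_refl (0 : ℝ), h.pos⟩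
  have hslice := (hasFDerivAt_collarChart_slice hf h hD hk').fderiv
  have hslice' : fderivWithin ℝ (collarChart g f ν q (f p)) (collarDomain q r) (y, 0) (e, 0)
      = fderiv ℝ (fun y' => extChartAt (𝓡∂ 3) (f p) (f ((extChartAt (𝓡 2) q).symm y'))) y e := by
    have hfun : (fun y' => extChartAt (𝓡∂ 3) (f p) (f ((extChartAt (𝓡 2) q).symm y')))
        = fun y' => collarChart g f ν q (f p) (y', 0) := by
      funext y'
      simp only [collarChart, chartNormalExp, normalExp_zero hν h]
    rw [hfun, hslice]
    simp
  have hsd := symmDeriv_fderiv_chart (φ := f) hu.1 hp.symm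
    ((hf p).mdifferentiableAt (by simp)) hk e
  have hn : symmDeriv (𝓡∂ 3) (f p) (extChartAt (𝓡∂ 3) (f p) (f p))
      (fderivWithin ℝ (collarChart g f ν q (f p)) (collarDomain q r) (y, 0) (0, 1)) = ν p :=
    (congrArg _ (fderivWithin_collarChart_zero hf hν h hu.1 hk)).trans (symmDeriv_mfderiv hk _)
  rw [collarMetric_eq hf h hD hk', hslice', collarChart, h0, chartBilin_extChartAt g hk]
  exact (congrArg₂ (fun v w => modelInner g (f p) v w) hn hsd).trans ((hν p).2 _)

/-- The first variation of the induced metric of the sheets of the collar. -/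
lemma exists_unitNormal_hasDerivAt (hf : ContMDiff (𝓡 2) (𝓡∂ 3) ∞ f)
    (hν : ∀ p, IsUnitNormalAt (𝓡 2) g.form f p (ν p))
    (h : IsLocalOuterInjRadius g f ν r) (p : S) {s : ℝ} (hs : s ∈ Ioo 0 r) :
    ∃ n : TangentSpace (𝓡∂ 3) (normalExp g f ν (p, s)),
      IsUnitNormalAt (𝓡 2) g.form (fun x => normalExp g f ν (x, s)) p n ∧
      ∀ v w : EuclideanSpace ℝ (Fin 2),
        HasDerivAt (fun s' => chartForm (pullbackForm (𝓡 2) g.form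
            (fun x => normalExp g f ν (x, s'))) p (extChartAt (𝓡 2) p p) v w)
          (2 * secondFundForm (𝓡 2) g.form (fun x => normalExp g f ν (x, s)) p n v w) s := by
  set y := extChartAt (𝓡 2) p p with hy
  have hyt : y ∈ (extChartAt (𝓡 2) p).target := mem_extChartAt_target p
  have hyp : (extChartAt (𝓡 2) p).symm y = p := extChartAt_to_inv p
  set k := normalExp g f ν (p, s) with hkdef
  have hk0 : k ∈ (extChartAt (𝓡∂ 3) k).source := mem_extChartAt_source k
  have hΦ : chartNormalExp g f ν p (y, s) = k := by
    simp only [chartNormalExp, hyp, hkdef]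
  have hk : chartNormalExp g f ν p (y, s) ∈ (extChartAt (𝓡∂ 3) k).source := hΦ.symm ▸ hk0
  have hD : (y, s) ∈ collarDomain p r := ⟨hyt, hs.1.le, hs.2⟩
  have hDn := collarDomain_mem_nhds (r := r) (u := (y, s)) hyt hs
  set X := collarChart g f ν p k with hXdef
  have hX : ContDiffAt ℝ ∞ X (y, s) := contDiffAt_collarChart hf h (u := (y, s)) hyt hs hk
  have hXk : X (y, s) = extChartAt (𝓡∂ 3) k k := congrArg (extChartAt (𝓡∂ 3) k) hΦ
  have hT : X (y, s) ∈ (extChartAt (𝓡∂ 3) k).target := (extChartAt (𝓡∂ 3) k).map_source hk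
  have hr := eventually_collarChart_mem_range (g := g) (f := f) (ν := ν) p k (y, s)
  set τ : EuclideanSpace ℝ (Fin 3) := fderiv ℝ X (y, s) (0, 1) with hτ
  have hslice : ∀ a : EuclideanSpace ℝ (Fin 2),
      fderiv ℝ (fun y' => X (y', s)) y a = fderiv ℝ X (y, s) (a, 0) := by
    intro a
    rw [(hasFDerivAt_collarChart_slice hf h hD hk).fderiv, fderivWithin_of_mem_nhds hDn]
    simp [X]
  have hone : chartBilin g k (X (y, s)) τ τ = 1 := by
    have := collarMetric_normal_normal hf hν h hD
    rwa [collarMetric_eq hf h hD hk, fderivWithin_of_mem_nhds hDn] at this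
  have horth : ∀ a : EuclideanSpace ℝ (Fin 2),
      chartBilin g k (X (y, s)) τ (fderiv ℝ X (y, s) (a, 0)) = 0 := by
    intro a
    have := collarMetric_normal_tangent hf hν h hD a
    rwa [collarMetric_eq hf h hD hk, fderivWithin_of_mem_nhds hDn] at this
  have hfd : MDifferentiableAt (𝓡 2) (𝓡∂ 3) (fun x => normalExp g f ν (x, s)) p :=
    ((contMDiff_normalExp_slice hf h ⟨hs.1.le, hs.2⟩) p).mdifferentiableAt (by simp)
  let n : EuclideanSpace ℝ (Fin 3) := symmDeriv (𝓡∂ 3) k (extChartAt (𝓡∂ 3) k k) τ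
  refine ⟨n, ⟨?_, ?_⟩, ?_⟩
  · rw [hXk, chartBilin_extChartAt g hk0] at hone
    exact hone
  · intro (v : EuclideanSpace ℝ (Fin 2))
    have hsd := symmDeriv_fderiv_chart (φ := fun x => normalExp g f ν (x, s)) hyt hyp hfd hk0 v
    have hv := horth v
    rw [hXk, chartBilin_extChartAt g hk0, ← hslice] at hv
    rw [symmDeriv_self p v] at hsd
    exact (congrArg (modelInner g k n) hsd).symm.trans hv
  · intro v w
    have hzero : ∀ a b : EuclideanSpace ℝ (Fin 2),
        fderiv ℝ (partialInner g k X (0, 1) (a, 0)) (y, s) (b, 0) = 0 := by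
      intro a b
      have hev := collarMetric_eq_partialInner hf h (u := (y, s)) hyt hs hk (0, 1) (a, 0)
      have hz : partialInner g k X (0, 1) (a, 0) =ᶠ[𝓝 (y, s)] fun _ => (0 : ℝ) := by
        filter_upwards [hev, hDn] with u' h1 h2
        rw [← h1, collarMetric_normal_tangent hf hν h h2]
      rw [hz.fderiv_eq, fderiv_fun_const, Pi.zero_apply, zero_apply]
    have hd := hasDerivAt_collarMetric hf h hyt hs hk (v, 0) (w, 0)
    rw [fderiv_partialInner_normal g hX hT hr (hzero v w) (hzero w v)] at hd
    have hsecond : fderiv ℝ (fderiv ℝ (fun y' => X (y', s))) y v w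
        = fderiv ℝ (fderiv ℝ X) (y, s) (v, 0) (w, 0) := by
      have h1 : fderiv ℝ (fun y' => X (y', s)) =ᶠ[𝓝 y] fun y' =>
          (fderiv ℝ X (y', s)).comp (ContinuousLinearMap.inl ℝ (EuclideanSpace ℝ (Fin 2)) ℝ) := by
        have h2 : Tendsto (fun y' : EuclideanSpace ℝ (Fin 2) => (y', s)) (𝓝 y) (𝓝 (y, s)) :=
          (Continuous.prodMk_left s).tendsto y
        filter_upwards [h2.eventually
          ((hX.of_le (m := 1) (by simp)).eventually (by simp))] with y' hy'
        exact (HasFDerivAt.comp y' (hy'.differentiableAt (by simp)).hasFDerivAt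
          (hasFDerivAt_prodMk_left (𝕜 := ℝ) y' s)).fderiv
      have h3 : HasFDerivAt (fderiv ℝ X) (fderiv ℝ (fderiv ℝ X) (y, s)) (y, s) :=
        ((hX.fderiv_right (m := ∞) (by simp)).differentiableAt (by simp)).hasFDerivAt
      have h4 := (HasFDerivAt.comp y h3 (hasFDerivAt_prodMk_left (𝕜 := ℝ) y s)).clm_comp
        (hasFDerivAt_const (ContinuousLinearMap.inl ℝ (EuclideanSpace ℝ (Fin 2)) ℝ) y)
      rw [h1.fderiv_eq]
      have h5 := h4.fderiv
      simp only [Function.comp_def] at h5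
      rw [h5]
      simp
    have hval : secondFundForm (𝓡 2) g.form (fun x => normalExp g f ν (x, s)) p n v w
        = -(chartBilin g k (X (y, s)) (fderiv ℝ (fderiv ℝ X) (y, s) (v, 0) (w, 0)) τ
          + christoffel (metricForm g) k (X (y, s)) (fderiv ℝ X (y, s) (v, 0))
            (fderiv ℝ X (y, s) (w, 0)) τ) := by
      rw [← hsecond, ← hslice, ← hslice]
      have hm := mfderiv_symmDeriv (I := 𝓡∂ 3) hk0 τ
      exact congrArg (fun m => -(chartBilin g k (X (y, s))
        (fderiv ℝ (fderiv ℝ (fun y' => X (y', s))) y v w) m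
        + christoffel (metricForm g) k (X (y, s)) (fderiv ℝ (fun y' => X (y', s)) y v)
          (fderiv ℝ (fun y' => X (y', s)) y w) m)) hm
    rw [hval]
    have hev : (fun s' => chartForm (pullbackForm (𝓡 2) g.form
        (fun x => normalExp g f ν (x, s'))) p y v w)
        =ᶠ[𝓝 s] fun s' => collarMetric g f ν r p (v, 0) (w, 0) (y, s') := by
      filter_upwards [Ico_mem_nhds hs.1 hs.2] with s' hs'
      exact chartForm_slice hf h ⟨hyt, hs'⟩ v w
    refine (hd.congr_of_eventuallyEq hev).congr_deriv ?_
    rw [neg_mul, mul_neg]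

end Collar

section Gram

/-- The determinant of the Gram matrix of a bilinear form pulled back by a linear map. -/
lemma det_gram_comp {n : ℕ} {V W : Type*} [AddCommGroup V] [Module ℝ V] [AddCommGroup W]
    [Module ℝ W] (B : W →ₗ[ℝ] W →ₗ[ℝ] ℝ) (b : Module.Basis (Fin n) ℝ V)
    (b' : Module.Basis (Fin n) ℝ W) (T : V →ₗ[ℝ] W) :
    (Matrix.of fun i j => B (T (b i)) (T (b j))).det
      = (LinearMap.toMatrix b b' T).det ^ 2 * (Matrix.of fun i j => B (b' i) (b' j)).det := by
  have h := LinearMap.toMatrix₂_compl₁₂ b' b' b b B T T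
  have h1 : (Matrix.of fun i j => B (T (b i)) (T (b j)))
      = LinearMap.toMatrix₂ b b (B.compl₁₂ T T) := by
    ext i j
    simp [LinearMap.toMatrix₂_apply]
  have h2 : (Matrix.of fun i j => B (b' i) (b' j)) = LinearMap.toMatrix₂ b' b' B := by
    ext i j
    simp [LinearMap.toMatrix₂_apply]
  rw [h1, h2, h, Matrix.det_mul, Matrix.det_mul, Matrix.det_transpose]
  ring

/-- A positive definite form on the plane has positive Gram determinant. -/
lemma det_two_pos {a b c : ℝ} (h : ∀ x y : ℝ, (x ≠ 0 ∨ y ≠ 0) →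
    0 < a * x ^ 2 + 2 * b * x * y + c * y ^ 2) : 0 < a ∧ 0 < a * c - b ^ 2 := by
  have ha : 0 < a := by simpa using h 1 0 (by simp)
  refine ⟨ha, ?_⟩
  have h1 := h (-b) a (Or.inr ha.ne')
  have h2 : a * (-b) ^ 2 + 2 * b * (-b) * a + c * a ^ 2 = a * (a * c - b ^ 2) := by ring
  rw [h2] at h1
  exact (mul_pos_iff_of_pos_left ha).1 h1

/-- For symmetric `A` and positive definite `G`, the square of `tr (G⁻¹ A)` is at most
`2 tr ((G⁻¹ A)²)`, in dimension two. -/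
lemma sq_trace_le {a b c α β γ : ℝ} (ha : 0 < a) (hD : 0 < a * c - b ^ 2) :
    let G : Matrix (Fin 2) (Fin 2) ℝ := !![a, b; b, c]
    let A : Matrix (Fin 2) (Fin 2) ℝ := !![α, β; β, γ]
    ((c * α - 2 * b * β + a * γ) / (a * c - b ^ 2)) ^ 2
      ≤ 2 * (G⁻¹ * A * (G⁻¹ * A)).trace := by
  intro G A
  have hdet : G.det = a * c - b ^ 2 := by simp [G, Matrix.det_fin_two]; ring
  have hinv : G⁻¹ = (a * c - b ^ 2)⁻¹ • !![c, -b; -b, a] := by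
    rw [Matrix.inv_def, hdet, Ring.inverse_eq_inv']
    simp [G, Matrix.adjugate_fin_two]
  set D := a * c - b ^ 2 with hDdef
  have htr : (G⁻¹ * A * (G⁻¹ * A)).trace
      = ((c * α - 2 * b * β + a * γ) ^ 2 - 2 * D * (α * γ - β ^ 2)) / D ^ 2 := by
    rw [hinv]
    simp only [A, Matrix.smul_mul, Matrix.mul_smul, smul_smul, Matrix.trace_smul,
      Matrix.mul_fin_two, Matrix.trace_fin_two_of, smul_eq_mul]
    rw [hDdef] at hD ⊢
    field_simp
    ring
  rw [htr, div_pow, ← mul_div_assoc]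
  gcongr
  have key : 0 ≤ a ^ 2 * ((c * α - 2 * b * β + a * γ) ^ 2 - 4 * D * (α * γ - β ^ 2)) := by
    have : a ^ 2 * ((c * α - 2 * b * β + a * γ) ^ 2 - 4 * D * (α * γ - β ^ 2))
        = (D * α - (a ^ 2 * γ - 2 * a * b * β + b ^ 2 * α)) ^ 2
          + 4 * D * (a * β - b * α) ^ 2 := by
      rw [hDdef]; ring
    rw [this]
    positivity
  have := (mul_nonneg_iff_of_pos_left (pow_pos ha 2)).1 key
  linarith

/-- A positive function on `[0, r)` whose logarithmic derivative is at least `-κ` decays at most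
like `exp (-κ s)`. -/
lemma exp_neg_mul_le_of_hasDerivAt {D D' : ℝ → ℝ} {r κ : ℝ} (hc : ContinuousOn D (Ico 0 r))
    (hd : ∀ s ∈ Ioo 0 r, HasDerivAt D (D' s) s) (hκ : ∀ s ∈ Ioo 0 r, -κ * D s ≤ D' s)
    {s : ℝ} (hs : s ∈ Ico 0 r) : Real.exp (-(κ * s)) * D 0 ≤ D s := by
  have hmono : MonotoneOn (fun s => Real.exp (κ * s) * D s) (Ico 0 r) := by
    have hder : ∀ t ∈ Ioo 0 r, HasDerivAt (fun s => Real.exp (κ * s) * D s)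
        (Real.exp (κ * t) * κ * D t + Real.exp (κ * t) * D' t) t := by
      intro t ht
      have h1 : HasDerivAt (fun s : ℝ => κ * s) κ t := by simpa using (hasDerivAt_id t).const_mul κ
      exact h1.exp.mul (hd t ht)
    refine monotoneOn_of_deriv_nonneg (convex_Ico 0 r)
      ((Real.continuous_exp.comp (continuous_const.mul continuous_id)).continuousOn.mul hc) ?_ ?_
    · rw [interior_Ico]
      exact fun t ht => (hder t ht).differentiableAt.differentiableWithinAt
    · rw [interior_Ico]
      intro t ht
      rw [(hder t ht).deriv]
      have := mul_nonneg (Real.exp_pos (κ * t)).le (sub_nonneg.2 (hκ t ht))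
      linarith
  have h0 : (0 : ℝ) ∈ Ico 0 r := ⟨le_rfl, hs.1.trans_lt hs.2⟩
  have h := hmono h0 hs hs.1
  simp only [mul_zero, Real.exp_zero, one_mul] at h
  calc Real.exp (-(κ * s)) * D 0 ≤ Real.exp (-(κ * s)) * (Real.exp (κ * s) * D s) := by gcongr
    _ = D s := by rw [← mul_assoc, ← Real.exp_add]; simp

end Gram

section Sheet

variable {M : Type*} [TopologicalSpace M] [ChartedSpace (EuclideanHalfSpace 3) M]
  [IsManifold (𝓡∂ 3) ∞ M]
  {S : Type*} [TopologicalSpace S] [ChartedSpace (EuclideanSpace ℝ (Fin 2)) S]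
  [IsManifold (𝓡 2) ∞ S]
  {g : Metric3 M} {f : S → M} {ν : ∀ p : S, TangentSpace (𝓡∂ 3) (f p)} {r : ℝ}

/-- The derivative of a map from a surface, as a map between model spaces. -/
def modelDeriv (φ : S → M) (p : S) : EuclideanSpace ℝ (Fin 2) →L[ℝ] EuclideanSpace ℝ (Fin 3) :=
  mfderiv (𝓡 2) (𝓡∂ 3) φ p

omit [IsManifold (𝓡 2) ∞ S] in
lemma chartForm_pullbackForm_eq (φ : S → M) (q : S) (y a b : EuclideanSpace ℝ (Fin 2)) :
    chartForm (pullbackForm (𝓡 2) g.form φ) q y a b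
      = modelInner g (φ ((extChartAt (𝓡 2) q).symm y))
        (modelDeriv φ ((extChartAt (𝓡 2) q).symm y) (symmDeriv (𝓡 2) q y a))
        (modelDeriv φ ((extChartAt (𝓡 2) q).symm y) (symmDeriv (𝓡 2) q y b)) := rfl

lemma modelDeriv_slice_injective (hf : ContMDiff (𝓡 2) (𝓡∂ 3) ∞ f)
    (h : IsLocalOuterInjRadius g f ν r) {s : ℝ} (hs : s ∈ Ico 0 r) (p : S) :
    Function.Injective (modelDeriv (fun x => normalExp g f ν (x, s)) p) := by
  have hB := intrinsicBall_mem_nhds g hf p h.pos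
  have hp : p ∈ intrinsicBall g f p r := mem_of_mem_nhds hB
  obtain ⟨-, ψ, hψ, hinv⟩ := h.diffeo p
  set φ : S → M := fun x => normalExp g f ν (x, s) with hφdef
  have hφ : HasMFDerivAt (𝓡 2) (𝓡∂ 3) φ p (mfderiv (𝓡 2) (𝓡∂ 3) φ p) :=
    ((contMDiff_normalExp_slice hf h hs p).mdifferentiableAt (by simp)).hasMFDerivAt
  have hψp := ((hψ (φ p) ⟨(p, s), ⟨hp, hs⟩, rfl⟩).mdifferentiableWithinAt
    (by simp)).hasMFDerivWithinAt
  have hcomp := HasMFDerivWithinAt.comp p hψp (hφ.hasMFDerivWithinAt (s := intrinsicBall g f p r))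
    (fun x hx => ⟨(x, s), ⟨hx, hs⟩, rfl⟩)
  have hfst := HasMFDerivAt.comp_hasMFDerivWithinAt p (hasMFDerivAt_fst (x := ψ (φ p))) hcomp
  have hid : HasMFDerivAt (𝓡 2) (𝓡 2) (id : S → S) p _ :=
    (hfst.congr_of_eventuallyEq (f₁ := id) (by
      filter_upwards [self_mem_nhdsWithin] with x hx
      have := hinv (show (x, s) ∈ _ from ⟨hx, hs⟩)
      exact (congrArg Prod.fst this).symm) (by
      have := hinv (show (p, s) ∈ _ from ⟨hp, hs⟩)
      exact (congrArg Prod.fst this).symm)).hasMFDerivAt hB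
  have heq := hasMFDerivAt_unique hid (hasMFDerivAt_id p)
  intro v w hvw
  have hv := DFunLike.congr_fun heq v
  have hw := DFunLike.congr_fun heq w
  refine hv.symm.trans (Eq.trans ?_ hw)
  exact congrArg (fun u : EuclideanSpace ℝ (Fin 3) =>
    (ContinuousLinearMap.fst ℝ (EuclideanSpace ℝ (Fin 2)) ℝ)
      (mfderivWithin (𝓡∂ 3) ((𝓡 2).prod 𝓘(ℝ, ℝ)) ψ
        (normalExp g f ν '' intrinsicBall g f p r ×ˢ Ico 0 r) (φ p) u)) hvw

omit [IsManifold (𝓡 2) ∞ S] in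
lemma gramMatrix_fin_two (φ : S → M) (q : S) (y : EuclideanSpace ℝ (Fin 2)) :
    gramMatrix (pullbackForm (𝓡 2) g.form φ) q y =
      !![chartForm (pullbackForm (𝓡 2) g.form φ) q y (EuclideanSpace.single 0 1)
          (EuclideanSpace.single 0 1),
        chartForm (pullbackForm (𝓡 2) g.form φ) q y (EuclideanSpace.single 0 1)
          (EuclideanSpace.single 1 1);
        chartForm (pullbackForm (𝓡 2) g.form φ) q y (EuclideanSpace.single 0 1)
          (EuclideanSpace.single 1 1),
        chartForm (pullbackForm (𝓡 2) g.form φ) q y (EuclideanSpace.single 1 1)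
          (EuclideanSpace.single 1 1)] := by
  have hs : chartForm (pullbackForm (𝓡 2) g.form φ) q y (EuclideanSpace.single 1 1)
      (EuclideanSpace.single 0 1) = chartForm (pullbackForm (𝓡 2) g.form φ) q y
        (EuclideanSpace.single 0 1) (EuclideanSpace.single 1 1) := g.symm _ _ _
  ext i j
  fin_cases i <;> fin_cases j
  · rfl
  · rfl
  · exact hs
  · rfl

/-- The Gram determinants of an induced metric in the charts at `q` and at the point itself. -/
lemma det_gramMatrix_pullbackForm (φ : S → M) (q : S) (y : EuclideanSpace ℝ (Fin 2)) {p : S}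
    (hp : (extChartAt (𝓡 2) q).symm y = p) :
    (gramMatrix (pullbackForm (𝓡 2) g.form φ) q y).det
      = (LinearMap.toMatrix (EuclideanSpace.basisFun (Fin 2) ℝ).toBasis
          (EuclideanSpace.basisFun (Fin 2) ℝ).toBasis (symmDeriv (𝓡 2) q y).toLinearMap).det ^ 2
        * (gramMatrix (pullbackForm (𝓡 2) g.form φ) p (extChartAt (𝓡 2) p p)).det := by
  subst hp
  set p := (extChartAt (𝓡 2) q).symm y with hpdef
  let B : EuclideanSpace ℝ (Fin 2) →L[ℝ] EuclideanSpace ℝ (Fin 2) →L[ℝ] ℝ :=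
    (modelInner g (φ p)).bilinearComp (modelDeriv φ p) (modelDeriv φ p)
  have h := det_gram_comp B.toLinearMap₁₂ (EuclideanSpace.basisFun (Fin 2) ℝ).toBasis
    (EuclideanSpace.basisFun (Fin 2) ℝ).toBasis (symmDeriv (𝓡 2) q y).toLinearMap
  convert h using 2
  · ext i j
    simp [gramMatrix, chartForm_pullbackForm_eq, B]
    rfl
  · congr 1
    ext i j
    have hsd := symmDeriv_self p
    have hpp : (extChartAt (𝓡 2) p).symm (extChartAt (𝓡 2) p p) = p := extChartAt_to_inv p
    simp only [gramMatrix, Matrix.of_apply, chartForm_pullbackForm_eq, hsd]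
    rw [hpp]
    simp [B]

lemma chartForm_slice_self_pos (hf : ContMDiff (𝓡 2) (𝓡∂ 3) ∞ f)
    (h : IsLocalOuterInjRadius g f ν r) {s : ℝ} (hs : s ∈ Ico 0 r) (p : S)
    {v : EuclideanSpace ℝ (Fin 2)} (hv : v ≠ 0) :
    0 < chartForm (pullbackForm (𝓡 2) g.form (fun x => normalExp g f ν (x, s))) p
      (extChartAt (𝓡 2) p p) v v := by
  rw [chartForm_pullbackForm_eq, symmDeriv_self]
  refine modelInner_pos g _ fun h0 => hv ?_
  exact modelDeriv_slice_injective hf h hs _ (h0.trans (map_zero _).symm)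

omit [IsManifold (𝓡 2) ∞ S] in
lemma chartForm_pullbackForm_combination (φ : S → M) (q : S) (z v w : EuclideanSpace ℝ (Fin 2))
    (x y : ℝ) :
    chartForm (pullbackForm (𝓡 2) g.form φ) q z (x • v + y • w) (x • v + y • w)
      = chartForm (pullbackForm (𝓡 2) g.form φ) q z v v * x ^ 2
        + 2 * chartForm (pullbackForm (𝓡 2) g.form φ) q z v w * x * y
        + chartForm (pullbackForm (𝓡 2) g.form φ) q z w w * y ^ 2 := by
  simp only [chartForm_pullbackForm_eq, map_add, map_smul, add_apply, smul_apply, smul_eq_mul]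
  rw [modelInner_symm g _ (modelDeriv φ ((extChartAt (𝓡 2) q).symm z) (symmDeriv (𝓡 2) q z w))
    (modelDeriv φ ((extChartAt (𝓡 2) q).symm z) (symmDeriv (𝓡 2) q z v))]
  ring

lemma gram_slice_pos (hf : ContMDiff (𝓡 2) (𝓡∂ 3) ∞ f)
    (h : IsLocalOuterInjRadius g f ν r) {s : ℝ} (hs : s ∈ Ico 0 r) (p : S) :
    let H := chartForm (pullbackForm (𝓡 2) g.form (fun x => normalExp g f ν (x, s))) p
      (extChartAt (𝓡 2) p p)
    let e₀ : EuclideanSpace ℝ (Fin 2) := EuclideanSpace.single 0 1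
    let e₁ : EuclideanSpace ℝ (Fin 2) := EuclideanSpace.single 1 1
    0 < H e₀ e₀ ∧ 0 < H e₀ e₀ * H e₁ e₁ - H e₀ e₁ ^ 2 := by
  intro H e₀ e₁
  refine det_two_pos fun x y hxy => ?_
  rw [← chartForm_pullbackForm_combination]
  refine chartForm_slice_self_pos hf h hs p fun h0 => ?_
  have h1 := congrArg (fun v : EuclideanSpace ℝ (Fin 2) => v 0) h0
  have h2 := congrArg (fun v : EuclideanSpace ℝ (Fin 2) => v 1) h0
  simp [e₀, e₁] at h1 h2
  rcases hxy with hx | hy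
  · exact hx h1
  · exact hy h2

variable [T2Space M]

/-- The area element of the sheets of the collar decays at most exponentially. -/
lemma exp_mul_det_gramMatrix_le_center (hf : ContMDiff (𝓡 2) (𝓡∂ 3) ∞ f)
    (hν : ∀ p, IsUnitNormalAt (𝓡 2) g.form f p (ν p))
    (h : IsLocalOuterInjRadius g f ν r) {K : ℝ} (hK0 : 0 ≤ K)
    (hK : 2 * supSecondFund g f ν ≤ ENNReal.ofReal K) (p : S) {s : ℝ} (hs : s ∈ Ico 0 r) :
    Real.exp (-(3 * K * s))
        * (gramMatrix (pullbackForm (𝓡 2) g.form f) p (extChartAt (𝓡 2) p p)).det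
      ≤ (gramMatrix (pullbackForm (𝓡 2) g.form (fun x => normalExp g f ν (x, s))) p
          (extChartAt (𝓡 2) p p)).det := by
  have hf0 : f = fun x => normalExp g f ν (x, 0) := funext fun x => (normalExp_zero hν h x).symm
  let H : ℝ → EuclideanSpace ℝ (Fin 2) → EuclideanSpace ℝ (Fin 2) → ℝ := fun s =>
    chartForm (pullbackForm (𝓡 2) g.form (fun x => normalExp g f ν (x, s))) p
      (extChartAt (𝓡 2) p p)
  let e₀ : EuclideanSpace ℝ (Fin 2) := EuclideanSpace.single 0 1
  let e₁ : EuclideanSpace ℝ (Fin 2) := EuclideanSpace.single 1 1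
  have hdet : ∀ t, (gramMatrix (pullbackForm (𝓡 2) g.form (fun x => normalExp g f ν (x, t))) p
      (extChartAt (𝓡 2) p p)).det = H t e₀ e₀ * H t e₁ e₁ - H t e₀ e₁ ^ 2 := by
    intro t
    rw [gramMatrix_fin_two, Matrix.det_fin_two_of, sq]
  have hcont : ∀ a b, ContinuousOn (fun t => H t a b) (Ico 0 r) := by
    intro a b
    refine (continuousOn_collarMetric_line hf h (mem_extChartAt_target p) (a, 0) (b, 0)).congr ?_
    intro t ht
    exact chartForm_slice hf h ⟨mem_extChartAt_target p, ht⟩ a b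
  choose! n hn hd using fun t (ht : t ∈ Ioo 0 r) => exists_unitNormal_hasDerivAt hf hν h p ht
  let A : ℝ → EuclideanSpace ℝ (Fin 2) → EuclideanSpace ℝ (Fin 2) → ℝ := fun t =>
    secondFundForm (𝓡 2) g.form (fun x => normalExp g f ν (x, t)) p (n t)
  have hsymm : ∀ t ∈ Ioo 0 r, A t e₁ e₀ = A t e₀ e₁ := by
    intro t ht
    have h1 := hd t ht e₀ e₁
    have h2 : HasDerivAt (fun s' => H s' e₀ e₁) (2 * A t e₁ e₀) t := by
      refine (hd t ht e₁ e₀).congr_of_eventuallyEq (Eventually.of_forall fun s' => ?_)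
      exact g.symm _ _ _
    have h3 : 2 * A t e₁ e₀ = 2 * A t e₀ e₁ := h2.unique h1
    linarith
  have hderiv : ∀ t ∈ Ioo 0 r, HasDerivAt (fun t => H t e₀ e₀ * H t e₁ e₁ - H t e₀ e₁ ^ 2)
      (2 * (H t e₁ e₁ * A t e₀ e₀ - 2 * H t e₀ e₁ * A t e₀ e₁ + H t e₀ e₀ * A t e₁ e₁)) t := by
    intro t ht
    have h1 := ((hd t ht e₀ e₀).mul (hd t ht e₁ e₁)).sub ((hd t ht e₀ e₁).pow 2)
    refine h1.congr_deriv ?_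
    simp only [H, A]
    push_cast
    ring
  have hbound : ∀ t ∈ Ioo 0 r, -(3 * K) * (H t e₀ e₀ * H t e₁ e₁ - H t e₀ e₁ ^ 2)
      ≤ 2 * (H t e₁ e₁ * A t e₀ e₀ - 2 * H t e₀ e₁ * A t e₀ e₁ + H t e₀ e₀ * A t e₁ e₁) := by
    intro t ht
    obtain ⟨ha, hD⟩ := gram_slice_pos hf h ⟨ht.1.le, ht.2⟩ p
    change 0 < H t e₀ e₀ at ha
    change 0 < H t e₀ e₀ * H t e₁ e₁ - H t e₀ e₁ ^ 2 at hD
    have hcurv := (h.curvature p t ⟨ht.1.le, ht.2⟩ p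
      (mem_of_mem_nhds (intrinsicBall_mem_nhds g hf p h.pos)) (n t) (hn t ht)).trans hK
    rw [ENNReal.ofReal_le_ofReal_iff hK0] at hcurv
    have hsq := sq_trace_le (α := A t e₀ e₀) (β := A t e₀ e₁) (γ := A t e₁ e₁) ha hD
    have hnorm : secondFundNorm (𝓡 2) g.form (fun x => normalExp g f ν (x, t)) p (n t)
        = √(((!![H t e₀ e₀, H t e₀ e₁; H t e₀ e₁, H t e₁ e₁])⁻¹
            * !![A t e₀ e₀, A t e₀ e₁; A t e₀ e₁, A t e₁ e₁])
          * ((!![H t e₀ e₀, H t e₀ e₁; H t e₀ e₁, H t e₁ e₁])⁻¹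
            * !![A t e₀ e₀, A t e₀ e₁; A t e₀ e₁, A t e₁ e₁])).trace := by
      rw [secondFundNorm, gramMatrix_fin_two]
      have hA : (Matrix.of fun i j : Fin 2 =>
          secondFundForm (𝓡 2) g.form (fun x => normalExp g f ν (x, t)) p (n t)
            (EuclideanSpace.single i 1) (EuclideanSpace.single j 1))
          = !![A t e₀ e₀, A t e₀ e₁; A t e₀ e₁, A t e₁ e₁] := by
        have := hsymm t ht
        ext i j
        fin_cases i <;> fin_cases j
        · rfl
        · rfl
        · exact this
        · rfl
      rw [hA]
    rw [hnorm, Real.sqrt_le_left hK0] at hcurv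
    simp only at hsq
    set D := H t e₀ e₀ * H t e₁ e₁ - H t e₀ e₁ ^ 2
    set N := H t e₁ e₁ * A t e₀ e₀ - 2 * H t e₀ e₁ * A t e₀ e₁ + H t e₀ e₀ * A t e₁ e₁
    have h4 : (N / D) ^ 2 ≤ (3 / 2 * K) ^ 2 := by nlinarith [sq_nonneg K]
    have h5 := (abs_le_of_sq_le_sq' h4 (by positivity)).1
    rw [le_div_iff₀ hD] at h5
    linarith
  have hres := exp_neg_mul_le_of_hasDerivAt
    (((hcont e₀ e₀).mul (hcont e₁ e₁)).sub ((hcont e₀ e₁).pow 2)) hderiv hbound hs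
  rw [hdet s]
  refine le_trans (le_of_eq ?_) hres
  congr 1
  have := hdet 0
  rwa [← hf0] at this

/-- The area element of the sheets of the collar decays at most exponentially. -/
lemma exp_mul_det_gramMatrix_le (hf : ContMDiff (𝓡 2) (𝓡∂ 3) ∞ f)
    (hν : ∀ p, IsUnitNormalAt (𝓡 2) g.form f p (ν p))
    (h : IsLocalOuterInjRadius g f ν r) {K : ℝ} (hK0 : 0 ≤ K)
    (hK : 2 * supSecondFund g f ν ≤ ENNReal.ofReal K) (q : S) (y : EuclideanSpace ℝ (Fin 2))
    {s : ℝ} (hs : s ∈ Ico 0 r) :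
    Real.exp (-(3 * K * s)) * (gramMatrix (pullbackForm (𝓡 2) g.form f) q y).det
      ≤ (gramMatrix (pullbackForm (𝓡 2) g.form (fun x => normalExp g f ν (x, s))) q y).det := by
  rw [det_gramMatrix_pullbackForm f q y rfl, det_gramMatrix_pullbackForm _ q y rfl]
  have := exp_mul_det_gramMatrix_le_center hf hν h hK0 hK ((extChartAt (𝓡 2) q).symm y) hs
  rw [mul_left_comm]
  gcongr

end Sheet

section Measurability

lemma measurableSet_inter_preimage {X Y : Type*} [TopologicalSpace X] [MeasurableSpace X]
    [OpensMeasurableSpace X] [TopologicalSpace Y] [MeasurableSpace Y] [BorelSpace Y] {φ : X → Y}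
    {s : Set X} {T : Set Y} (hφ : ContinuousOn φ s) (hs : MeasurableSet s) (hT : MeasurableSet T) :
    MeasurableSet (s ∩ φ ⁻¹' T) := by
  have h := (continuousOn_iff_continuous_domRestrict.1 hφ).measurable hT
  have h2 := (MeasurableEmbedding.subtype_coe hs).measurableSet_image.2 h
  convert h2 using 1
  ext x
  simp [and_comm]

variable {n : ℕ} {H : Type*} [TopologicalSpace H]
  {I : ModelWithCorners ℝ (EuclideanSpace ℝ (Fin n)) H}
  {M : Type*} [TopologicalSpace M] [ChartedSpace H M]

lemma measurableSet_extChartAt_target (q : M) : MeasurableSet (extChartAt I q).target := by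
  rw [extChartAt_target]
  exact (((chartAt H q).open_target.preimage I.continuous_symm).measurableSet).inter
    I.isClosed_range.measurableSet

lemma chartVolume_apply [MeasurableSpace M] [BorelSpace M] (b : FormField I M) (q : M) {A : Set M}
    (hA : MeasurableSet A) :
    chartVolume b q A = ∫⁻ z in (extChartAt I q).target ∩ (extChartAt I q).symm ⁻¹' A,
      ENNReal.ofReal √(gramMatrix b q z).det := by
  have ht := measurableSet_extChartAt_target (I := I) q
  have hm : AEMeasurable (extChartAt I q).symm
      ((volume.restrict (extChartAt I q).target).withDensity
        (fun z => ENNReal.ofReal √(gramMatrix b q z).det)) :=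
    ((continuousOn_extChartAt_symm q).aemeasurable ht).mono_ac
      (withDensity_absolutelyContinuous _ _)
  rw [chartVolume, Measure.map_apply_of_aemeasurable hm hA, withDensity_apply',
    Measure.restrict_restrict' ht, inter_comm]

/-- A manifold with countable topology is covered by a sequence of chart domains. -/
lemma exists_seq_iUnion_extChartAt_source [SecondCountableTopology M] [Nonempty M] :
    ∃ k : ℕ → M, ⋃ i, (extChartAt I (k i)).source = univ := by
  obtain ⟨s, hs, hcov⟩ := TopologicalSpace.countable_cover_nhds
    (fun x : M => extChartAt_source_mem_nhds (I := I) x)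
  have hne : s.Nonempty := by
    by_contra hemp
    rw [not_nonempty_iff_eq_empty] at hemp
    subst hemp
    rw [biUnion_empty] at hcov
    exact (univ_nonempty (α := M)).ne_empty hcov.symm
  obtain ⟨k, rfl⟩ := hs.exists_eq_range hne
  exact ⟨k, by simpa using hcov⟩

end Measurability

section Split

/-- Splitting off the last coordinate of Euclidean space. -/
def splitLast : EuclideanSpace ℝ (Fin 3) ≃L[ℝ] EuclideanSpace ℝ (Fin 2) × ℝ :=
  LinearEquiv.toContinuousLinearEquiv
    { toFun := fun z => (!₂[z 0, z 1], z 2)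
      invFun := fun u => !₂[u.1 0, u.1 1, u.2]
      map_add' := fun x y => by
        refine Prod.ext ?_ rfl
        ext i; fin_cases i <;> rfl
      map_smul' := fun c x => by
        refine Prod.ext ?_ rfl
        ext i; fin_cases i <;> rfl
      left_inv := fun x => by ext i; fin_cases i <;> rfl
      right_inv := fun u => by
        refine Prod.ext ?_ rfl
        ext i; fin_cases i <;> rfl }

lemma splitLast_apply (z : EuclideanSpace ℝ (Fin 3)) : splitLast z = (!₂[z 0, z 1], z 2) := rfl

lemma measurePreserving_splitLast : MeasurePreserving splitLast := by
  have h1 := EuclideanSpace.volume_preserving_symm_measurableEquiv_toLp (Fin 3)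
  have h2 := volume_preserving_piFinSuccAbove (fun _ : Fin 3 => ℝ) 2
  have h3 : MeasurePreserving (Prod.swap : ℝ × (Fin 2 → ℝ) → (Fin 2 → ℝ) × ℝ) :=
    Measure.measurePreserving_swap
  have h4 := (EuclideanSpace.volume_preserving_symm_measurableEquiv_toLp (Fin 2)).symm.prod
    (MeasurePreserving.id (volume : Measure ℝ))
  have h : MeasurePreserving _ volume (volume : Measure (EuclideanSpace ℝ (Fin 2) × ℝ)) :=
    h4.comp (h3.comp (h2.comp h1))
  have hfun : (splitLast : EuclideanSpace ℝ (Fin 3) → EuclideanSpace ℝ (Fin 2) × ℝ)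
      = Prod.map (MeasurableEquiv.toLp 2 (Fin 2 → ℝ)).symm.symm id ∘ Prod.swap ∘
        MeasurableEquiv.piFinSuccAbove (fun _ : Fin 3 => ℝ) 2 ∘
          (MeasurableEquiv.toLp 2 (Fin 3 → ℝ)).symm := by
    funext z
    refine Prod.ext ?_ rfl
    ext i
    fin_cases i <;> rfl
  rw [hfun]
  exact h

end Split

section Volume

variable {M : Type*} [TopologicalSpace M] [ChartedSpace (EuclideanHalfSpace 3) M]
  [IsManifold (𝓡∂ 3) ∞ M]
  {S : Type*} [TopologicalSpace S] [ChartedSpace (EuclideanSpace ℝ (Fin 2)) S]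
  [IsManifold (𝓡 2) ∞ S]
  {g : Metric3 M} {f : S → M} {ν : ∀ p : S, TangentSpace (𝓡∂ 3) (f p)} {r : ℝ}

variable [T2Space M]

/-- The Gram determinant of the collar in the coordinates given by the normal exponential map is
that of the sheets. -/
lemma det_collarMetric (hf : ContMDiff (𝓡 2) (𝓡∂ 3) ∞ f)
    (hν : ∀ p, IsUnitNormalAt (𝓡 2) g.form f p (ν p))
    (h : IsLocalOuterInjRadius g f ν r) {q : S} {u : EuclideanSpace ℝ (Fin 2) × ℝ}
    (hu : u ∈ collarDomain q r) :
    (Matrix.of fun i j : Fin 3 => collarMetric g f ν r q (splitLast (EuclideanSpace.single i 1))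
        (splitLast (EuclideanSpace.single j 1)) u).det
      = (gramMatrix (pullbackForm (𝓡 2) g.form (fun x => normalExp g f ν (x, u.2))) q u.1).det := by
  have e0 : splitLast (EuclideanSpace.single 0 1) = (EuclideanSpace.single 0 1, 0) := by
    refine Prod.ext ?_ ?_
    · ext i; fin_cases i <;> simp [splitLast_apply]
    · simp [splitLast_apply]
  have e1 : splitLast (EuclideanSpace.single 1 1) = (EuclideanSpace.single 1 1, 0) := by
    refine Prod.ext ?_ ?_
    · ext i; fin_cases i <;> simp [splitLast_apply]
    · simp [splitLast_apply]
  have e2 : splitLast (EuclideanSpace.single 2 1) = (0, 1) := by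
    refine Prod.ext ?_ ?_
    · ext i; fin_cases i <;> simp [splitLast_apply]
    · simp [splitLast_apply]
  have hn := collarMetric_normal_normal hf hν h hu
  have ht := fun e => collarMetric_normal_tangent hf hν h hu e
  have ht' : ∀ e : EuclideanSpace ℝ (Fin 2), collarMetric g f ν r q (e, 0) (0, 1) u = 0 :=
    fun e => (collarMetric_comm q _ _ u).trans (ht e)
  rw [Matrix.det_fin_three, gramMatrix_fin_two, Matrix.det_fin_two_of]
  simp only [Matrix.of_apply, e0, e1, e2, hn, ht, ht']
  simp only [chartForm_slice hf h (y := u.1) (s := u.2) hu]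
  rw [collarMetric_comm q (EuclideanSpace.single 1 1, 0) (EuclideanSpace.single 0 1, 0) u]
  ring

/-- The volume density of the collar in a chart of the manifold, pulled back by the normal
exponential map. -/
lemma abs_det_mul_sqrt_gramMatrix (hf : ContMDiff (𝓡 2) (𝓡∂ 3) ∞ f)
    (hν : ∀ p, IsUnitNormalAt (𝓡 2) g.form f p (ν p))
    (h : IsLocalOuterInjRadius g f ν r) {q : S} {k : M} {u : EuclideanSpace ℝ (Fin 2) × ℝ}
    (hu : u ∈ collarDomain q r)
    (hk : chartNormalExp g f ν q u ∈ (extChartAt (𝓡∂ 3) k).source) :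
    |((fderivWithin ℝ (collarChart g f ν q k) (collarDomain q r) u).comp
        (splitLast : EuclideanSpace ℝ (Fin 3) →L[ℝ] EuclideanSpace ℝ (Fin 2) × ℝ)).det|
      * √(gramMatrix g.form k (collarChart g f ν q k u)).det
      = √(gramMatrix (pullbackForm (𝓡 2) g.form (fun x => normalExp g f ν (x, u.2))) q
          u.1).det := by
  set T := (fderivWithin ℝ (collarChart g f ν q k) (collarDomain q r) u).comp
        (splitLast : EuclideanSpace ℝ (Fin 3) →L[ℝ] EuclideanSpace ℝ (Fin 2) × ℝ) with hT
  have hgram := det_gram_comp (chartBilin g k (collarChart g f ν q k u)).toLinearMap₁₂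
    (EuclideanSpace.basisFun (Fin 3) ℝ).toBasis (EuclideanSpace.basisFun (Fin 3) ℝ).toBasis
    T.toLinearMap
  rw [LinearMap.det_toMatrix] at hgram
  have h1 : (Matrix.of fun i j : Fin 3 => (chartBilin g k (collarChart g f ν q k u)).toLinearMap₁₂
      (T.toLinearMap ((EuclideanSpace.basisFun (Fin 3) ℝ).toBasis i))
      (T.toLinearMap ((EuclideanSpace.basisFun (Fin 3) ℝ).toBasis j)))
      = Matrix.of fun i j : Fin 3 => collarMetric g f ν r q
        (splitLast (EuclideanSpace.single i 1)) (splitLast (EuclideanSpace.single j 1)) u := by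
    ext i j
    simp [collarMetric_eq hf h hu hk, hT]
  have h2 : (Matrix.of fun i j : Fin 3 => (chartBilin g k (collarChart g f ν q k u)).toLinearMap₁₂
      ((EuclideanSpace.basisFun (Fin 3) ℝ).toBasis i)
      ((EuclideanSpace.basisFun (Fin 3) ℝ).toBasis j))
      = gramMatrix g.form k (collarChart g f ν q k u) := by
    ext i j
    simp [gramMatrix]
    rfl
  rw [h1, h2, det_collarMetric hf hν h hu] at hgram
  rw [hgram, Real.sqrt_mul (sq_nonneg _), Real.sqrt_sq_eq_abs]

end Volume

section Volume

variable {M : Type*} [TopologicalSpace M] [ChartedSpace (EuclideanHalfSpace 3) M]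
  [IsManifold (𝓡∂ 3) ∞ M]
  {S : Type*} [TopologicalSpace S] [ChartedSpace (EuclideanSpace ℝ (Fin 2)) S]
  [IsManifold (𝓡 2) ∞ S]
  {g : Metric3 M} {f : S → M} {ν : ∀ p : S, TangentSpace (𝓡∂ 3) (f p)} {r : ℝ}

lemma measurableSet_chartNormalExp_image [T2Space M] [SecondCountableTopology M]
    [MeasurableSpace M] [BorelSpace M]
    (hf : ContMDiff (𝓡 2) (𝓡∂ 3) ∞ f)
    (h : IsLocalOuterInjRadius g f ν r) {q : S} {P : Set (EuclideanSpace ℝ (Fin 2) × ℝ)}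
    (hP : P ⊆ collarDomain q r) (hPm : MeasurableSet P) (hinj : InjOn (chartNormalExp g f ν q) P) :
    MeasurableSet (chartNormalExp g f ν q '' P) :=
  hPm.image_of_continuousOn_injOn ((contMDiffOn_chartNormalExp hf h q).continuousOn.mono hP) hinj

variable [T2Space M] [SecondCountableTopology M] [MeasurableSpace M] [BorelSpace M]

/-- The volume of a region of the collar inside a chart domain. -/
lemma chartVolume_chartNormalExp_image (hf : ContMDiff (𝓡 2) (𝓡∂ 3) ∞ f)
    (hν : ∀ p, IsUnitNormalAt (𝓡 2) g.form f p (ν p))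
    (h : IsLocalOuterInjRadius g f ν r) {q : S} {k : M}
    {P : Set (EuclideanSpace ℝ (Fin 2) × ℝ)} (hP : P ⊆ collarDomain q r) (hPm : MeasurableSet P)
    (hinj : InjOn (chartNormalExp g f ν q) P)
    (hk : MapsTo (chartNormalExp g f ν q) P (extChartAt (𝓡∂ 3) k).source) :
    chartVolume g.form k (chartNormalExp g f ν q '' P)
      = ∫⁻ u in P, ENNReal.ofReal √(gramMatrix (pullbackForm (𝓡 2) g.form
          (fun x => normalExp g f ν (x, u.2))) q u.1).det := by
  have hset : (extChartAt (𝓡∂ 3) k).target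
      ∩ (extChartAt (𝓡∂ 3) k).symm ⁻¹' (chartNormalExp g f ν q '' P)
      = (fun z => collarChart g f ν q k (splitLast z)) '' (splitLast ⁻¹' P) := by
    ext z
    constructor
    · rintro ⟨hz, u, hu, hzu⟩
      refine ⟨splitLast.symm u, by simpa using hu, ?_⟩
      simp only [ContinuousLinearEquiv.apply_symm_apply, collarChart]
      rw [hzu, (extChartAt (𝓡∂ 3) k).right_inv hz]
    · rintro ⟨w, hw, rfl⟩
      exact ⟨(extChartAt (𝓡∂ 3) k).map_source (hk hw), splitLast w, hw,
        ((extChartAt (𝓡∂ 3) k).left_inv (hk hw)).symm⟩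
  have hemb : MeasurableEmbedding splitLast := splitLast.toHomeomorph.measurableEmbedding
  have hderiv : ∀ z ∈ splitLast ⁻¹' P, HasFDerivWithinAt
      (fun z => collarChart g f ν q k (splitLast z))
      ((fderivWithin ℝ (collarChart g f ν q k) (collarDomain q r) (splitLast z)).comp
        (splitLast : EuclideanSpace ℝ (Fin 3) →L[ℝ] EuclideanSpace ℝ (Fin 2) × ℝ))
      (splitLast ⁻¹' P) z := by
    intro z hz
    have h1 := ((contDiffWithinAt_collarChart hf h (hP hz) (hk hz)).differentiableWithinAt
      (by simp)).hasFDerivWithinAt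
    exact h1.comp z splitLast.hasFDerivAt.hasFDerivWithinAt (fun w hw => hP hw)
  have hinj' : InjOn (fun z => collarChart g f ν q k (splitLast z)) (splitLast ⁻¹' P) := by
    intro z hz w hw hzw
    exact splitLast.injective (hinj hz hw ((extChartAt (𝓡∂ 3) k).injOn (hk hz) (hk hw) hzw))
  rw [chartVolume_apply _ _ (measurableSet_chartNormalExp_image hf h hP hPm hinj), hset,
    lintegral_image_eq_lintegral_abs_det_fderiv_mul volume (hemb.measurable hPm) hderiv hinj',
    ← measurePreserving_splitLast.setLIntegral_comp_preimage_emb hemb]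
  refine setLIntegral_congr_fun (hemb.measurable hPm) fun z hz => ?_
  simp only
  rw [← ENNReal.ofReal_mul (abs_nonneg _), abs_det_mul_sqrt_gramMatrix hf hν h (hP hz) (hk hz)]

/-- The volume of a region of the collar is at least the integral of the area elements of the
sheets. -/
lemma lintegral_sqrt_gramMatrix_le (hf : ContMDiff (𝓡 2) (𝓡∂ 3) ∞ f)
    (hν : ∀ p, IsUnitNormalAt (𝓡 2) g.form f p (ν p))
    (h : IsLocalOuterInjRadius g f ν r) {q : S}
    {P : Set (EuclideanSpace ℝ (Fin 2) × ℝ)} (hP : P ⊆ collarDomain q r) (hPm : MeasurableSet P)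
    (hinj : InjOn (chartNormalExp g f ν q) P) :
    ∫⁻ u in P, ENNReal.ofReal √(gramMatrix (pullbackForm (𝓡 2) g.form
          (fun x => normalExp g f ν (x, u.2))) q u.1).det
      ≤ volumeMeasure g.form (chartNormalExp g f ν q '' P) := by
  have : Nonempty M := ⟨f q⟩
  obtain ⟨k, hk⟩ := exists_seq_iUnion_extChartAt_source (I := 𝓡∂ 3) (M := M)
  let K : ℕ → Set M := disjointed fun i => (extChartAt (𝓡∂ 3) (k i)).source
  have hKm : ∀ i, MeasurableSet (K i) := fun i =>
    MeasurableSet.disjointed (fun i => (isOpen_extChartAt_source (k i)).measurableSet) i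
  have hKs : ∀ i, K i ⊆ (extChartAt (𝓡∂ 3) (k i)).source := disjointed_subset _
  have hKd : Pairwise (Function.onFun Disjoint K) := disjoint_disjointed _
  have hKu : ⋃ i, K i = univ := (iUnion_disjointed).trans hk
  let Q : ℕ → Set (EuclideanSpace ℝ (Fin 2) × ℝ) := fun i =>
    P ∩ chartNormalExp g f ν q ⁻¹' K i
  have hQm : ∀ i, MeasurableSet (Q i) := fun i => measurableSet_inter_preimage
    ((contMDiffOn_chartNormalExp hf h q).continuousOn.mono hP) hPm (hKm i)
  have hQd : Pairwise (Function.onFun Disjoint Q) := fun i j hij =>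
    ((hKd hij).preimage _).mono inter_subset_right inter_subset_right
  have hQu : P = ⋃ i, Q i := by
    rw [← inter_iUnion, ← preimage_iUnion, hKu, preimage_univ, inter_univ]
  have himd : Pairwise (Function.onFun Disjoint fun i => chartNormalExp g f ν q '' Q i) :=
    fun i j hij => (hKd hij).mono (image_subset_iff.2 inter_subset_right)
      (image_subset_iff.2 inter_subset_right)
  have hQi : ∀ i, InjOn (chartNormalExp g f ν q) (Q i) := fun i => hinj.mono inter_subset_left
  have hQP : ∀ i, Q i ⊆ collarDomain q r := fun i => inter_subset_left.trans hP
  rw [hQu, lintegral_iUnion hQm hQd, image_iUnion, measure_iUnion himd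
    (fun i => measurableSet_chartNormalExp_image hf h (hQP i) (hQm i) (hQi i))]
  refine ENNReal.tsum_le_tsum fun i => ?_
  rw [← chartVolume_chartNormalExp_image hf hν h (hQP i) (hQm i) (hQi i)
    (fun u hu => hKs i hu.2)]
  exact Measure.le_iff'.1 (le_iSup (fun k => chartVolume g.form k) (k i)) _

end Volume

section Area

variable {M : Type*} [TopologicalSpace M] [ChartedSpace (EuclideanHalfSpace 3) M]
  [IsManifold (𝓡∂ 3) ∞ M]
  {S : Type*} [TopologicalSpace S] [ChartedSpace (EuclideanSpace ℝ (Fin 2)) S]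
  [IsManifold (𝓡 2) ∞ S]
  {g : Metric3 M} {f : S → M} {ν : ∀ p : S, TangentSpace (𝓡∂ 3) (f p)} {r s₀ : ℝ}

lemma continuousOn_det_gramMatrix [T2Space M] (hf : ContMDiff (𝓡 2) (𝓡∂ 3) ∞ f)
    (hν : ∀ p, IsUnitNormalAt (𝓡 2) g.form f p (ν p))
    (h : IsLocalOuterInjRadius g f ν r) (q : S) :
    ContinuousOn (fun y => (gramMatrix (pullbackForm (𝓡 2) g.form f) q y).det)
      (extChartAt (𝓡 2) q).target := by
  have hf0 : f = fun x => normalExp g f ν (x, 0) := funext fun x => (normalExp_zero hν h x).symm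
  have hc : ∀ a b, ContinuousOn (fun y => chartForm (pullbackForm (𝓡 2) g.form f) q y a b)
      (extChartAt (𝓡 2) q).target := by
    intro a b
    have h1 : ContinuousOn (fun y => collarMetric g f ν r q (a, 0) (b, 0) (y, 0))
        (extChartAt (𝓡 2) q).target :=
      (continuousOn_collarMetric hf h q (a, 0) (b, 0)).comp
        (Continuous.prodMk_left (0 : ℝ)).continuousOn (fun y hy => ⟨hy, le_rfl, h.pos⟩)
    refine h1.congr fun y hy => ?_
    have h2 := chartForm_slice hf h (q := q) (y := y) (s := 0) ⟨hy, le_rfl, h.pos⟩ a b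
    rwa [← hf0] at h2
  simp only [gramMatrix_fin_two, Matrix.det_fin_two_of]
  exact ((hc _ _).mul (hc _ _)).sub ((hc _ _).mul (hc _ _))

omit [IsManifold (𝓡 2) ∞ S] in
lemma chartNormalExp_image_prod (q : S) (T : Set S) :
    chartNormalExp g f ν q ''
        (((extChartAt (𝓡 2) q).target ∩ (extChartAt (𝓡 2) q).symm ⁻¹' T) ×ˢ Ico 0 s₀)
      = normalExp g f ν '' ((T ∩ (extChartAt (𝓡 2) q).source) ×ˢ Ico 0 s₀) := by
  ext z
  constructor
  · rintro ⟨⟨y, s⟩, ⟨⟨hy, hyT⟩, hs⟩, rfl⟩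
    exact ⟨((extChartAt (𝓡 2) q).symm y, s), ⟨⟨hyT, (extChartAt (𝓡 2) q).map_target hy⟩, hs⟩, rfl⟩
  · rintro ⟨⟨x, s⟩, ⟨⟨hx, hxq⟩, hs⟩, rfl⟩
    have hinv := (extChartAt (𝓡 2) q).left_inv hxq
    refine ⟨(extChartAt (𝓡 2) q x, s), ⟨⟨(extChartAt (𝓡 2) q).map_source hxq, ?_⟩, hs⟩, ?_⟩
    · rwa [mem_preimage, hinv]
    · simp only [chartNormalExp, hinv]

omit [IsManifold (𝓡 2) ∞ S] in
lemma injOn_chartNormalExp {T : Set S} (hinj : InjOn (normalExp g f ν) (T ×ˢ Ico 0 s₀)) (q : S) :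
    InjOn (chartNormalExp g f ν q)
      (((extChartAt (𝓡 2) q).target ∩ (extChartAt (𝓡 2) q).symm ⁻¹' T) ×ˢ Ico 0 s₀) := by
  rintro ⟨y, s⟩ ⟨⟨hy, hyT⟩, hs⟩ ⟨y', s'⟩ ⟨⟨hy', hyT'⟩, hs'⟩ heq
  have h1 := hinj (show ((extChartAt (𝓡 2) q).symm y, s) ∈ T ×ˢ Ico 0 s₀ from ⟨hyT, hs⟩)
    (show ((extChartAt (𝓡 2) q).symm y', s') ∈ T ×ˢ Ico 0 s₀ from ⟨hyT', hs'⟩) heq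
  rw [Prod.mk.injEq] at h1 ⊢
  exact ⟨(extChartAt (𝓡 2) q).symm.injOn hy hy' h1.1, h1.2⟩

variable [MeasurableSpace S] [BorelSpace S]

omit [IsManifold (𝓡 2) ∞ S] in
lemma measurableSet_chart_preimage (q : S) {T : Set S} (hT : MeasurableSet T) :
    MeasurableSet ((extChartAt (𝓡 2) q).target ∩ (extChartAt (𝓡 2) q).symm ⁻¹' T) :=
  measurableSet_inter_preimage (continuousOn_extChartAt_symm q)
    (measurableSet_extChartAt_target q) hT

variable [T2Space M] [SecondCountableTopology M] [MeasurableSpace M] [BorelSpace M]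

/-- The area of a piece of the surface in a chart is controlled by the volume of the collar over
this piece. -/
lemma chartVolume_mul_le (hf : ContMDiff (𝓡 2) (𝓡∂ 3) ∞ f)
    (hν : ∀ p, IsUnitNormalAt (𝓡 2) g.form f p (ν p))
    (h : IsLocalOuterInjRadius g f ν r) {K : ℝ} (hK0 : 0 ≤ K)
    (hK : 2 * supSecondFund g f ν ≤ ENNReal.ofReal K) (hs₀ : s₀ ≤ r) {T : Set S}
    (hT : MeasurableSet T) (hinj : InjOn (normalExp g f ν) (T ×ˢ Ico 0 s₀)) (q : S) :
    chartVolume (pullbackForm (𝓡 2) g.form f) q T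
        * ENNReal.ofReal (Real.exp (-(3 * K * s₀ / 2)) * s₀)
      ≤ volumeMeasure g.form (normalExp g f ν '' (T ×ˢ Ico 0 s₀)) := by
  set Y := (extChartAt (𝓡 2) q).target ∩ (extChartAt (𝓡 2) q).symm ⁻¹' T with hYdef
  have hY : MeasurableSet Y := measurableSet_chart_preimage q hT
  have hP : Y ×ˢ Ico 0 s₀ ⊆ collarDomain q r :=
    prod_mono inter_subset_left (Ico_subset_Ico_right hs₀)
  have hw : AEMeasurable (fun y => ENNReal.ofReal
      √(gramMatrix (pullbackForm (𝓡 2) g.form f) q y).det) (volume.restrict Y) :=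
    (ENNReal.continuous_ofReal.comp_continuousOn (Real.continuous_sqrt.comp_continuousOn
      ((continuousOn_det_gramMatrix hf hν h q).mono inter_subset_left))).aemeasurable hY
  calc chartVolume (pullbackForm (𝓡 2) g.form f) q T
        * ENNReal.ofReal (Real.exp (-(3 * K * s₀ / 2)) * s₀)
      = (∫⁻ y in Y, ENNReal.ofReal √(gramMatrix (pullbackForm (𝓡 2) g.form f) q y).det)
        * ∫⁻ _ in Ico 0 s₀, ENNReal.ofReal (Real.exp (-(3 * K * s₀ / 2))) := by
        rw [chartVolume_apply _ _ hT, setLIntegral_const, Real.volume_Ico, sub_zero,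
          ENNReal.ofReal_mul (Real.exp_pos _).le]
    _ = ∫⁻ u in Y ×ˢ Ico 0 s₀, ENNReal.ofReal
          √(gramMatrix (pullbackForm (𝓡 2) g.form f) q u.1).det
          * ENNReal.ofReal (Real.exp (-(3 * K * s₀ / 2))) := by
        rw [Measure.volume_eq_prod, ← Measure.prod_restrict]
        exact (lintegral_prod_mul hw aemeasurable_const).symm
    _ ≤ ∫⁻ u in Y ×ˢ Ico 0 s₀, ENNReal.ofReal √(gramMatrix (pullbackForm (𝓡 2) g.form
          (fun x => normalExp g f ν (x, u.2))) q u.1).det := by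
        refine setLIntegral_mono' (hY.prod measurableSet_Ico) fun u hu => ?_
        rw [← ENNReal.ofReal_mul (Real.sqrt_nonneg _)]
        refine ENNReal.ofReal_le_ofReal ?_
        have h1 := exp_mul_det_gramMatrix_le hf hν h hK0 hK q u.1 (hP hu).2
        refine le_trans ?_ (Real.sqrt_le_sqrt h1)
        rw [Real.sqrt_mul (Real.exp_pos _).le, ← Real.exp_half, mul_comm]
        gcongr
        have : K * u.2 ≤ K * s₀ := mul_le_mul_of_nonneg_left hu.2.2.le hK0
        linarith
    _ ≤ volumeMeasure g.form (chartNormalExp g f ν q '' (Y ×ˢ Ico 0 s₀)) :=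
        lintegral_sqrt_gramMatrix_le hf hν h hP (hY.prod measurableSet_Ico)
          (injOn_chartNormalExp hinj q)
    _ ≤ volumeMeasure g.form (normalExp g f ν '' (T ×ˢ Ico 0 s₀)) := by
        rw [hYdef, chartNormalExp_image_prod]
        exact measure_mono (image_mono (prod_mono inter_subset_left subset_rfl))

variable [SecondCountableTopology S]

lemma measurableSet_normalExp_image (hf : ContMDiff (𝓡 2) (𝓡∂ 3) ∞ f)
    (h : IsLocalOuterInjRadius g f ν r) (hs₀ : s₀ ≤ r) {T : Set S}
    (hT : MeasurableSet T) (hinj : InjOn (normalExp g f ν) (T ×ˢ Ico 0 s₀)) :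
    MeasurableSet (normalExp g f ν '' (T ×ˢ Ico 0 s₀)) := by
  rcases isEmpty_or_nonempty S with hS | hS
  · rw [eq_empty_of_isEmpty T, empty_prod, image_empty]
    exact MeasurableSet.empty
  obtain ⟨q, hq⟩ := exists_seq_iUnion_extChartAt_source (I := 𝓡 2) (M := S)
  have hcov : normalExp g f ν '' (T ×ˢ Ico 0 s₀) = ⋃ i, chartNormalExp g f ν (q i) ''
      (((extChartAt (𝓡 2) (q i)).target ∩ (extChartAt (𝓡 2) (q i)).symm ⁻¹' T) ×ˢ Ico 0 s₀) := by
    simp only [chartNormalExp_image_prod]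
    rw [← image_iUnion, ← iUnion_prod_const, ← inter_iUnion, hq, inter_univ]
  rw [hcov]
  refine MeasurableSet.iUnion fun i => measurableSet_chartNormalExp_image hf h
    (prod_mono inter_subset_left (Ico_subset_Ico_right hs₀))
    ((measurableSet_chart_preimage (q i) hT).prod measurableSet_Ico)
    (injOn_chartNormalExp hinj (q i))

/-- The area of a surface with an embedded collar is controlled by the volume. -/
lemma area_mul_le (hf : ContMDiff (𝓡 2) (𝓡∂ 3) ∞ f)
    (hν : ∀ p, IsUnitNormalAt (𝓡 2) g.form f p (ν p))
    (h : IsLocalOuterInjRadius g f ν r) {K : ℝ} (hK0 : 0 ≤ K)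
    (hK : 2 * supSecondFund g f ν ≤ ENNReal.ofReal K) (hs₀ : s₀ ≤ r) (hpos : 0 < s₀)
    (hinj : InjOn (normalExp g f ν) (univ ×ˢ Ico 0 s₀)) :
    area g f * ENNReal.ofReal (Real.exp (-(3 * K * s₀ / 2)) * s₀) ≤ totalVolume g := by
  set κ := ENNReal.ofReal (Real.exp (-(3 * K * s₀ / 2)) * s₀) with hκ
  have hκ0 : κ ≠ 0 := by
    rw [hκ, Ne, ENNReal.ofReal_eq_zero, not_le]
    positivity
  have hκt : κ ≠ ⊤ := ENNReal.ofReal_ne_top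
  have hinjT : ∀ T : Set S, InjOn (normalExp g f ν) (T ×ˢ Ico 0 s₀) := fun T =>
    hinj.mono (prod_mono (subset_univ T) subset_rfl)
  let μ : Measure S := Measure.ofMeasurable
    (fun T _ => volumeMeasure g.form (normalExp g f ν '' (T ×ˢ Ico 0 s₀))) (by simp) (by
      intro T hT hd
      rw [iUnion_prod_const, image_iUnion]
      refine measure_iUnion (fun i j hij => ?_)
        (fun i => measurableSet_normalExp_image hf h hs₀ (hT i) (hinjT _))
      exact (disjoint_prod.2 (Or.inl (hd hij))).image hinj (prod_mono (subset_univ _) subset_rfl)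
        (prod_mono (subset_univ _) subset_rfl))
  have hμ : ∀ T, MeasurableSet T →
      μ T = volumeMeasure g.form (normalExp g f ν '' (T ×ˢ Ico 0 s₀)) := fun T hT =>
    Measure.ofMeasurable_apply T hT
  have hle : volumeMeasure (pullbackForm (𝓡 2) g.form f) ≤ κ⁻¹ • μ := by
    refine iSup_le fun q => Measure.le_iff.2 fun T hT => ?_
    rw [Measure.smul_apply, smul_eq_mul, hμ T hT, ← ENNReal.div_eq_inv_mul,
      ENNReal.le_div_iff_mul_le (Or.inl hκ0) (Or.inl hκt)]
    exact chartVolume_mul_le hf hν h hK0 hK hs₀ hT (hinjT T) q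
  rw [← ENNReal.le_div_iff_mul_le (Or.inl hκ0) (Or.inl hκt)]
  refine (Measure.le_iff'.1 hle univ).trans ?_
  rw [Measure.smul_apply, smul_eq_mul, hμ _ MeasurableSet.univ, ← ENNReal.div_eq_inv_mul]
  exact ENNReal.div_le_div_right (measure_mono (subset_univ _)) _

/-- In a manifold of volume zero, surfaces have area zero. -/
lemma area_eq_zero (hf : ContMDiff (𝓡 2) (𝓡∂ 3) ∞ f)
    (hν : ∀ p, IsUnitNormalAt (𝓡 2) g.form f p (ν p))
    (h : IsLocalOuterInjRadius g f ν r) (hfin : supSecondFund g f ν ≠ ⊤)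
    (hvol : totalVolume g = 0) : area g f = 0 := by
  have hzero : ∀ q, chartVolume (pullbackForm (𝓡 2) g.form f) q = 0 := by
    intro q
    rw [← Measure.measure_univ_eq_zero]
    refine measure_null_of_locally_null _ fun x _ => ?_
    obtain ⟨U, hU, hUo, hxU⟩ := mem_nhds_iff.1 (intrinsicBall_mem_nhds g hf x h.pos)
    refine ⟨U, mem_nhdsWithin_of_mem_nhds (hUo.mem_nhds hxU), ?_⟩
    obtain ⟨-, ψ, -, hψ⟩ := h.diffeo x
    have hle := chartVolume_mul_le hf hν h (K := 2 * (supSecondFund g f ν).toReal) (by positivity)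
      (by rw [ENNReal.ofReal_mul (by norm_num), ENNReal.ofReal_toReal hfin]; simp) le_rfl
      hUo.measurableSet (hψ.injOn.mono (prod_mono hU subset_rfl)) q
    have h0 : volumeMeasure g.form (normalExp g f ν '' (U ×ˢ Ico 0 r)) = 0 :=
      measure_mono_null (subset_univ _) hvol
    rw [h0, nonpos_iff_eq_zero, mul_eq_zero, ENNReal.ofReal_eq_zero] at hle
    refine hle.resolve_right (not_le.2 ?_)
    have := h.pos
    positivity
  have hle : volumeMeasure (pullbackForm (𝓡 2) g.form f) ≤ 0 := iSup_le fun q => (hzero q).le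
  exact nonpos_iff_eq_zero.1 (Measure.le_iff'.1 hle univ)

end Area

section Main

variable {M : Type*} [TopologicalSpace M] [ChartedSpace (EuclideanHalfSpace 3) M]
  [IsManifold (𝓡∂ 3) ∞ M]
  {S : Type*} [TopologicalSpace S] [ChartedSpace (EuclideanSpace ℝ (Fin 2)) S]
  {g : Metric3 M} {f : S → M} {ν : ∀ p : S, TangentSpace (𝓡∂ 3) (f p)}

omit [TopologicalSpace S] [ChartedSpace (EuclideanSpace ℝ (Fin 2)) S] in
lemma injOn_of_lt_outerInjRadius {s : ℝ} (hs : ENNReal.ofReal s < outerInjRadius g f ν) :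
    InjOn (normalExp g f ν) (univ ×ˢ Ico 0 s) := by
  simp only [outerInjRadius, lt_iSup_iff] at hs
  obtain ⟨δ, ⟨-, hinj⟩, hlt⟩ := hs
  exact hinj.mono (prod_mono subset_rfl
    (Ico_subset_Ico_right (ENNReal.ofReal_lt_ofReal_iff'.1 hlt).1.le))

/-- The choice of the thickness of the collar. -/
lemma exists_thickness {a d : ℝ} (ha : 0 ≤ a) (hd : 0 < d) :
    ∃ s, 0 < s ∧ s < d ∧
      1 ≤ 2 * Real.exp (3 / 2) * (d⁻¹ + a) * (Real.exp (-(3 * (2 * a) * s / 2)) * s) := by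
  have h1 : 0 < 1 + a * d := by positivity
  refine ⟨d / (2 * (1 + a * d)), by positivity, ?_, ?_⟩
  · rw [div_lt_iff₀ (by positivity)]
    nlinarith [mul_nonneg ha hd.le]
  · have h2 : a * (d / (2 * (1 + a * d))) ≤ 1 / 2 := by
      rw [mul_div_assoc', div_le_iff₀ (by positivity)]
      nlinarith
    have h3 : 2 * (d⁻¹ + a) * (d / (2 * (1 + a * d))) = 1 := by
      field_simp
    set s := d / (2 * (1 + a * d))
    calc (1 : ℝ) ≤ Real.exp (3 / 2 + -(3 * (2 * a) * s / 2)) := by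
          rw [Real.one_le_exp_iff]
          linarith
      _ = Real.exp (3 / 2) * Real.exp (-(3 * (2 * a) * s / 2)) * (2 * (d⁻¹ + a) * s) := by
          rw [h3, mul_one, Real.exp_add]
      _ = _ := by ring

end Main

end AreaBound

end

theorem mainTheorem10 :
    ∃ c : ℝ≥0, ∀ (M : Type*) [TopologicalSpace M] [T2Space M] [CompactSpace M]
      [ChartedSpace (EuclideanHalfSpace 3) M] [IsManifold (𝓡∂ 3) ∞ M]
      [MeasurableSpace M] [BorelSpace M]
      (S : Type*) [TopologicalSpace S] [ChartedSpace (EuclideanSpace ℝ (Fin 2)) S]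
      [IsManifold (𝓡 2) ∞ S] [MeasurableSpace S] [BorelSpace S]
      (g : AreaBound.Metric3 M) (f : S → M) (ν : ∀ p : S, TangentSpace (𝓡∂ 3) (f p))
      (C i₀ : ℝ),
      Manifold.IsSmoothEmbedding (𝓡 2) (𝓡∂ 3) ∞ f →
      AreaBound.IsUnitNormalField (𝓡 2) g.form f ν →
      (∀ p : S, AreaBound.secondFundNorm (𝓡 2) g.form f p (ν p) ≤ C) →
      AreaBound.IsLocalOuterInjRadius g f ν i₀ →
      AreaBound.area g f
        ≤ c * ((min (ENNReal.ofReal i₀) (AreaBound.outerInjRadius g f ν))⁻¹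
            + AreaBound.supSecondFund g f ν) * AreaBound.totalVolume g := by
  refine ⟨(2 * Real.exp (3 / 2)).toNNReal, ?_⟩
  intro M _ _ _ _ _ _ _ S _ _ _ _ _ g f ν C i₀ hemb hν hC h
  have hf : ContMDiff (𝓡 2) (𝓡∂ 3) ∞ f := hemb.contMDiff
  have : SecondCountableTopology (EuclideanHalfSpace 3) :=
    inferInstanceAs (SecondCountableTopology {x : EuclideanSpace ℝ (Fin 3) // 0 ≤ x 0})
  have : SecondCountableTopology M :=
    ChartedSpace.secondCountable_of_sigmaCompact (EuclideanHalfSpace 3) M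
  have : SecondCountableTopology S := hemb.isEmbedding.secondCountableTopology
  set A := AreaBound.supSecondFund g f ν
  set δ := min (ENNReal.ofReal i₀) (AreaBound.outerInjRadius g f ν) with hδ
  have hA : A ≠ ⊤ := ne_top_of_le_ne_top ENNReal.ofReal_ne_top
    (iSup_le fun p => ENNReal.ofReal_le_ofReal (hC p))
  have hδt : δ ≠ ⊤ := ne_top_of_le_ne_top ENNReal.ofReal_ne_top (min_le_left _ _)
  rcases eq_or_ne δ 0 with h0 | h0
  · rcases eq_or_ne (AreaBound.totalVolume g) 0 with hv | hv
    · rw [AreaBound.area_eq_zero hf hν.2 h hA hv]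
      exact zero_le
    · have hc : ((2 * Real.exp (3 / 2)).toNNReal : ℝ≥0∞) ≠ 0 := by
        simp [Real.exp_pos]
      rw [h0, ENNReal.inv_zero, top_add, ENNReal.mul_top hc, ENNReal.top_mul hv]
      exact le_top
  · obtain ⟨s, hs, hsd, hle⟩ := AreaBound.exists_thickness (a := A.toReal) (d := δ.toReal)
      ENNReal.toReal_nonneg (ENNReal.toReal_pos h0 hδt)
    have hsδ : ENNReal.ofReal s < δ := (ENNReal.ofReal_lt_iff_lt_toReal hs.le hδt).2 hsd
    have hsi : s ≤ i₀ := by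
      have := hsδ.trans_le (min_le_left _ _)
      exact (ENNReal.ofReal_lt_ofReal_iff h.pos).1 this |>.le
    have hmul := AreaBound.area_mul_le hf hν.2 h (K := 2 * A.toReal) (by positivity)
      (by rw [ENNReal.ofReal_mul (by norm_num), ENNReal.ofReal_toReal hA]; simp [A]) hsi hs
      (AreaBound.injOn_of_lt_outerInjRadius (hsδ.trans_le (min_le_right _ _)))
    set κ := Real.exp (-(3 * (2 * A.toReal) * s / 2)) * s
    have hcoef : ((2 * Real.exp (3 / 2)).toNNReal : ℝ≥0∞) * (δ⁻¹ + A)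
        = ENNReal.ofReal (2 * Real.exp (3 / 2) * (δ.toReal⁻¹ + A.toReal)) := by
      rw [ENNReal.ofReal_mul (by positivity), ENNReal.ofReal_add (by positivity) (by positivity),
        ENNReal.ofReal_inv_of_pos (ENNReal.toReal_pos h0 hδt), ENNReal.ofReal_toReal hA,
        ENNReal.ofReal_toReal hδt]
      rfl
    calc AreaBound.area g f ≤ AreaBound.area g f * ENNReal.ofReal
          (2 * Real.exp (3 / 2) * (δ.toReal⁻¹ + A.toReal) * κ) :=
          le_mul_of_one_le_right' (ENNReal.one_le_ofReal.2 hle)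
      _ = ENNReal.ofReal (2 * Real.exp (3 / 2) * (δ.toReal⁻¹ + A.toReal))
          * (AreaBound.area g f * ENNReal.ofReal κ) := by
          rw [ENNReal.ofReal_mul (by positivity), mul_left_comm]
      _ ≤ _ := by
          rw [hcoef]
          gcongr
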